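/- Let $\mathcal G\rightrightarrows M$ be a (finite-dimensional, real, smooth) Lie groupoid over a Hausdorff manifold $M$, with source $s$, target $t$, units $M\hookrightarrow\mathcal G$, inversion $\mathrm{inv}$, and with product $g\circ h$ defined when $s(g)=t(h)$. Let $E=\mathrm{Lie}(\mathcal G)=\mathsf T\mathcal G|_M/\mathsf TM$ be its Lie algebroid, with anchor $\alpha:E\to\mathsf TM$ induced by $\mathsf Ts-\mathsf Tt$. For $X\in\mathrm{Sec}(E)$ let $X^L$ (respectively $X^R$) be the left-invariant (respectively right-invariant) vector field on $\mathcal G$, tangent to the fibres of $t$ (respectively $s$), that represents $X$ along $M$; the bracket on $\mathrm{Sec}(E)$ is given by $[X,Y]^L=[X^L,Y^L]$. Let $F:\mathcal G\to\mathbb R$ be a contrast function, i.e. a smooth function with $F|_M=0$ and $dF|_M=0$; then so is $F^*=F\circ\mathrm{inv}$. Let $g^F$ be the symmetric form $g^F(X,Y)=X^LY^LF|_M$ on $E$ (it is equal to $g^{F^*}$) and $K^F=\{X\in E: g^F(X,\cdot)=0\}$. Assume that $F$ is a Koszul contrast function: $K^F$ has constant rank, and $X^LY^LZ^RF|_M=0$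 and $X^LY^LZ^RF^*|_M=0$ for all $X,Y\in\mathrm{Sec}(E)$ and $Z\in\mathrm{Sec}(K^F)$. Let $L^F=E/K^F$, write $\bar X$ for the class of $X$, and let $g^{[F]}(\bar X,\bar Y)=g^F(X,Y)$ be the induced (nondegenerate) transversal metric on $L^F$. An $E$-connection on $L^F$ is an $\mathbb R$-bilinear map $\nabla:\mathrm{Sec}(E)\times\mathrm{Sec}(L^F)\to\mathrm{Sec}(L^F)$ with $\nabla_{fX}\sigma=f\nabla_X\sigma$ and $\nabla_X(f\sigma)=f\nabla_X\sigma+(\alpha(X)f)\sigma$ for $f\in C^\infty(M)$. Theorem. There are unique $E$-connections $\nabla^{[F]}$ and $\nabla^{[F^*]}$ on $L^F$ (the Koszul connections) such that, for all $X,Y,Z\in\mathrm{Sec}(E)$, $$g^{[F]}(\nabla^{[F]}_X\bar Y,\bar Z)=X^LY^LZ^RF|_M,\qquad g^{[F]}(\nabla^{[F^*]}_X\bar Y,\bar Z)=X^LY^LZ^RF^*|_M,$$ and there is a unique $E$-connection $\nabla^{[g]}$ on $L^F$ (the transversal Levi-Civita connection) that is torsion-free, $\nabla^{[g]}_X\bar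 Y-\nabla^{[g]}_Y\bar X=\overline{[X,Y]}$ for all $X,Y\in\mathrm{Sec}(E)$, and metric, $\alpha(X)\,g^{[F]}(\sigma,\tau)=g^{[F]}(\nabla^{[g]}_X\sigma,\tau)+g^{[F]}(\sigma,\nabla^{[g]}_X\tau)$ for all $X\in\mathrm{Sec}(E)$ and $\sigma,\tau\in\mathrm{Sec}(L^F)$. The formula $$T^{[F]}(\bar X,\bar Y,\bar Z)=g^{[F]}\bigl(\nabla^{[F]}_X\bar Y-\nabla^{[F^*]}_X\bar Y,\bar Z\bigr)$$ is well defined: there is exactly one field $T^{[F]}$ of trilinear forms on the fibres of $L^F$ that satisfies it for all $X,Y,Z\in\mathrm{Sec}(E)$. This field is smooth and totally symmetric, i.e. $T^{[F]}\in\mathrm{Sec}(\bigodot^3(L^F)^*)$. For all $X,Y,Z\in\mathrm{Sec}(E)$, $$g^{[F]}(\nabla^{[F]}_X\bar Y,\bar Z)=g^{[F]}(\nabla^{[g]}_X\bar Y,\bar Z)+\tfrac12T^{[F]}(\bar X,\bar Y,\bar Z),$$ $$g^{[F]}(\nabla^{[F^*]}_X\bar Y,\bar Z)=g^{[F]}(\nabla^{[g]}_X\bar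 Y,\bar Z)-\tfrac12T^{[F]}(\bar X,\bar Y,\bar Z).$$ In particular, $T^{[F]}=0$ if $F=F^*$. -/

import Mathlib

open scoped Manifold ContDiff Topology

noncomputable section

set_option linter.unusedSectionVars false

/-- A Lie groupoid `G ⇉ M`: finite-dimensional smooth manifolds without boundary, source and target
submersions, units, inversion, and a multiplication `mul g h` of the composable pairs, those with
`src g = tgt h` (the values of `mul` on other pairs are irrelevant).  The map `unit` is automatically a
smooth embedding and `src`, `tgt` are automatically surjective, since `src ∘ unit = tgt ∘ unit = id`.
Smoothness of the multiplication is smoothness on the submanifold of composable pairs of `G × G`. -/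
structure LieGroupoid (EM M EG G : Type*)
    [NormedAddCommGroup EM] [NormedSpace ℝ EM] [FiniteDimensional ℝ EM]
    [TopologicalSpace M] [ChartedSpace EM M] [IsManifold 𝓘(ℝ, EM) ∞ M]
    [NormedAddCommGroup EG] [NormedSpace ℝ EG] [FiniteDimensional ℝ EG]
    [TopologicalSpace G] [ChartedSpace EG G] [IsManifold 𝓘(ℝ, EG) ∞ G] where
  src : G → M
  tgt : G → M
  unit : M → G
  inv : G → G
  mul : G → G → G
  src_unit : ∀ x, src (unit x) = x
  tgt_unit : ∀ x, tgt (unit x) = x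
  src_mul : ∀ g h, src g = tgt h → src (mul g h) = src h
  tgt_mul : ∀ g h, src g = tgt h → tgt (mul g h) = tgt g
  mul_assoc : ∀ g h k, src g = tgt h → src h = tgt k → mul (mul g h) k = mul g (mul h k)
  unit_mul : ∀ g, mul (unit (tgt g)) g = g
  mul_unit : ∀ g, mul g (unit (src g)) = g
  src_inv : ∀ g, src (inv g) = tgt g
  tgt_inv : ∀ g, tgt (inv g) = src g
  mul_inv : ∀ g, mul g (inv g) = unit (tgt g)
  inv_mul : ∀ g, mul (inv g) g = unit (src g)
  contMDiff_src : ContMDiff 𝓘(ℝ, EG) 𝓘(ℝ, EM) ∞ src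
  contMDiff_tgt : ContMDiff 𝓘(ℝ, EG) 𝓘(ℝ, EM) ∞ tgt
  contMDiff_unit : ContMDiff 𝓘(ℝ, EM) 𝓘(ℝ, EG) ∞ unit
  contMDiff_inv : ContMDiff 𝓘(ℝ, EG) 𝓘(ℝ, EG) ∞ inv
  contMDiffOn_mul : ContMDiffOn (𝓘(ℝ, EG).prod 𝓘(ℝ, EG)) 𝓘(ℝ, EG) ∞
    (fun p : G × G => mul p.1 p.2) {p : G × G | src p.1 = tgt p.2}
  submersion_src : ∀ g, Function.Surjective (mfderiv 𝓘(ℝ, EG) 𝓘(ℝ, EM) src g)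
  submersion_tgt : ∀ g, Function.Surjective (mfderiv 𝓘(ℝ, EG) 𝓘(ℝ, EM) tgt g)

namespace LieGroupoid

variable {EM M EG G : Type*}
    [NormedAddCommGroup EM] [NormedSpace ℝ EM] [FiniteDimensional ℝ EM]
    [TopologicalSpace M] [ChartedSpace EM M] [IsManifold 𝓘(ℝ, EM) ∞ M]
    [NormedAddCommGroup EG] [NormedSpace ℝ EG] [FiniteDimensional ℝ EG]
    [TopologicalSpace G] [ChartedSpace EG G] [IsManifold 𝓘(ℝ, EG) ∞ G]
    (𝒢 : LieGroupoid EM M EG G)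

/-! ### The Lie algebroid -/

/-- The identification of the tangent spaces of a manifold at two equal points. -/
def tangentCast {V N : Type*} [NormedAddCommGroup V] [NormedSpace ℝ V] [TopologicalSpace N]
    [ChartedSpace V N] {p q : N} (h : p = q) :
    TangentSpace 𝓘(ℝ, V) p →ₗ[ℝ] TangentSpace 𝓘(ℝ, V) q :=
  h ▸ LinearMap.id

/-- The differential `T_x M → T_{1_x} G` of the unit embedding. -/
def dUnit (x : M) : TangentSpace 𝓘(ℝ, EM) x →ₗ[ℝ] TangentSpace 𝓘(ℝ, EG) (𝒢.unit x) :=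
  (mfderiv 𝓘(ℝ, EM) 𝓘(ℝ, EG) 𝒢.unit x).toLinearMap

/-- The differential `T_{1_x} G → T_x M` of the source map at a unit. -/
def dSrc (x : M) : TangentSpace 𝓘(ℝ, EG) (𝒢.unit x) →ₗ[ℝ] TangentSpace 𝓘(ℝ, EM) x :=
  tangentCast (𝒢.src_unit x) ∘ₗ (mfderiv 𝓘(ℝ, EG) 𝓘(ℝ, EM) 𝒢.src (𝒢.unit x)).toLinearMap

/-- The differential `T_{1_x} G → T_x M` of the target map at a unit. -/
def dTgt (x : M) : TangentSpace 𝓘(ℝ, EG) (𝒢.unit x) →ₗ[ℝ] TangentSpace 𝓘(ℝ, EM) x :=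
  tangentCast (𝒢.tgt_unit x) ∘ₗ (mfderiv 𝓘(ℝ, EG) 𝓘(ℝ, EM) 𝒢.tgt (𝒢.unit x)).toLinearMap

theorem tangentCast_mfderiv {f : M → M} (hf : f = id) (x : M) (h : f x = x)
    (v : TangentSpace 𝓘(ℝ, EM) x) :
    tangentCast h (mfderiv 𝓘(ℝ, EM) 𝓘(ℝ, EM) f x v) = v := by
  subst hf
  rw [mfderiv_id]
  rfl

theorem dSrc_dUnit (x : M) (v : TangentSpace 𝓘(ℝ, EM) x) : 𝒢.dSrc x (𝒢.dUnit x v) = v := by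
  have h1 : MDifferentiableAt 𝓘(ℝ, EM) 𝓘(ℝ, EG) 𝒢.unit x :=
    (𝒢.contMDiff_unit x).mdifferentiableAt (by simp)
  have h2 : MDifferentiableAt 𝓘(ℝ, EG) 𝓘(ℝ, EM) 𝒢.src (𝒢.unit x) :=
    (𝒢.contMDiff_src _).mdifferentiableAt (by simp)
  have h3 := tangentCast_mfderiv (funext 𝒢.src_unit : 𝒢.src ∘ 𝒢.unit = id) x (𝒢.src_unit x) v
  rw [mfderiv_comp x h2 h1] at h3
  exact h3

theorem dTgt_dUnit (x : M) (v : TangentSpace 𝓘(ℝ, EM) x) : 𝒢.dTgt x (𝒢.dUnit x v) = v := by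
  have h1 : MDifferentiableAt 𝓘(ℝ, EM) 𝓘(ℝ, EG) 𝒢.unit x :=
    (𝒢.contMDiff_unit x).mdifferentiableAt (by simp)
  have h2 : MDifferentiableAt 𝓘(ℝ, EG) 𝓘(ℝ, EM) 𝒢.tgt (𝒢.unit x) :=
    (𝒢.contMDiff_tgt _).mdifferentiableAt (by simp)
  have h3 := tangentCast_mfderiv (funext 𝒢.tgt_unit : 𝒢.tgt ∘ 𝒢.unit = id) x (𝒢.tgt_unit x) v
  rw [mfderiv_comp x h2 h1] at h3
  exact h3

/-- The tangent space `T_{1_x} G` of the groupoid at the unit `1_x`. -/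
abbrev UnitTangent (x : M) : Type _ := TangentSpace 𝓘(ℝ, EG) (𝒢.unit x)

/-- The subspace `T_x M` of `T_{1_x} G`. -/
def tangentUnits (x : M) : Submodule ℝ (𝒢.UnitTangent x) := LinearMap.range (𝒢.dUnit x)

/-- The fibre `E_x = T_{1_x} G / T_x M` of the Lie algebroid `E = Lie(G)`. -/
abbrev Fibre (x : M) : Type _ := 𝒢.UnitTangent x ⧸ 𝒢.tangentUnits x

/-- The representative of an element of `E_x` that is tangent to the target fibre:
the class of `v` has the representative `v - T1 (Tt v)`. -/
def leftRep (x : M) : 𝒢.Fibre x →ₗ[ℝ] 𝒢.UnitTangent x :=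
  (𝒢.tangentUnits x).liftQ (LinearMap.id - 𝒢.dUnit x ∘ₗ 𝒢.dTgt x) (by
    rintro _ ⟨v, rfl⟩
    exact sub_eq_zero.mpr (congrArg (𝒢.dUnit x) (𝒢.dTgt_dUnit x v).symm))

/-- The representative of an element of `E_x` that is tangent to the source fibre:
the class of `v` has the representative `v - T1 (Ts v)`. -/
def rightRep (x : M) : 𝒢.Fibre x →ₗ[ℝ] 𝒢.UnitTangent x :=
  (𝒢.tangentUnits x).liftQ (LinearMap.id - 𝒢.dUnit x ∘ₗ 𝒢.dSrc x) (by
    rintro _ ⟨v, rfl⟩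
    exact sub_eq_zero.mpr (congrArg (𝒢.dUnit x) (𝒢.dSrc_dUnit x v).symm))

/-- The anchor `E_x → T_x M`, induced by `Ts - Tt`. -/
def anchor (x : M) : 𝒢.Fibre x →ₗ[ℝ] TangentSpace 𝓘(ℝ, EM) x :=
  (𝒢.tangentUnits x).liftQ (𝒢.dSrc x - 𝒢.dTgt x) (by
    rintro _ ⟨v, rfl⟩
    exact sub_eq_zero.mpr ((𝒢.dSrc_dUnit x v).trans (𝒢.dTgt_dUnit x v).symm))

/-- Smoothness of a section of the restricted tangent bundle `TG|_M`. -/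
def SmoothAlong (V : ∀ x, 𝒢.UnitTangent x) : Prop :=
  ContMDiff 𝓘(ℝ, EM) 𝓘(ℝ, EG).tangent ∞
    (fun x => (⟨𝒢.unit x, V x⟩ : TangentBundle 𝓘(ℝ, EG) G))

theorem smoothAlong_iff (V : ∀ x, 𝒢.UnitTangent x) :
    𝒢.SmoothAlong V ↔ ∀ x₀, ContMDiffAt 𝓘(ℝ, EM) 𝓘(ℝ, EG) ∞
      (fun x => (trivializationAt EG (TangentSpace 𝓘(ℝ, EG)) (𝒢.unit x₀)
        (⟨𝒢.unit x, V x⟩ : TangentBundle 𝓘(ℝ, EG) G)).2) x₀ := by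
  refine forall_congr' fun x₀ => ?_
  rw [Bundle.contMDiffAt_totalSpace]
  exact and_iff_right (𝒢.contMDiff_unit x₀)

theorem eventually_mem_baseSet (x₀ : M) : ∀ᶠ x in 𝓝 x₀, 𝒢.unit x ∈
    (trivializationAt EG (TangentSpace 𝓘(ℝ, EG)) (𝒢.unit x₀)).baseSet :=
  (𝒢.contMDiff_unit.continuous.continuousAt).eventually
    ((trivializationAt EG (TangentSpace 𝓘(ℝ, EG)) (𝒢.unit x₀)).open_baseSet.mem_nhds
      (FiberBundle.mem_baseSet_trivializationAt' _))

variable {𝒢} in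
theorem SmoothAlong.add {V W : ∀ x, 𝒢.UnitTangent x}
    (hV : 𝒢.SmoothAlong V) (hW : 𝒢.SmoothAlong W) : 𝒢.SmoothAlong (fun x => V x + W x) := by
  rw [smoothAlong_iff] at *
  intro x₀
  refine ((hV x₀).add (hW x₀)).congr_of_eventuallyEq ?_
  filter_upwards [𝒢.eventually_mem_baseSet x₀] with x hx
  exact ((trivializationAt EG (TangentSpace 𝓘(ℝ, EG)) (𝒢.unit x₀)).linear ℝ hx).1 (V x) (W x)

variable {𝒢} in
theorem SmoothAlong.smul {V : ∀ x, 𝒢.UnitTangent x} {f : M → ℝ}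
    (hf : ContMDiff 𝓘(ℝ, EM) 𝓘(ℝ, ℝ) ∞ f) (hV : 𝒢.SmoothAlong V) :
    𝒢.SmoothAlong (fun x => f x • V x) := by
  rw [smoothAlong_iff] at *
  intro x₀
  refine ((hf x₀).smul (hV x₀)).congr_of_eventuallyEq ?_
  filter_upwards [𝒢.eventually_mem_baseSet x₀] with x hx
  exact ((trivializationAt EG (TangentSpace 𝓘(ℝ, EG)) (𝒢.unit x₀)).linear ℝ hx).2 (f x) (V x)

variable {𝒢} in
theorem SmoothAlong.zero : 𝒢.SmoothAlong (fun _ => 0) := by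
  rw [smoothAlong_iff]
  intro x₀
  refine (contMDiffAt_const (c := (0 : EG))).congr_of_eventuallyEq ?_
  filter_upwards [𝒢.eventually_mem_baseSet x₀] with x hx
  exact (((trivializationAt EG (TangentSpace 𝓘(ℝ, EG)) (𝒢.unit x₀)).linear ℝ hx).mk' _).map_zero

/-- The space `Sec(E)` of smooth sections of the Lie algebroid: those represented by a smooth section
of `TG|_M`. -/
def Sec : Submodule ℝ (∀ x, 𝒢.Fibre x) where
  carrier := {X | ∃ V : ∀ x, 𝒢.UnitTangent x, 𝒢.SmoothAlong V ∧
    ∀ x, X x = (𝒢.tangentUnits x).mkQ (V x)}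
  add_mem' := by
    rintro X Y ⟨V, hV, hX⟩ ⟨W, hW, hY⟩
    exact ⟨_, hV.add hW, fun x => by rw [Pi.add_apply, hX, hY, map_add]⟩
  zero_mem' := ⟨_, SmoothAlong.zero, fun x => by rw [map_zero]; rfl⟩
  smul_mem' := by
    rintro c X ⟨V, hV, hX⟩
    exact ⟨_, hV.smul (f := fun _ => c) contMDiff_const, fun x => by rw [Pi.smul_apply, hX, map_smul]⟩

/-- The product `f X` of a section of `E` with a smooth function. -/
def smulSec (f : C^∞⟮𝓘(ℝ, EM), M; 𝓘(ℝ, ℝ), ℝ⟯) (X : 𝒢.Sec) : 𝒢.Sec :=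
  ⟨fun x => f x • X.1 x, by
    obtain ⟨V, hV, hX⟩ := X.2
    exact ⟨_, hV.smul f.contMDiff, fun x => by simp only [hX, map_smul]⟩⟩

/-- The left-invariant vector field `X^L` on `G`, `X^L(g) = TL_g (X^L(1_{s(g)}))`, where
`X^L(1_x)` is the representative of `X(x)` tangent to the target fibre.  The left translation
`L_g(h) = g ∘ h` is defined on the target fibre over `s(g)`; the vector `X^L(1_{s(g)})` is tangent to
this fibre, so the value does not depend on the derivative within the fibre that `mfderivWithin`
selects, and it lies in the tangent space at `g ∘ 1_{s(g)} = g`. -/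
def leftField (X : ∀ x, 𝒢.Fibre x) (g : G) : TangentSpace 𝓘(ℝ, EG) g :=
  tangentCast (𝒢.mul_unit g)
    (mfderivWithin 𝓘(ℝ, EG) 𝓘(ℝ, EG) (fun h => 𝒢.mul g h) {h | 𝒢.src g = 𝒢.tgt h}
      (𝒢.unit (𝒢.src g)) (𝒢.leftRep (𝒢.src g) (X (𝒢.src g))))

/-- The right-invariant vector field `X^R` on `G`, `X^R(g) = TR_g (X^R(1_{t(g)}))`, where
`X^R(1_x)` is the representative of `X(x)` tangent to the source fibre.  The right translation
`R_g(h) = h ∘ g` is defined on the source fibre over `t(g)`. -/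
def rightField (X : ∀ x, 𝒢.Fibre x) (g : G) : TangentSpace 𝓘(ℝ, EG) g :=
  tangentCast (𝒢.unit_mul g)
    (mfderivWithin 𝓘(ℝ, EG) 𝓘(ℝ, EG) (fun h => 𝒢.mul h g) {h | 𝒢.src h = 𝒢.tgt g}
      (𝒢.unit (𝒢.tgt g)) (𝒢.rightRep (𝒢.tgt g) (X (𝒢.tgt g))))

/-- The bracket `[X, Y]` on sections of `E`, determined by `[X, Y]^L = [X^L, Y^L]`: its value at `x` is
the class of `[X^L, Y^L](1_x)`. -/
def bracket (X Y : 𝒢.Sec) (x : M) : 𝒢.Fibre x :=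
  (𝒢.tangentUnits x).mkQ
    (VectorField.mlieBracket 𝓘(ℝ, EG) (𝒢.leftField X.1) (𝒢.leftField Y.1) (𝒢.unit x))

/-- The derivative `V f` of a function on `G` along a vector field. -/
def along (V : ∀ g : G, TangentSpace 𝓘(ℝ, EG) g) (f : G → ℝ) (g : G) : ℝ :=
  mfderiv 𝓘(ℝ, EG) 𝓘(ℝ, ℝ) f g (V g)

/-- The derivative `α(X) f` of a function on `M`. -/
def anchorDeriv (X : 𝒢.Sec) (f : M → ℝ) (x : M) : ℝ :=
  mfderiv 𝓘(ℝ, EM) 𝓘(ℝ, ℝ) f x (𝒢.anchor x (X.1 x))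

/-- The function `X^L Y^L Z^R f |_M`. -/
def third (X Y Z : 𝒢.Sec) (f : G → ℝ) (x : M) : ℝ :=
  along (𝒢.leftField X.1) (along (𝒢.leftField Y.1) (along (𝒢.rightField Z.1) f)) (𝒢.unit x)

/-! ### Contrast functions -/

/-- A contrast function: a smooth function on `G` with `F|_M = 0` and `dF|_M = 0`. -/
structure ContrastFunction where
  toFun : G → ℝ
  smooth : ContMDiff 𝓘(ℝ, EG) 𝓘(ℝ, ℝ) ∞ toFun
  zero_unit : ∀ x, toFun (𝒢.unit x) = 0
  deriv_unit : ∀ x, mfderiv 𝓘(ℝ, EG) 𝓘(ℝ, ℝ) toFun (𝒢.unit x) = 0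

theorem inv_unit (x : M) : 𝒢.inv (𝒢.unit x) = 𝒢.unit x := by
  have h1 := 𝒢.unit_mul (𝒢.inv (𝒢.unit x))
  rw [𝒢.tgt_inv, 𝒢.src_unit] at h1
  have h2 := 𝒢.mul_inv (𝒢.unit x)
  rw [𝒢.tgt_unit] at h2
  rw [← h1, h2]

/-- The second derivative of a function `f` on `G` at `p`, in the chart at `p` through which `T_p G` is
identified with the model space.  At a critical point of `f` it is the Hessian of `f`: it is equal to
`V W f (p)` for all vector fields `V`, `W` through the two vectors, see `along_along`. -/
def hessian (f : G → ℝ) (p : G) :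
    TangentSpace 𝓘(ℝ, EG) p →ₗ[ℝ] TangentSpace 𝓘(ℝ, EG) p →ₗ[ℝ] ℝ :=
  let B : EG →L[ℝ] EG →L[ℝ] ℝ :=
    fderiv ℝ (fderiv ℝ (f ∘ (extChartAt 𝓘(ℝ, EG) p).symm)) (extChartAt 𝓘(ℝ, EG) p p)
  LinearMap.mk₂ ℝ (fun v w => B v w)
    (B.map_add₂) (B.map_smul₂) (fun v => (B v).map_add) (fun c v => (B v).map_smul c)

theorem contDiffAt_chart {f : G → ℝ} (hf : ContMDiff 𝓘(ℝ, EG) 𝓘(ℝ, ℝ) ∞ f) (p : G) :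
    ContDiffAt ℝ ∞ (f ∘ (extChartAt 𝓘(ℝ, EG) p).symm) (extChartAt 𝓘(ℝ, EG) p p) := by
  have h := (contMDiffAt_iff_source (I := 𝓘(ℝ, EG)) (I' := 𝓘(ℝ, ℝ))).mp (hf p)
  rw [modelWithCornersSelf_coe, Set.range_id, contMDiffWithinAt_univ] at h
  exact h.contDiffAt

theorem hessian_symm {f : G → ℝ} (hf : ContMDiff 𝓘(ℝ, EG) 𝓘(ℝ, ℝ) ∞ f) (p : G)
    (v w : TangentSpace 𝓘(ℝ, EG) p) : hessian f p v w = hessian f p w v := by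
  have h : (2 : ℕ∞ω) ≤ ∞ := WithTop.coe_le_coe.2 (le_top : (2 : ℕ∞) ≤ ⊤)
  exact (contDiffAt_chart hf p).isSymmSndFDerivAt
    (by rwa [minSmoothness_of_isRCLikeNormedField]) v w

/-- At a critical point `p` of `f`, the Hessian is `V W f (p)` for arbitrary vector fields. -/
theorem along_along {f : G → ℝ} (hf : ContMDiff 𝓘(ℝ, EG) 𝓘(ℝ, ℝ) ∞ f) (p : G)
    (hp : mfderiv 𝓘(ℝ, EG) 𝓘(ℝ, ℝ) f p = 0) (V W : ∀ g : G, TangentSpace 𝓘(ℝ, EG) g)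
    (hW : MDifferentiableAt 𝓘(ℝ, EG) 𝓘(ℝ, EG).tangent
      (fun g => (⟨g, W g⟩ : TangentBundle 𝓘(ℝ, EG) G)) p) :
    along V (along W f) p = hessian f p (V p) (W p) := by
  have : IsManifold 𝓘(ℝ, EG) 1 G := IsManifold.of_le (n := ∞) (by simp)
  set φ := extChartAt 𝓘(ℝ, EG) p with hφ
  let fh : EG → ℝ := f ∘ φ.symm
  let Wh : G → EG := fun g =>
    (trivializationAt EG (TangentSpace 𝓘(ℝ, EG)) p (⟨g, W g⟩ : TangentBundle 𝓘(ℝ, EG) G)).2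
  have hWh : MDifferentiableAt 𝓘(ℝ, EG) 𝓘(ℝ, EG) Wh p := (mdifferentiableAt_section _ W).mp hW
  have hWeq : ∀ g ∈ (chartAt EG p).source, Wh g = mfderiv 𝓘(ℝ, EG) 𝓘(ℝ, EG) φ g (W g) := by
    intro g hg
    have h1 := TangentBundle.continuousLinearMapAt_trivializationAt (I := 𝓘(ℝ, EG)) hg
    have h2 := congrArg (fun A => A (W g)) h1
    refine Eq.trans ?_ h2
    exact (Bundle.Trivialization.coe_linearMapAt_of_mem (R := ℝ)
      (trivializationAt EG (TangentSpace 𝓘(ℝ, EG)) p) (b := g) (by simpa using hg) ▸ rfl)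
  have hsrc : ∀ᶠ g in 𝓝 p, g ∈ (chartAt EG p).source :=
    (chartAt EG p).open_source.mem_nhds (mem_chart_source EG p)
  have hφp : ∀ g ∈ (chartAt EG p).source, MDifferentiableAt 𝓘(ℝ, EG) 𝓘(ℝ, EG) φ g :=
    fun g hg => mdifferentiableAt_extChartAt hg
  have hfh : ContDiffAt ℝ ∞ fh (φ p) := contDiffAt_chart hf p
  have hfheq : ∀ g ∈ (chartAt EG p).source, (fh ∘ φ) =ᶠ[𝓝 g] f := by
    intro g hg
    filter_upwards [(chartAt EG p).open_source.mem_nhds hg] with g' hg'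
    exact congrArg f (φ.left_inv (by simpa [hφ] using hg'))
  have hfhd : ∀ᶠ g in 𝓝 p, DifferentiableAt ℝ fh (φ g) := by
    have h1 : ∀ᶠ y in 𝓝 (φ p), ContDiffAt ℝ 1 fh y :=
      (hfh.of_le (m := 1) (by simp)).eventually (by simp)
    have h2 := (continuousAt_extChartAt (I := 𝓘(ℝ, EG)) p).eventually h1
    filter_upwards [h2] with g hg using hg.differentiableAt (by simp)
  have hmf : ∀ᶠ g in 𝓝 p, ∀ w : TangentSpace 𝓘(ℝ, EG) g, mfderiv 𝓘(ℝ, EG) 𝓘(ℝ, ℝ) f g w =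
      fderiv ℝ fh (φ g) (mfderiv 𝓘(ℝ, EG) 𝓘(ℝ, EG) φ g w) := by
    filter_upwards [hsrc, hfhd] with g hg hd w
    have h1 := mfderiv_comp g hd.mdifferentiableAt (hφp g hg)
    rw [mfderiv_eq_fderiv] at h1
    have h2 := (hfheq g hg).mfderiv_eq (I := 𝓘(ℝ, EG)) (I' := 𝓘(ℝ, ℝ))
    have h3 := (h2.symm.trans h1 : _)
    exact congrArg (fun A : EG →L[ℝ] ℝ => A w) h3
  have key : ∀ᶠ g in 𝓝 p, along W f g = fderiv ℝ fh (φ g) (Wh g) := by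
    filter_upwards [hsrc, hmf] with g hg h
    rw [hWeq g hg]
    exact h (W g)
  have hself : ∀ v : TangentSpace 𝓘(ℝ, EG) p, mfderiv 𝓘(ℝ, EG) 𝓘(ℝ, EG) φ p v = v := fun v =>
    (congrArg (fun A => A v) (mfderiv_extChartAt_self (I := 𝓘(ℝ, EG)) (x := p)) :)
  have hcrit : ∀ w : EG, fderiv ℝ fh (φ p) w = 0 := by
    intro w
    have h1 := hmf.self_of_nhds w
    have h2 := congrArg (fun A => A w) hp
    exact (congrArg (fderiv ℝ fh (φ p)) (hself w)).symm.trans (h1.symm.trans h2)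
  have hWp : Wh p = W p := (hWeq p (mem_chart_source EG p)).trans (hself (W p))
  have hd2 : DifferentiableAt ℝ (fderiv ℝ fh) (φ p) :=
    (hfh.fderiv_right (m := 1) (WithTop.coe_le_coe.2 (le_top : (1 + 1 : ℕ∞) ≤ ⊤))).differentiableAt
      one_ne_zero
  have hΨ : HasFDerivAt (fun q : EG × EG => fderiv ℝ fh q.1 q.2)
      ((fderiv ℝ fh (φ p)).comp (ContinuousLinearMap.snd ℝ EG EG) +
        ((fderiv ℝ (fderiv ℝ fh) (φ p)).comp (ContinuousLinearMap.fst ℝ EG EG)).flip (Wh p))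
      (φ p, Wh p) :=
    HasFDerivAt.clm_apply (c := fun q : EG × EG => fderiv ℝ fh q.1) (u := Prod.snd)
      (HasFDerivAt.comp (φ p, Wh p) (f := Prod.fst) hd2.hasFDerivAt hasFDerivAt_fst) hasFDerivAt_snd
  have hpair : HasMFDerivAt 𝓘(ℝ, EG) 𝓘(ℝ, EG × EG) (fun g => (φ g, Wh g)) p
      ((mfderiv 𝓘(ℝ, EG) 𝓘(ℝ, EG) φ p).prod (mfderiv 𝓘(ℝ, EG) 𝓘(ℝ, EG) Wh p)) :=
    ⟨(hφp p (mem_chart_source EG p)).hasMFDerivAt.1.prodMk hWh.hasMFDerivAt.1,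
      (hφp p (mem_chart_source EG p)).hasMFDerivAt.2.prodMk hWh.hasMFDerivAt.2⟩
  have hk := HasMFDerivAt.comp p (f := fun g => (φ g, Wh g)) hΨ.hasMFDerivAt hpair
  have hk2 := (hk.congr_of_eventuallyEq key).mfderiv
  have hk3 := congrArg (fun A : EG →L[ℝ] ℝ => A (V p)) hk2
  refine Eq.trans hk3 ?_
  change fderiv ℝ fh (φ p) _ +
    fderiv ℝ (fderiv ℝ fh) (φ p) (mfderiv 𝓘(ℝ, EG) 𝓘(ℝ, EG) φ p (V p)) (Wh p) = _
  rw [hcrit, hself, hWp, zero_add]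
  rfl

namespace ContrastFunction

variable {𝒢} (F : 𝒢.ContrastFunction)

/-- The contrast function `F* = F ∘ inv`. -/
def star : 𝒢.ContrastFunction where
  toFun := fun g => F.toFun (𝒢.inv g)
  smooth := F.smooth.comp 𝒢.contMDiff_inv
  zero_unit x := by rw [𝒢.inv_unit, F.zero_unit]
  deriv_unit x := by
    have h := mfderiv_comp (𝒢.unit x) (g := F.toFun) (f := 𝒢.inv)
      ((F.smooth _).mdifferentiableAt (by simp)) ((𝒢.contMDiff_inv _).mdifferentiableAt (by simp))
    refine Eq.trans h ?_
    rw [𝒢.inv_unit, F.deriv_unit]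
    rfl

/-- The symmetric form `g^F` on the Lie algebroid, `g^F(X, Y) = X̃ Ỹ F |_M` for vector fields
`X̃`, `Ỹ` on `G` representing `X` and `Y` along `M`. -/
def metric (x : M) : 𝒢.Fibre x →ₗ[ℝ] 𝒢.Fibre x →ₗ[ℝ] ℝ :=
  (hessian F.toFun (𝒢.unit x)).compl₁₂ (𝒢.leftRep x) (𝒢.leftRep x)

theorem metric_symm (x : M) (e e' : 𝒢.Fibre x) : F.metric x e e' = F.metric x e' e :=
  hessian_symm F.smooth _ _ _

/-- The kernel `K^F` of `g^F`. -/
def kernel (x : M) : Submodule ℝ (𝒢.Fibre x) := LinearMap.ker (F.metric x)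

/-- `F` is regular: `g^F` has constant rank. -/
def IsRegular : Prop := ∃ r : ℕ, ∀ x, Module.finrank ℝ (F.kernel x) = r

/-- `F` is a Koszul contrast function: it is regular, and `X^L Y^L Z^R F |_M = 0` and
`X^L Y^L Z^R F* |_M = 0` for all sections `X`, `Y` of `E` and `Z` of `K^F`. -/
structure IsKoszul : Prop where
  regular : F.IsRegular
  third_eq_zero : ∀ X Y Z : 𝒢.Sec, (∀ x, Z.1 x ∈ F.kernel x) →
    ∀ x, 𝒢.third X Y Z F.toFun x = 0
  third_star_eq_zero : ∀ X Y Z : 𝒢.Sec, (∀ x, Z.1 x ∈ F.kernel x) →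
    ∀ x, 𝒢.third X Y Z F.star.toFun x = 0

/-! ### The transversal bundle -/

/-- The fibre `L_x = E_x / K^F_x` of the bundle `L^F = E / K^F`. -/
abbrev Transversal (x : M) : Type _ := 𝒢.Fibre x ⧸ F.kernel x

/-- The transversal metric `g^[F]` on `L^F`, induced by `g^F`. -/
def transMetric (x : M) : F.Transversal x →ₗ[ℝ] F.Transversal x →ₗ[ℝ] ℝ :=
  (F.kernel x).liftQ ((F.kernel x).liftQ (F.metric x) le_rfl).flip (by
    intro z hz
    rw [LinearMap.mem_ker]
    refine LinearMap.ext fun a => ?_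
    obtain ⟨e, rfl⟩ := (F.kernel x).mkQ_surjective a
    exact (F.metric_symm x e z).trans (LinearMap.congr_fun (LinearMap.mem_ker.mp hz) e))

theorem transMetric_mk (x : M) (e e' : 𝒢.Fibre x) :
    F.transMetric x ((F.kernel x).mkQ e) ((F.kernel x).mkQ e') = F.metric x e e' :=
  F.metric_symm x e' e

/-- The space `Sec(L^F)` of smooth sections of `L^F`: those that are locally classes of smooth sections
of `E`. -/
def TSec : Submodule ℝ (∀ x, F.Transversal x) where
  carrier := {σ | ∀ x₀, ∃ X : 𝒢.Sec, ∀ᶠ x in 𝓝 x₀, σ x = (F.kernel x).mkQ (X.1 x)}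
  add_mem' := by
    intro σ τ hσ hτ x₀
    obtain ⟨X, hX⟩ := hσ x₀
    obtain ⟨Y, hY⟩ := hτ x₀
    refine ⟨X + Y, ?_⟩
    filter_upwards [hX, hY] with x h1 h2
    rw [Pi.add_apply, h1, h2, ← map_add]
    rfl
  zero_mem' := fun x₀ => ⟨0, Filter.Eventually.of_forall fun x => by
    simp only [Submodule.coe_zero, Pi.zero_apply, map_zero]⟩
  smul_mem' := by
    intro c σ hσ x₀
    obtain ⟨X, hX⟩ := hσ x₀
    refine ⟨c • X, ?_⟩
    filter_upwards [hX] with x h1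
    rw [Pi.smul_apply, h1, ← map_smul]
    rfl

/-- The product `f σ` of a section of `L^F` with a smooth function. -/
def smulTSec (f : C^∞⟮𝓘(ℝ, EM), M; 𝓘(ℝ, ℝ), ℝ⟯) (σ : F.TSec) : F.TSec :=
  ⟨fun x => f x • σ.1 x, fun x₀ => by
    obtain ⟨X, hX⟩ := σ.2 x₀
    refine ⟨𝒢.smulSec f X, ?_⟩
    filter_upwards [hX] with x h1
    rw [h1, ← map_smul]
    rfl⟩

/-- The class `X̄` of a section `X` of `E` as a section of `L^F`. -/
def bar (X : 𝒢.Sec) : F.TSec :=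
  ⟨fun x => (F.kernel x).mkQ (X.1 x), fun _ => ⟨X, Filter.Eventually.of_forall fun _ => rfl⟩⟩

/-! ### Connections -/

/-- `D`, `D X σ = ∇_X σ`, is an `E`-connection on `L^F`.  (Homogeneity over `ℝ` is the case of constant
functions.) -/
structure IsConnection (D : 𝒢.Sec → F.TSec → F.TSec) : Prop where
  add_left : ∀ X Y σ, D (X + Y) σ = D X σ + D Y σ
  smul_left : ∀ f X σ, D (𝒢.smulSec f X) σ = F.smulTSec f (D X σ)
  add_right : ∀ X σ τ, D X (σ + τ) = D X σ + D X τ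
  leibniz : ∀ (f : C^∞⟮𝓘(ℝ, EM), M; 𝓘(ℝ, ℝ), ℝ⟯) (X : 𝒢.Sec) (σ : F.TSec) (x : M),
    (D X (F.smulTSec f σ)).1 x = f x • (D X σ).1 x + 𝒢.anchorDeriv X f x • σ.1 x

/-- `D` is the `E`-connection on `L^F` given by
`g^[F](∇_X Ȳ, Z̄) = X^L Y^L Z^R H |_M`: the Koszul connection `∇^[F]` for `H = F`, and the Koszul
connection `∇^[F*]` for `H = F*` (the forms `g^F` and `g^{F*}` are equal). -/
structure IsKoszulConnection (H : G → ℝ) (D : 𝒢.Sec → F.TSec → F.TSec) : Prop where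
  isConnection : F.IsConnection D
  eq_third : ∀ (X Y Z : 𝒢.Sec) (x : M),
    F.transMetric x ((D X (F.bar Y)).1 x) ((F.bar Z).1 x) = 𝒢.third X Y Z H x

/-- `D` is the transversal Levi-Civita connection `∇^[g]`: the `E`-connection on `L^F` that is
torsion-free, `∇_X Ȳ - ∇_Y X̄ = [X, Y]‾`, and metric, i.e. self-dual with respect to `g^[F]`. -/
structure IsTransversalLeviCivita (D : 𝒢.Sec → F.TSec → F.TSec) : Prop where
  isConnection : F.IsConnection D
  torsion_free : ∀ (X Y : 𝒢.Sec) (x : M),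
    (D X (F.bar Y)).1 x - (D Y (F.bar X)).1 x = (F.kernel x).mkQ (𝒢.bracket X Y x)
  metric : ∀ (X : 𝒢.Sec) (σ τ : F.TSec) (x : M),
    𝒢.anchorDeriv X (fun y => F.transMetric y (σ.1 y) (τ.1 y)) x =
      F.transMetric x ((D X σ).1 x) (τ.1 x) + F.transMetric x (σ.1 x) ((D X τ).1 x)

/-- A field of trilinear forms on the fibres of `L^F`. -/
abbrev TrilinearField : Type _ :=
  ∀ x, F.Transversal x →ₗ[ℝ] F.Transversal x →ₗ[ℝ] F.Transversal x →ₗ[ℝ] ℝ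

/-- `T` is a smooth section of `⊙³ (L^F)*`. -/
structure IsSymmetricTensor (T : F.TrilinearField) : Prop where
  smooth : ∀ σ τ υ : F.TSec,
    ContMDiff 𝓘(ℝ, EM) 𝓘(ℝ, ℝ) ∞ (fun x => T x (σ.1 x) (τ.1 x) (υ.1 x))
  swap_left : ∀ x a b c, T x a b c = T x b a c
  swap_right : ∀ x a b c, T x a b c = T x a c b

/-- `T(X̄, Ȳ, Z̄) = g^[F](∇_X Ȳ - ∇*_X Ȳ, Z̄)` for two operators `D = ∇` and `D' = ∇*`. -/
def IsDifferenceTensor (D D' : 𝒢.Sec → F.TSec → F.TSec) (T : F.TrilinearField) : Prop :=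
  ∀ (X Y Z : 𝒢.Sec) (x : M), T x ((F.bar X).1 x) ((F.bar Y).1 x) ((F.bar Z).1 x) =
    F.transMetric x ((D X (F.bar Y)).1 x - (D' X (F.bar Y)).1 x) ((F.bar Z).1 x)

end ContrastFunction

end LieGroupoid

end

/-! Everything follows from three facts about invariant fields: `X^L` and `Z^R` commute
(`along_left_right_comm`); at a unit `X^L - X^R` is the anchor of `X`, tangent to `M`
(`along_left_unit`); inversion carries `X^L` to `-X^R` (`mfderiv_inv_leftField`). They are proved by
differentiating curves in the source and target fibres.

Since `dF` vanishes along `M`, the Hessian of `F` there kills `TM` and descends to `g^F` on `E`. Two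
identities for third derivatives result. Torsion (`third_sub_third_swap`): `X^L Y^L Z^R F - Y^L X^L
Z^R F = g([X,Y], Z)` on `M`, because a commutator of left fields is applied to `Z^R F`. Duality
(`third_add_third_star`): `X^L Y^L Z^R F + X^L Z^L Y^R F* = α(X) g(Y,Z)` on `M`, because the left
side is `(X^L - X^R) Z^R Y^L F`.

Commuting `Z^R` to the front shows that `X^L Y^L Z^R F` is tensorial in `Z`. The Koszul condition
for `F` makes it depend on `Z̄` only; the condition for `F*`, transported by duality, makes it
depend on `Ȳ` only. The constant rank of `K^F` allows the resulting form to be represented smoothly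
by the metric (`exists_represents`), which gives the Koszul connections. By torsion and duality
their mean is torsion-free and metric, hence is the unique transversal Levi-Civita connection.

Finally let `d(X,Y,Z)` be the third derivative of `F` minus that of `F*`. Torsion is the same for
`F` and `F*`, so `d` is symmetric in `X, Y`; duality makes it symmetric in `Y, Z`. As `d` is
tensorial in `Z`, these symmetries make it tensorial in every slot, and it is the tensor `T`. -/

open scoped Manifold ContDiff Topology

noncomputable section

set_option linter.unusedSectionVars false

/-! ### Velocities of curves -/

section Velocity

variable {E H N E' H' N' : Type*}
    [NormedAddCommGroup E] [NormedSpace ℝ E] [TopologicalSpace H] {I : ModelWithCorners ℝ E H}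
    [TopologicalSpace N] [ChartedSpace H N]
    [NormedAddCommGroup E'] [NormedSpace ℝ E'] [TopologicalSpace H'] {I' : ModelWithCorners ℝ E' H'}
    [TopologicalSpace N'] [ChartedSpace H' N']

variable (I) in
/-- The curve `γ` passes at time `0` through `p`, with velocity `v` (in the model space with which
`T_p N` is identified). -/
def HasVelocity (γ : ℝ → N) (p : N) (v : E) : Prop :=
  γ 0 = p ∧ HasMFDerivAt 𝓘(ℝ, ℝ) I γ 0 (ContinuousLinearMap.toSpanSingleton ℝ v : ℝ →L[ℝ] E)

theorem HasVelocity.congr {γ γ' : ℝ → N} {p : N} {v : E} (h : HasVelocity I γ p v)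
    (h' : γ' =ᶠ[𝓝 0] γ) : HasVelocity I γ' p v := by
  obtain ⟨rfl, h⟩ := h
  exact ⟨h'.self_of_nhds, h.congr_of_eventuallyEq h'⟩

theorem HasVelocity.unique {γ : ℝ → N} {p : N} {v w : E} (h : HasVelocity I γ p v)
    (h' : HasVelocity I γ p w) : v = w := by
  obtain ⟨rfl, h⟩ := h
  have h0 := hasMFDerivAt_unique h h'.2
  have h1 := congrArg (fun A : ℝ →L[ℝ] E => A 1) h0
  exact (one_smul ℝ v).symm.trans (h1.trans (one_smul ℝ w))

/-- The derivative `D` within `S` need not be unique, but its value on the velocity of a curve in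
`S` is. This makes the choice hidden in `mfderivWithin` harmless in the definition of the invariant
fields. -/
theorem HasVelocity.comp_within {γ : ℝ → N} {p : N} {v : E}
    (h : HasVelocity I γ p v) {f : N → N'} {S : Set N} {D : E →L[ℝ] E'}
    (hf : HasMFDerivWithinAt I I' f S p D) (hS : ∀ᶠ τ in 𝓝 0, γ τ ∈ S) :
    HasVelocity I' (fun τ => f (γ τ)) (f p) (D v) := by
  obtain ⟨rfl, h⟩ := h
  refine ⟨rfl, ?_⟩
  have h1 := HasMFDerivWithinAt.comp (0 : ℝ) hf (h.hasMFDerivWithinAt (s := γ ⁻¹' S)) le_rfl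
  refine (h1.hasMFDerivAt hS).congr_mfderiv ?_
  exact ContinuousLinearMap.comp_toSpanSingleton D v

theorem HasVelocity.comp {γ : ℝ → N} {p : N} {v : E}
    (h : HasVelocity I γ p v) {f : N → N'} (hf : MDifferentiableAt I I' f p) :
    HasVelocity I' (fun τ => f (γ τ)) (f p) (mfderiv I I' f p v) :=
  h.comp_within (S := Set.univ) hf.hasMFDerivAt.hasMFDerivWithinAt
    (Filter.Eventually.of_forall fun _ => Set.mem_univ _)

theorem HasVelocity.prodMk {γ : ℝ → N} {p : N} {v : E} {γ' : ℝ → N'} {p' : N'}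
    {v' : E'} (h : HasVelocity I γ p v) (h' : HasVelocity I' γ' p' v') :
    HasVelocity (I.prod I') (fun τ => (γ τ, γ' τ)) (p, p') (v, v') := by
  obtain ⟨rfl, h⟩ := h
  obtain ⟨rfl, h'⟩ := h'
  refine ⟨rfl, (h.prodMk h').congr_mfderiv ?_⟩
  exact ContinuousLinearMap.ext fun t => rfl

theorem hasVelocity_iff_hasDerivAt {γ : ℝ → E} {p v : E} :
    HasVelocity 𝓘(ℝ, E) γ p v ↔ γ 0 = p ∧ HasDerivAt γ v 0 := by
  refine and_congr_right fun _ => ?_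
  refine Iff.trans ?_ hasDerivAt_iff_hasFDerivAt.symm
  exact hasMFDerivAt_iff_hasFDerivAt

theorem hasVelocity_const (p : N) : HasVelocity I (fun _ => p) p 0 := by
  refine ⟨rfl, (hasMFDerivAt_const p (0 : ℝ)).congr_mfderiv ?_⟩
  exact (ContinuousLinearMap.toSpanSingleton_zero ℝ (M₁ := E)).symm

theorem HasVelocity.tendsto {γ : ℝ → N} {p : N} {v : E}
    (h : HasVelocity I γ p v) : Filter.Tendsto γ (𝓝 0) (𝓝 p) := h.1 ▸ h.2.continuousAt

theorem exists_hasVelocity [I.Boundaryless] [IsManifold I 1 N] (p : N) (v : E) :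
    ∃ γ : ℝ → N, HasVelocity I γ p v := by
  have h1 : HasVelocity 𝓘(ℝ, E) (fun τ : ℝ => extChartAt I p p + τ • v) (extChartAt I p p) v := by
    rw [hasVelocity_iff_hasDerivAt]
    refine ⟨by simp, ?_⟩
    simpa using ((hasDerivAt_id (0 : ℝ)).smul_const v).const_add (extChartAt I p p)
  have hd := mdifferentiableWithinAt_extChartAt_symm (I := I) (mem_extChartAt_target (I := I) p)
  have h2 := h1.comp_within hd.hasMFDerivWithinAt (Filter.Eventually.of_forall fun τ => by
    simp [I.range_eq_univ])
  have h3 := congrArg (fun A : E →L[ℝ] E => A v) (mfderivWithin_range_extChartAt_symm (I := I) (x := p))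
  have h4 : (extChartAt I p).symm (extChartAt I p p) = p := extChartAt_to_inv p
  refine ⟨_, h2.1.trans h4, h2.2.congr_mfderiv ?_⟩
  exact congrArg (ContinuousLinearMap.toSpanSingleton ℝ) h3

end Velocity

namespace LieGroupoid

variable {EM M EG G : Type*}
    [NormedAddCommGroup EM] [NormedSpace ℝ EM] [FiniteDimensional ℝ EM]
    [TopologicalSpace M] [ChartedSpace EM M] [IsManifold 𝓘(ℝ, EM) ∞ M]
    [NormedAddCommGroup EG] [NormedSpace ℝ EG] [FiniteDimensional ℝ EG]
    [TopologicalSpace G] [ChartedSpace EG G] [IsManifold 𝓘(ℝ, EG) ∞ G]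
    (𝒢 : LieGroupoid EM M EG G)

/-! ### Representatives of the fibres of the Lie algebroid -/

/-- All tangent spaces are definitionally the model space, so the cast is invisible there. -/
theorem tangentCast_eq {V N : Type*} [NormedAddCommGroup V] [NormedSpace ℝ V] [TopologicalSpace N]
    [ChartedSpace V N] {p q : N} (h : p = q) (v : V) :
    (tangentCast h (v : TangentSpace 𝓘(ℝ, V) p) : V) = v := by
  subst h
  rfl

theorem leftRep_mkQ (x : M) (v : 𝒢.UnitTangent x) :
    𝒢.leftRep x ((𝒢.tangentUnits x).mkQ v) = v - 𝒢.dUnit x (𝒢.dTgt x v) := rfl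

theorem rightRep_mkQ (x : M) (v : 𝒢.UnitTangent x) :
    𝒢.rightRep x ((𝒢.tangentUnits x).mkQ v) = v - 𝒢.dUnit x (𝒢.dSrc x v) := rfl

theorem anchor_mkQ (x : M) (v : 𝒢.UnitTangent x) :
    𝒢.anchor x ((𝒢.tangentUnits x).mkQ v) = 𝒢.dSrc x v - 𝒢.dTgt x v := rfl

theorem dTgt_leftRep (x : M) (e : 𝒢.Fibre x) : 𝒢.dTgt x (𝒢.leftRep x e) = 0 := by
  obtain ⟨v, rfl⟩ := (𝒢.tangentUnits x).mkQ_surjective e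
  rw [leftRep_mkQ, map_sub, dTgt_dUnit, sub_self]

theorem dSrc_leftRep (x : M) (e : 𝒢.Fibre x) : 𝒢.dSrc x (𝒢.leftRep x e) = 𝒢.anchor x e := by
  obtain ⟨v, rfl⟩ := (𝒢.tangentUnits x).mkQ_surjective e
  rw [leftRep_mkQ, map_sub, dSrc_dUnit, anchor_mkQ]

/-- The representatives are `v - T1 (Tt v)` and `v - T1 (Ts v)`. Their difference is the source of
the anchor term in the duality of `F` and `F*`. -/
theorem leftRep_eq (x : M) (e : 𝒢.Fibre x) :
    𝒢.leftRep x e = 𝒢.rightRep x e + 𝒢.dUnit x (𝒢.anchor x e) := by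
  obtain ⟨v, rfl⟩ := (𝒢.tangentUnits x).mkQ_surjective e
  rw [leftRep_mkQ, rightRep_mkQ, anchor_mkQ, map_sub]
  abel

theorem leftRep_of_dTgt_eq_zero {x : M} {v : 𝒢.UnitTangent x} (h : 𝒢.dTgt x v = 0) :
    𝒢.leftRep x ((𝒢.tangentUnits x).mkQ v) = v := by
  rw [leftRep_mkQ, h, map_zero, sub_zero]

/-! ### Velocities of translated curves -/

theorem src_mdifferentiableAt (g : G) : MDifferentiableAt 𝓘(ℝ, EG) 𝓘(ℝ, EM) 𝒢.src g :=
  (𝒢.contMDiff_src g).mdifferentiableAt (by simp)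

theorem tgt_mdifferentiableAt (g : G) : MDifferentiableAt 𝓘(ℝ, EG) 𝓘(ℝ, EM) 𝒢.tgt g :=
  (𝒢.contMDiff_tgt g).mdifferentiableAt (by simp)

theorem unit_mdifferentiableAt (x : M) : MDifferentiableAt 𝓘(ℝ, EM) 𝓘(ℝ, EG) 𝒢.unit x :=
  (𝒢.contMDiff_unit x).mdifferentiableAt (by simp)

theorem inv_mdifferentiableAt (g : G) : MDifferentiableAt 𝓘(ℝ, EG) 𝓘(ℝ, EG) 𝒢.inv g :=
  (𝒢.contMDiff_inv g).mdifferentiableAt (by simp)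

variable {𝒢} in
theorem hasVelocity_src {γ : ℝ → G} {x : M} {v : EG}
    (h : HasVelocity 𝓘(ℝ, EG) γ (𝒢.unit x) v) :
    HasVelocity 𝓘(ℝ, EM) (fun τ => 𝒢.src (γ τ)) x (𝒢.dSrc x v) := by
  have h1 := h.comp (𝒢.src_mdifferentiableAt _)
  refine ⟨h1.1.trans (𝒢.src_unit x), h1.2.congr_mfderiv ?_⟩
  exact congrArg (ContinuousLinearMap.toSpanSingleton ℝ) (tangentCast_eq (𝒢.src_unit x) _).symm

variable {𝒢} in
theorem hasVelocity_tgt {γ : ℝ → G} {x : M} {v : EG}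
    (h : HasVelocity 𝓘(ℝ, EG) γ (𝒢.unit x) v) :
    HasVelocity 𝓘(ℝ, EM) (fun τ => 𝒢.tgt (γ τ)) x (𝒢.dTgt x v) := by
  have h1 := h.comp (𝒢.tgt_mdifferentiableAt _)
  refine ⟨h1.1.trans (𝒢.tgt_unit x), h1.2.congr_mfderiv ?_⟩
  exact congrArg (ContinuousLinearMap.toSpanSingleton ℝ) (tangentCast_eq (𝒢.tgt_unit x) _).symm

variable {𝒢} in
theorem hasVelocity_unit {γ : ℝ → M} {x : M} {v : EM} (h : HasVelocity 𝓘(ℝ, EM) γ x v) :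
    HasVelocity 𝓘(ℝ, EG) (fun τ => 𝒢.unit (γ τ)) (𝒢.unit x) (𝒢.dUnit x v) :=
  h.comp (𝒢.unit_mdifferentiableAt x)

theorem mul_left_mdifferentiableWithinAt (g : G) :
    MDifferentiableWithinAt 𝓘(ℝ, EG) 𝓘(ℝ, EG) (fun h => 𝒢.mul g h)
      {h | 𝒢.src g = 𝒢.tgt h} (𝒢.unit (𝒢.src g)) := by
  have h1 : ContMDiffOn 𝓘(ℝ, EG) (𝓘(ℝ, EG).prod 𝓘(ℝ, EG)) ∞ (fun h : G => (g, h))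
      {h | 𝒢.src g = 𝒢.tgt h} := (contMDiff_const.prodMk contMDiff_id).contMDiffOn
  have h2 := 𝒢.contMDiffOn_mul.comp h1 (fun h hh => hh)
  exact (h2 _ (𝒢.tgt_unit _).symm).mdifferentiableWithinAt (by simp)

theorem mul_right_mdifferentiableWithinAt (g : G) :
    MDifferentiableWithinAt 𝓘(ℝ, EG) 𝓘(ℝ, EG) (fun h => 𝒢.mul h g)
      {h | 𝒢.src h = 𝒢.tgt g} (𝒢.unit (𝒢.tgt g)) := by
  have h1 : ContMDiffOn 𝓘(ℝ, EG) (𝓘(ℝ, EG).prod 𝓘(ℝ, EG)) ∞ (fun h : G => (h, g))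
      {h | 𝒢.src h = 𝒢.tgt g} := (contMDiff_id.prodMk contMDiff_const).contMDiffOn
  have h2 := 𝒢.contMDiffOn_mul.comp h1 (fun h hh => hh)
  exact (h2 _ (𝒢.src_unit _)).mdifferentiableWithinAt (by simp)

-- This is the working description of `leftField`: any curve in the target fibre with the right
-- initial velocity computes it. Identities between invariant fields reduce to identities between
-- curves by `HasVelocity.unique`. The base point `x` is kept apart from `src g` so that `g` may
-- itself be a product.
variable {𝒢} in
theorem hasVelocity_mul_left {γ : ℝ → G} {g : G} {x : M} (hx : 𝒢.src g = x) {X : ∀ x, 𝒢.Fibre x}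
    (h : HasVelocity 𝓘(ℝ, EG) γ (𝒢.unit x) (𝒢.leftRep x (X x)))
    (ht : ∀ᶠ τ in 𝓝 0, 𝒢.tgt (γ τ) = x) :
    HasVelocity 𝓘(ℝ, EG) (fun τ => 𝒢.mul g (γ τ)) g (𝒢.leftField X g) := by
  subst hx
  have h1 := h.comp_within (𝒢.mul_left_mdifferentiableWithinAt g).hasMFDerivWithinAt
    (ht.mono fun τ h => h.symm)
  refine ⟨h1.1.trans (𝒢.mul_unit g), h1.2.congr_mfderiv ?_⟩
  exact congrArg (ContinuousLinearMap.toSpanSingleton ℝ) (tangentCast_eq (𝒢.mul_unit g) _).symm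

variable {𝒢} in
theorem hasVelocity_mul_right {γ : ℝ → G} {g : G} {x : M} (hx : 𝒢.tgt g = x) {X : ∀ x, 𝒢.Fibre x}
    (h : HasVelocity 𝓘(ℝ, EG) γ (𝒢.unit x) (𝒢.rightRep x (X x)))
    (ht : ∀ᶠ τ in 𝓝 0, 𝒢.src (γ τ) = x) :
    HasVelocity 𝓘(ℝ, EG) (fun τ => 𝒢.mul (γ τ) g) g (𝒢.rightField X g) := by
  subst hx
  have h1 := h.comp_within (𝒢.mul_right_mdifferentiableWithinAt g).hasMFDerivWithinAt ht
  refine ⟨h1.1.trans (𝒢.unit_mul g), h1.2.congr_mfderiv ?_⟩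
  exact congrArg (ContinuousLinearMap.toSpanSingleton ℝ) (tangentCast_eq (𝒢.unit_mul g) _).symm

/-! ### Inversion -/

theorem inv_inv (g : G) : 𝒢.inv (𝒢.inv g) = g := by
  have h1 := 𝒢.mul_assoc (𝒢.inv (𝒢.inv g)) (𝒢.inv g) g (𝒢.src_inv _ |>.trans (by rfl)) (𝒢.src_inv g)
  rw [𝒢.inv_mul, 𝒢.inv_mul, 𝒢.src_inv, 𝒢.unit_mul] at h1
  have h2 := 𝒢.mul_unit (𝒢.inv (𝒢.inv g))
  rw [𝒢.src_inv, 𝒢.tgt_inv] at h2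
  rw [← h2, ← h1]

theorem eq_inv_of_mul_eq_unit {g h : G} (hgh : 𝒢.src g = 𝒢.tgt h)
    (H : 𝒢.mul g h = 𝒢.unit (𝒢.tgt g)) : h = 𝒢.inv g := by
  have h1 := 𝒢.mul_assoc (𝒢.inv g) g h (𝒢.src_inv g) hgh
  rw [H, 𝒢.inv_mul, hgh, 𝒢.unit_mul] at h1
  have h2 := 𝒢.mul_unit (𝒢.inv g)
  rw [𝒢.src_inv] at h2
  rw [h1, h2]

theorem inv_mul_rev {g h : G} (hgh : 𝒢.src g = 𝒢.tgt h) :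
    𝒢.inv (𝒢.mul g h) = 𝒢.mul (𝒢.inv h) (𝒢.inv g) := by
  have e1 : 𝒢.src (𝒢.inv h) = 𝒢.tgt (𝒢.inv g) := by rw [𝒢.src_inv, 𝒢.tgt_inv, hgh]
  symm
  apply 𝒢.eq_inv_of_mul_eq_unit
  · rw [𝒢.src_mul _ _ hgh, 𝒢.tgt_mul _ _ e1, 𝒢.tgt_inv]
  · rw [𝒢.mul_assoc g h _ hgh (by rw [𝒢.tgt_mul _ _ e1, 𝒢.tgt_inv]),
      ← 𝒢.mul_assoc h _ _ (𝒢.tgt_inv h).symm e1, 𝒢.mul_inv, ← hgh, ← 𝒢.tgt_inv g, 𝒢.unit_mul,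
      𝒢.mul_inv, 𝒢.tgt_mul _ _ hgh]

/-- The differential of the multiplication at a pair of equal units, in terms of velocities. -/
theorem hasVelocity_mul_unit {γ γ' : ℝ → G} {x : M} {v w : 𝒢.UnitTangent x}
    (h : HasVelocity 𝓘(ℝ, EG) γ (𝒢.unit x) v) (h' : HasVelocity 𝓘(ℝ, EG) γ' (𝒢.unit x) w)
    (hc : ∀ᶠ τ in 𝓝 0, 𝒢.src (γ τ) = 𝒢.tgt (γ' τ)) :
    HasVelocity 𝓘(ℝ, EG) (fun τ => 𝒢.mul (γ τ) (γ' τ)) (𝒢.unit x)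
      (v + w - 𝒢.dUnit x (𝒢.dSrc x v)) := by
  have h0 : (𝒢.unit x, 𝒢.unit x) ∈ {p : G × G | 𝒢.src p.1 = 𝒢.tgt p.2} :=
    (𝒢.src_unit x).trans (𝒢.tgt_unit x).symm
  have hm := ((𝒢.contMDiffOn_mul _ h0).mdifferentiableWithinAt (by simp)).hasMFDerivWithinAt
  set D : EG × EG →L[ℝ] EG := mfderivWithin (𝓘(ℝ, EG).prod 𝓘(ℝ, EG)) 𝓘(ℝ, EG)
    (fun p : G × G => 𝒢.mul p.1 p.2) {p : G × G | 𝒢.src p.1 = 𝒢.tgt p.2} (𝒢.unit x, 𝒢.unit x) with hD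
  have hmul : 𝒢.mul (𝒢.unit x) (𝒢.unit x) = 𝒢.unit x := by
    have := 𝒢.mul_unit (𝒢.unit x)
    rwa [𝒢.src_unit] at this
  have key : ∀ {γ γ' : ℝ → G} {v w : EG}, HasVelocity 𝓘(ℝ, EG) γ (𝒢.unit x) v →
      HasVelocity 𝓘(ℝ, EG) γ' (𝒢.unit x) w → (∀ᶠ τ in 𝓝 0, 𝒢.src (γ τ) = 𝒢.tgt (γ' τ)) →
      HasVelocity 𝓘(ℝ, EG) (fun τ => 𝒢.mul (γ τ) (γ' τ)) (𝒢.unit x) (D (v, w)) := by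
    intro γ γ' v w h h' hc
    have h1 := (h.prodMk h').comp_within hm hc
    exact ⟨h1.1.trans hmul, h1.2⟩
  have hsv := hasVelocity_unit (𝒢 := 𝒢) (hasVelocity_src h)
  have hsw := hasVelocity_unit (𝒢 := 𝒢) (hasVelocity_tgt h')
  have huw : 𝒢.dTgt x w = 𝒢.dSrc x v :=
    (hasVelocity_tgt h').unique ((hasVelocity_src h).congr (hc.mono fun τ h => h.symm))
  rw [huw] at hsw
  -- `D` is linear, and `(v, w) = (v, U) + (U, w) - (U, U)`. Each of the three pairs is the velocity
  -- of a curve of composable pairs, on which the unit laws determine `D`.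
  obtain ⟨U, hU⟩ : ∃ U : EG, U = 𝒢.dUnit x (𝒢.dSrc x v) := ⟨_, rfl⟩
  rw [← hU] at hsv hsw
  have e1 : D (v, U) = v :=
    (key h hsv (.of_forall fun τ => (𝒢.tgt_unit _).symm)).unique
      (h.congr (.of_forall fun τ => 𝒢.mul_unit _))
  have e2 : D (U, w) = w :=
    (key hsw h' (.of_forall fun τ => 𝒢.src_unit _)).unique
      (h'.congr (.of_forall fun τ => 𝒢.unit_mul _))
  have e3 : D (U, U) = U :=
    (key hsv hsv (.of_forall fun τ => by rw [𝒢.src_unit, 𝒢.tgt_unit])).unique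
      (hsv.congr (.of_forall fun τ => by
        have := 𝒢.mul_unit (𝒢.unit (𝒢.src (γ τ)))
        rwa [𝒢.src_unit] at this))
  have e4 : ∀ v w : EG, D (v, U) = v → D (U, w) = w → D (v, w) = v + w - U := by
    intro v w e1 e2
    have : ((v, w) : EG × EG) = (v, U) + (U, w) - (U, U) := by
      ext <;> simp
    rw [this, map_sub, map_add, e1, e2, e3]
  have h2 := key h h' hc
  rw [e4 v w e1 e2, hU] at h2
  exact h2

/-- Inversion maps `X^L(1_x)` to `-X^R(1_x)`. -/
theorem hasVelocity_inv_leftRep {γ : ℝ → G} {x : M} {e : 𝒢.Fibre x}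
    (h : HasVelocity 𝓘(ℝ, EG) γ (𝒢.unit x) (𝒢.leftRep x e)) :
    HasVelocity 𝓘(ℝ, EG) (fun τ => 𝒢.inv (γ τ)) (𝒢.unit x) (-𝒢.rightRep x e) := by
  have h1 := h.comp (𝒢.inv_mdifferentiableAt _)
  obtain ⟨w, hw⟩ : ∃ w : 𝒢.UnitTangent x,
    w = mfderiv 𝓘(ℝ, EG) 𝓘(ℝ, EG) 𝒢.inv (𝒢.unit x) (𝒢.leftRep x e) := ⟨_, rfl⟩
  have h1' : HasVelocity 𝓘(ℝ, EG) (fun τ => 𝒢.inv (γ τ)) (𝒢.unit x) w :=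
    ⟨h1.1.trans (𝒢.inv_unit x), hw ▸ h1.2⟩
  -- Differentiate `g ∘ inv g = 1_{t(g)}` along the curve; the right side contributes nothing
  -- because `Tt` kills `leftRep`.
  have h2 := 𝒢.hasVelocity_mul_unit h h1' (.of_forall fun τ => (𝒢.tgt_inv _).symm)
  have h3 := (hasVelocity_unit (𝒢 := 𝒢) (hasVelocity_tgt h)).congr (.of_forall fun τ => 𝒢.mul_inv (γ τ))
  have h4 : 𝒢.leftRep x e + w - 𝒢.dUnit x (𝒢.dSrc x (𝒢.leftRep x e)) =
    𝒢.dUnit x (𝒢.dTgt x (𝒢.leftRep x e)) := h2.unique h3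
  rw [dSrc_leftRep, dTgt_leftRep, map_zero, leftRep_eq] at h4
  have h6 : w = -𝒢.rightRep x e := by
    rw [eq_neg_iff_add_eq_zero, ← h4]
    abel
  rw [h6] at h1'
  exact h1'

/-! ### Smooth families of curves in the target fibres -/

/-- A family of local maps `y ↦ B (y, τ)` that starts at the identity can be inverted, smoothly in
the parameter. -/
theorem exists_smooth_inverse_family {B : EM × ℝ → EM} {y₀ : EM} (hB : ContDiffAt ℝ ∞ B (y₀, 0))
    (h0 : ∀ᶠ y in 𝓝 y₀, B (y, 0) = y) :
    ∃ a : EM × ℝ → EM, ContDiffAt ℝ ∞ a (y₀, 0) ∧ (∀ᶠ q in 𝓝 (y₀, (0 : ℝ)), B (a q, q.2) = q.1) ∧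
      ∀ᶠ y in 𝓝 y₀, a (y, 0) = y := by
  -- Keeping the parameter as a second component turns the family into one local diffeomorphism. Its
  -- derivative at `(y₀, 0)` is triangular, `(w, s) ↦ (w + B' (0, s), s)`, and is inverted
  -- explicitly in `e`.
  let Θ : EM × ℝ → EM × ℝ := fun q => (B q, q.2)
  have hΘ : ContDiffAt ℝ ∞ Θ (y₀, 0) := hB.prodMk contDiffAt_snd
  have hB1 : HasFDerivAt B (fderiv ℝ B (y₀, 0)) (y₀, 0) :=
    (hB.differentiableAt (by simp)).hasFDerivAt
  set B' := fderiv ℝ B (y₀, 0) with hB'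
  have hB0 : B'.comp (ContinuousLinearMap.inl ℝ EM ℝ) = ContinuousLinearMap.id ℝ EM := by
    have h1 : HasFDerivAt (fun y : EM => (y, (0 : ℝ))) (ContinuousLinearMap.inl ℝ EM ℝ) y₀ :=
      hasFDerivAt_prodMk_left y₀ 0
    have h2 : HasFDerivAt (fun y : EM => B (y, 0)) (B'.comp (ContinuousLinearMap.inl ℝ EM ℝ)) y₀ :=
      hB1.comp (f := fun y : EM => (y, (0 : ℝ))) y₀ h1
    exact h2.unique ((hasFDerivAt_id y₀).congr_of_eventuallyEq h0)
  have hB0' : ∀ w, B' (w, 0) = w := fun w => congrArg (fun A => A w) hB0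
  have hadd : ∀ w s, B' (w, s) = w + B' (0, s) := by
    intro w s
    rw [← hB0' w, ← map_add, hB0']
    simp
  let e : (EM × ℝ) ≃L[ℝ] (EM × ℝ) := ContinuousLinearEquiv.equivOfInverse
    (B'.prod (ContinuousLinearMap.snd ℝ EM ℝ))
    ((ContinuousLinearMap.fst ℝ EM ℝ - B'.comp ((0 : EM × ℝ →L[ℝ] EM).prod
      (ContinuousLinearMap.snd ℝ EM ℝ))).prod (ContinuousLinearMap.snd ℝ EM ℝ))
    (by rintro ⟨w, s⟩; simp [hadd w s])
    (by rintro ⟨w, s⟩; simp [hadd (w - _) s])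
  have hΘ' : HasFDerivAt Θ (e : EM × ℝ →L[ℝ] EM × ℝ) (y₀, 0) := hB1.prodMk hasFDerivAt_snd
  have hstrict : HasStrictFDerivAt Θ (e : EM × ℝ →L[ℝ] EM × ℝ) (y₀, 0) :=
    hΘ.hasStrictFDerivAt' hΘ' (by simp)
  have hΘ0 : Θ (y₀, 0) = (y₀, 0) := Prod.ext h0.self_of_nhds rfl
  let inv := hΘ.localInverse hΘ' (by simp)
  have hinv : ContDiffAt ℝ ∞ inv (y₀, 0) := hΘ0 ▸ hΘ.to_localInverse hΘ' (by simp)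
  have hr : ∀ᶠ q in 𝓝 (y₀, (0 : ℝ)), Θ (inv q) = q := by
    have := hstrict.eventually_right_inverse
    rw [hΘ0] at this
    exact this
  have hl : ∀ᶠ q in 𝓝 (y₀, (0 : ℝ)), inv (Θ q) = q := hstrict.eventually_left_inverse
  refine ⟨fun q => (inv q).1, contDiffAt_fst.comp (y₀, 0) hinv, ?_, ?_⟩
  · filter_upwards [hr] with q hq
    have h2 : (inv q).2 = q.2 := (Prod.ext_iff.1 hq).2
    have h1 : B (inv q) = q.1 := (Prod.ext_iff.1 hq).1
    rw [← h1, ← h2]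
  · have hc : ContinuousAt (fun y : EM => (y, (0 : ℝ))) y₀ := by fun_prop
    filter_upwards [hc.eventually hl, h0] with y hy hy0
    have : Θ (y, 0) = (y, 0) := Prod.ext hy0 rfl
    rw [this] at hy
    rw [hy]

/-- Over a chart the tangent bundle is trivialized by the derivative of the chart, so a straight
line in the chart has the prescribed velocity. The chart is fixed at `p` while `g` varies, which
yields families depending smoothly on the base point. -/
theorem hasVelocity_extChartAt_symm {V N : Type*} [NormedAddCommGroup V] [NormedSpace ℝ V]
    [TopologicalSpace N] [ChartedSpace V N] [IsManifold 𝓘(ℝ, V) ∞ N] {p g : N}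
    (hg : g ∈ (chartAt V p).source) (v : TangentSpace 𝓘(ℝ, V) g) :
    HasVelocity 𝓘(ℝ, V) (fun τ : ℝ => (extChartAt 𝓘(ℝ, V) p).symm (extChartAt 𝓘(ℝ, V) p g + τ •
      (trivializationAt V (TangentSpace 𝓘(ℝ, V)) p (⟨g, v⟩ : TangentBundle 𝓘(ℝ, V) N)).2)) g v := by
  have : IsManifold 𝓘(ℝ, V) 1 N := IsManifold.of_le (n := ∞) (by simp)
  set φ := extChartAt 𝓘(ℝ, V) p with hφ
  set w : V := (trivializationAt V (TangentSpace 𝓘(ℝ, V)) p (⟨g, v⟩ : TangentBundle 𝓘(ℝ, V) N)).2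
    with hw
  have hgs : g ∈ φ.source := by rwa [hφ, extChartAt_source]
  have hwv : w = mfderiv 𝓘(ℝ, V) 𝓘(ℝ, V) φ g v := by
    have h1 := TangentBundle.continuousLinearMapAt_trivializationAt (I := 𝓘(ℝ, V)) hg
    refine Eq.trans ?_ (congrArg (fun A => A v) h1)
    exact (Bundle.Trivialization.coe_linearMapAt_of_mem (R := ℝ)
      (trivializationAt V (TangentSpace 𝓘(ℝ, V)) p) (b := g) (by simpa using hg) ▸ rfl)
  have h1 : HasVelocity 𝓘(ℝ, V) (fun τ : ℝ => φ g + τ • w) (φ g) w := by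
    rw [hasVelocity_iff_hasDerivAt]
    refine ⟨by simp, ?_⟩
    simpa using ((hasDerivAt_id (0 : ℝ)).smul_const w).const_add (φ g)
  have hd := mdifferentiableWithinAt_extChartAt_symm (I := 𝓘(ℝ, V)) (φ.map_source hgs)
  have h2 := h1.comp_within hd.hasMFDerivWithinAt (Filter.Eventually.of_forall fun τ => by simp)
  have h3 := mfderivWithin_extChartAt_symm_comp_mfderiv_extChartAt' (I := 𝓘(ℝ, V)) (x := p) hgs
  have h4 := congrArg (fun A : V →L[ℝ] V => A v) h3
  rw [hwv] at h2
  refine ⟨by simpa using φ.left_inv hgs, ?_⟩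
  rw [hwv]
  refine h2.2.congr_mfderiv ?_
  exact congrArg (ContinuousLinearMap.toSpanSingleton ℝ) h4

variable {𝒢} in
/-- A section of `TG|_M` is represented by a smooth family of curves. -/
theorem SmoothAlong.exists_curves {V : ∀ x, 𝒢.UnitTangent x} (hV : 𝒢.SmoothAlong V) (x₀ : M) :
    ∃ γ : M × ℝ → G, ContMDiffAt (𝓘(ℝ, EM).prod 𝓘(ℝ, ℝ)) 𝓘(ℝ, EG) ∞ γ (x₀, 0) ∧
      ∀ᶠ x in 𝓝 x₀, HasVelocity 𝓘(ℝ, EG) (fun τ => γ (x, τ)) (𝒢.unit x) (V x) := by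
  set p := 𝒢.unit x₀ with hp
  set φ := extChartAt 𝓘(ℝ, EG) p with hφ
  let Vh : M → EG := fun x => (trivializationAt EG (TangentSpace 𝓘(ℝ, EG)) p
        (⟨𝒢.unit x, V x⟩ : TangentBundle 𝓘(ℝ, EG) G)).2
  have hVh : ContMDiffAt 𝓘(ℝ, EM) 𝓘(ℝ, EG) ∞ Vh x₀ := (𝒢.smoothAlong_iff V).1 hV x₀
  refine ⟨fun q => φ.symm (φ (𝒢.unit q.1) + q.2 • Vh q.1), ?_, ?_⟩
  · have h1 : ContMDiffAt (𝓘(ℝ, EM).prod 𝓘(ℝ, ℝ)) 𝓘(ℝ, EG) ∞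
        (fun q : M × ℝ => φ (𝒢.unit q.1) + q.2 • Vh q.1) (x₀, 0) := by
      refine ContMDiffAt.add ?_ (ContMDiffAt.smul contMDiffAt_snd ?_)
      · refine ContMDiffAt.comp (x₀, (0 : ℝ)) (g := φ) (f := fun q : M × ℝ => 𝒢.unit q.1)
          contMDiffAt_extChartAt ?_
        exact (𝒢.contMDiff_unit x₀).comp (x₀, (0 : ℝ)) contMDiffAt_fst
      · exact ContMDiffAt.comp (x₀, (0 : ℝ)) (g := Vh) (f := Prod.fst) hVh contMDiffAt_fst
    have h2 : ContMDiffAt 𝓘(ℝ, EG) 𝓘(ℝ, EG) ∞ φ.symm (φ (𝒢.unit x₀) + (0 : ℝ) • Vh x₀) := by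
      rw [zero_smul, add_zero]
      exact (contMDiffOn_extChartAt_symm p).contMDiffAt (extChartAt_target_mem_nhds p)
    exact ContMDiffAt.comp (x₀, (0 : ℝ)) h2 h1
  · have h1 : ∀ᶠ x in 𝓝 x₀, 𝒢.unit x ∈ (chartAt EG p).source :=
      𝒢.contMDiff_unit.continuous.continuousAt.eventually
        ((chartAt EG p).open_source.mem_nhds (mem_chart_source EG p))
    filter_upwards [h1] with x hx
    exact hasVelocity_extChartAt_symm hx (V x)

/-- A family `γ` with velocities `V x` has moving targets. The maps `y ↦ t(γ(y, τ))` start at the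
identity, so they can be inverted by a family `A`, and `c(x, τ) = γ(A(x, τ), τ)` has target `x`. The
correction changes the velocity by a vector tangent to the units only. The class in `E` is thus
unchanged, and the representative killed by `Tt` is `leftRep`. -/
theorem exists_curves (X : 𝒢.Sec) (x₀ : M) :
    ∃ c : M × ℝ → G, ContMDiffAt (𝓘(ℝ, EM).prod 𝓘(ℝ, ℝ)) 𝓘(ℝ, EG) ∞ c (x₀, 0) ∧
      (∀ᶠ q in 𝓝 (x₀, (0 : ℝ)), 𝒢.tgt (c q) = q.1) ∧
      ∀ᶠ x in 𝓝 x₀, HasVelocity 𝓘(ℝ, EG) (fun τ => c (x, τ)) (𝒢.unit x) (𝒢.leftRep x (X.1 x)) := by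
  obtain ⟨V, hV, hX⟩ := X.2
  obtain ⟨γ, hγ, hγV⟩ := hV.exists_curves x₀
  set ψ := extChartAt 𝓘(ℝ, EM) x₀ with hψ
  have hψ0 : ContMDiffAt 𝓘(ℝ, EM) 𝓘(ℝ, EM) ∞ ψ x₀ := contMDiffAt_extChartAt
  have hψs : ContMDiffAt 𝓘(ℝ, EM) 𝓘(ℝ, EM) ∞ ψ.symm (ψ x₀) :=
    (contMDiffOn_extChartAt_symm x₀).contMDiffAt (extChartAt_target_mem_nhds x₀)
  have hψi : ψ.symm (ψ x₀) = x₀ := extChartAt_to_inv x₀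
  have hγ0 : γ (x₀, 0) = 𝒢.unit x₀ := hγV.self_of_nhds.1
  let β : EM × ℝ → M × ℝ := fun q => (ψ.symm q.1, q.2)
  have hβ : ContMDiffAt 𝓘(ℝ, EM × ℝ) (𝓘(ℝ, EM).prod 𝓘(ℝ, ℝ)) ∞ β (ψ x₀, 0) := by
    refine ContMDiffAt.prodMk ?_ contDiffAt_snd.contMDiffAt
    exact ContMDiffAt.comp (ψ x₀, (0 : ℝ)) (g := ψ.symm) (f := Prod.fst) hψs contDiffAt_fst.contMDiffAt
  have hβ0 : β (ψ x₀, 0) = (x₀, 0) := Prod.ext hψi rfl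
  let B : EM × ℝ → EM := fun q => ψ (𝒢.tgt (γ (β q)))
  have hγβ : ContMDiffAt 𝓘(ℝ, EM × ℝ) 𝓘(ℝ, EG) ∞ (fun q => γ (β q)) (ψ x₀, 0) :=
    by
    refine ContMDiffAt.comp (I' := 𝓘(ℝ, EM).prod 𝓘(ℝ, ℝ)) (ψ x₀, (0 : ℝ)) (g := γ) (f := β) ?_ hβ
    rw [hβ0]
    exact hγ
  have htγ : 𝒢.tgt (γ (β (ψ x₀, 0))) = x₀ := by rw [hβ0, hγ0, 𝒢.tgt_unit]
  have hB : ContDiffAt ℝ ∞ B (ψ x₀, 0) := by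
    rw [← contMDiffAt_iff_contDiffAt]
    refine ContMDiffAt.comp (I' := 𝓘(ℝ, EM)) (ψ x₀, (0 : ℝ)) (g := ψ) (f := fun q => 𝒢.tgt (γ (β q))) ?_ ?_
    · rw [htγ]; exact hψ0
    · exact (𝒢.contMDiff_tgt _).comp (ψ x₀, (0 : ℝ)) hγβ
  have hψsc : Filter.Tendsto ψ.symm (𝓝 (ψ x₀)) (𝓝 x₀) := by
    have := hψs.continuousAt.tendsto
    rwa [hψi] at this
  have htgt : ∀ᶠ y in 𝓝 (ψ x₀), y ∈ ψ.target := extChartAt_target_mem_nhds x₀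
  have hB0 : ∀ᶠ y in 𝓝 (ψ x₀), B (y, 0) = y := by
    filter_upwards [hψsc.eventually hγV, htgt] with y hy hyt
    have h1 : γ (β (y, 0)) = 𝒢.unit (ψ.symm y) := hy.1
    change ψ (𝒢.tgt (γ (β (y, 0)))) = y
    rw [h1, 𝒢.tgt_unit, ψ.right_inv hyt]
  obtain ⟨a, ha, haB, ha0⟩ := exists_smooth_inverse_family hB hB0
  -- the reparametrized base curves
  let A : M × ℝ → M := fun q => ψ.symm (a (ψ q.1, q.2))
  have ha00 : a (ψ x₀, 0) = ψ x₀ := ha0.self_of_nhds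
  have hψq : ContMDiffAt (𝓘(ℝ, EM).prod 𝓘(ℝ, ℝ)) 𝓘(ℝ, EM × ℝ) ∞
      (fun q : M × ℝ => (ψ q.1, q.2)) (x₀, 0) := by
    rw [modelWithCornersSelf_prod, ← chartedSpaceSelf_prod]
    refine ContMDiffAt.prodMk ?_ contMDiffAt_snd
    exact ContMDiffAt.comp (x₀, (0 : ℝ)) (g := ψ) (f := Prod.fst) hψ0 contMDiffAt_fst
  have haψ : ContMDiffAt (𝓘(ℝ, EM).prod 𝓘(ℝ, ℝ)) 𝓘(ℝ, EM) ∞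
      (fun q : M × ℝ => a (ψ q.1, q.2)) (x₀, 0) :=
    ContMDiffAt.comp (x₀, (0 : ℝ)) (g := a) (f := fun q : M × ℝ => (ψ q.1, q.2)) ha.contMDiffAt hψq
  have hA : ContMDiffAt (𝓘(ℝ, EM).prod 𝓘(ℝ, ℝ)) 𝓘(ℝ, EM) ∞ A (x₀, 0) := by
    refine ContMDiffAt.comp (x₀, (0 : ℝ)) (g := ψ.symm) (f := fun q : M × ℝ => a (ψ q.1, q.2)) ?_ haψ
    simp only [ha00]
    exact hψs
  have hsrc : ∀ᶠ x in 𝓝 x₀, x ∈ ψ.source := extChartAt_source_mem_nhds x₀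
  have hA0 : ∀ᶠ x in 𝓝 x₀, A (x, 0) = x := by
    filter_upwards [hψ0.continuousAt.eventually ha0, hsrc] with x hx hxs
    change ψ.symm (a (ψ x, 0)) = x
    rw [hx, ψ.left_inv hxs]
  have hA00 : A (x₀, 0) = x₀ := hA0.self_of_nhds
  have hAτ : ContMDiffAt (𝓘(ℝ, EM).prod 𝓘(ℝ, ℝ)) (𝓘(ℝ, EM).prod 𝓘(ℝ, ℝ)) ∞
      (fun q : M × ℝ => (A q, q.2)) (x₀, 0) := hA.prodMk contMDiffAt_snd
  have hc : ContMDiffAt (𝓘(ℝ, EM).prod 𝓘(ℝ, ℝ)) 𝓘(ℝ, EG) ∞ (fun q => γ (A q, q.2)) (x₀, 0) := by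
    refine ContMDiffAt.comp (x₀, (0 : ℝ)) (g := γ) (f := fun q : M × ℝ => (A q, q.2)) ?_ hAτ
    simp only [hA00]
    exact hγ
  have hct : ∀ᶠ q in 𝓝 (x₀, (0 : ℝ)), 𝒢.tgt (γ (A q, q.2)) = q.1 := by
    have h1 : ∀ᶠ q in 𝓝 (x₀, (0 : ℝ)), q.1 ∈ ψ.source :=
      (continuousAt_fst (p := (x₀, (0 : ℝ)))).eventually hsrc
    have h2 : ∀ᶠ q in 𝓝 (x₀, (0 : ℝ)), 𝒢.tgt (γ (A q, q.2)) ∈ ψ.source := by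
      have := (𝒢.contMDiff_tgt.continuous.continuousAt.comp hc.continuousAt)
      refine this.eventually ?_
      simp only [Function.comp_apply, hA00, hγ0, 𝒢.tgt_unit]
      exact hsrc
    filter_upwards [h1, h2, hψq.continuousAt.eventually haB] with q hq1 hq2 hq3
    exact ψ.injOn hq2 hq1 hq3
  refine ⟨fun q => γ (A q, q.2), hc, hct, ?_⟩
  have hct' : ∀ᶠ x in 𝓝 x₀, ∀ᶠ τ in 𝓝 (0 : ℝ), 𝒢.tgt (γ (A (x, τ), τ)) = x := by
    rw [nhds_prod_eq] at hct
    exact hct.curry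
  have hslice : ContinuousAt (fun x : M => (x, (0 : ℝ))) x₀ := by fun_prop
  have hγ1 := hslice.eventually ((contMDiffAt_iff_contMDiffAt_nhds (by simp)).1
    (hγ.of_le (m := 1) (by simp)))
  have hA1 := hslice.eventually ((contMDiffAt_iff_contMDiffAt_nhds (by simp)).1
    (hA.of_le (m := 1) (by simp)))
  filter_upwards [hct', hγ1, hA1, hA0, hγV, eventually_eventually_nhds.2 hγV] with x ht hγx hAx hA0x hVx hVx'
  have hγd : MDifferentiableAt (𝓘(ℝ, EM).prod 𝓘(ℝ, ℝ)) 𝓘(ℝ, EG) γ (x, 0) :=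
    hγx.mdifferentiableAt (by simp)
  set D : EM × ℝ →L[ℝ] EG := mfderiv (𝓘(ℝ, EM).prod 𝓘(ℝ, ℝ)) 𝓘(ℝ, EG) γ (x, 0) with hD
  have hγx0 : γ (x, 0) = 𝒢.unit x := hVx.1
  have key : ∀ {α : ℝ → M} {ρ : ℝ → ℝ} {k : EM} {r : ℝ}, HasVelocity 𝓘(ℝ, EM) α x k →
      HasVelocity 𝓘(ℝ, ℝ) ρ 0 r → HasVelocity 𝓘(ℝ, EG) (fun τ => γ (α τ, ρ τ)) (𝒢.unit x) (D (k, r)) := by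
    intro α ρ k r h h'
    have := (h.prodMk h').comp hγd
    exact ⟨this.1.trans hγx0, this.2⟩
  have hid : HasVelocity 𝓘(ℝ, ℝ) (fun τ : ℝ => τ) 0 1 :=
    hasVelocity_iff_hasDerivAt.2 ⟨rfl, hasDerivAt_id 0⟩
  have hAv := ((hasVelocity_const (I := 𝓘(ℝ, EM)) x).prodMk hid).comp
    (hAx.mdifferentiableAt (by simp))
  rw [hA0x] at hAv
  obtain ⟨k, hk⟩ : ∃ k : EM, HasVelocity 𝓘(ℝ, EM) (fun τ => A (x, τ)) x k := ⟨_, hAv⟩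
  have hcv := key hk hid
  have e1 : D (0, 1) = V x := (key (hasVelocity_const x) hid).unique hVx
  obtain ⟨δ, hδ⟩ : ∃ δ : ℝ → M, HasVelocity 𝓘(ℝ, EM) δ x k := ⟨_, hk⟩
  -- `γ(y, 0)` is the unit at `y` for all `y` near `x`, not only at `x` itself; hence the doubled
  -- `eventually` above.
  have e2 : D (k, 0) = 𝒢.dUnit x k := by
    refine (key hδ (hasVelocity_const (I := 𝓘(ℝ, ℝ)) 0)).unique ?_
    refine (hasVelocity_unit hδ).congr ?_
    filter_upwards [hδ.tendsto.eventually hVx'] with τ hτ using hτ.1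
  obtain ⟨v, hv⟩ : ∃ v : 𝒢.UnitTangent x, v = D (k, 1) := ⟨_, rfl⟩
  rw [← hv] at hcv
  have e3 : v = 𝒢.dUnit x k + V x := by
    have h1 : D (k, 1) = D (k, 0) + D (0, 1) := by rw [← map_add]; simp
    rw [hv, h1, e1, e2]
    rfl
  have e4 : 𝒢.dTgt x v = 0 :=
    (hasVelocity_tgt hcv).unique ((hasVelocity_const (I := 𝓘(ℝ, EM)) x).congr ht)
  have e5 : X.1 x = (𝒢.tangentUnits x).mkQ v := by
    rw [hX, e3, map_add]
    have : (𝒢.tangentUnits x).mkQ (𝒢.dUnit x k) = 0 := by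
      rw [Submodule.mkQ_apply, Submodule.Quotient.mk_eq_zero]
      exact ⟨k, rfl⟩
    rw [this, zero_add]
  rw [e5, leftRep_of_dTgt_eq_zero 𝒢 e4]
  exact hcv

/-! ### Smoothness of the invariant vector fields -/

/-- Smooth vector fields on `G`. -/
def SmoothField (V : ∀ g : G, TangentSpace 𝓘(ℝ, EG) g) : Prop :=
  ContMDiff 𝓘(ℝ, EG) 𝓘(ℝ, EG).tangent ∞ (fun g => (⟨g, V g⟩ : TangentBundle 𝓘(ℝ, EG) G))

/-- In the chart at `g₀` the field is the partial derivative at `τ = 0` of a jointly smooth map. -/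
theorem contMDiffAt_of_hasVelocity {Φ : G × ℝ → G} {g₀ : G}
    (hΦ : ContMDiffAt (𝓘(ℝ, EG).prod 𝓘(ℝ, ℝ)) 𝓘(ℝ, EG) ∞ Φ (g₀, 0))
    {W : ∀ g : G, TangentSpace 𝓘(ℝ, EG) g}
    (hW : ∀ᶠ g in 𝓝 g₀, HasVelocity 𝓘(ℝ, EG) (fun τ => Φ (g, τ)) g (W g)) :
    ContMDiffAt 𝓘(ℝ, EG) 𝓘(ℝ, EG).tangent ∞
      (fun g => (⟨g, W g⟩ : TangentBundle 𝓘(ℝ, EG) G)) g₀ := by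
  have : IsManifold 𝓘(ℝ, EG) 1 G := IsManifold.of_le (n := ∞) (by simp)
  rw [Bundle.contMDiffAt_totalSpace]
  refine ⟨contMDiffAt_id, ?_⟩
  set φ := extChartAt 𝓘(ℝ, EG) g₀ with hφ
  have hφ0 : ContMDiffAt 𝓘(ℝ, EG) 𝓘(ℝ, EG) ∞ φ g₀ := contMDiffAt_extChartAt
  have hφs : ContMDiffAt 𝓘(ℝ, EG) 𝓘(ℝ, EG) ∞ φ.symm (φ g₀) :=
    (contMDiffOn_extChartAt_symm g₀).contMDiffAt (extChartAt_target_mem_nhds g₀)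
  have hφi : φ.symm (φ g₀) = g₀ := extChartAt_to_inv g₀
  have hΦ0 : Φ (g₀, 0) = g₀ := hW.self_of_nhds.1
  let β : EG × ℝ → G × ℝ := fun q => (φ.symm q.1, q.2)
  have hβ : ContMDiffAt 𝓘(ℝ, EG × ℝ) (𝓘(ℝ, EG).prod 𝓘(ℝ, ℝ)) ∞ β (φ g₀, 0) := by
    refine ContMDiffAt.prodMk ?_ contDiffAt_snd.contMDiffAt
    exact ContMDiffAt.comp (φ g₀, (0 : ℝ)) (g := φ.symm) (f := Prod.fst) hφs contDiffAt_fst.contMDiffAt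
  have hβ0 : β (φ g₀, 0) = (g₀, 0) := Prod.ext hφi rfl
  let u : EG × ℝ → EG := fun q => φ (Φ (β q))
  have hu : ContDiffAt ℝ ∞ u (φ g₀, 0) := by
    rw [← contMDiffAt_iff_contDiffAt]
    refine ContMDiffAt.comp (I' := 𝓘(ℝ, EG)) (φ g₀, (0 : ℝ)) (g := φ) (f := fun q => Φ (β q)) ?_ ?_
    · rw [hβ0, hΦ0]; exact hφ0
    · refine ContMDiffAt.comp (I' := 𝓘(ℝ, EG).prod 𝓘(ℝ, ℝ)) (φ g₀, (0 : ℝ)) (g := Φ) (f := β) ?_ hβ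
      rw [hβ0]
      exact hΦ
  have hu' : ContDiffAt ℝ ∞ (fderiv ℝ u) (φ g₀, 0) := hu.fderiv_right (by simp)
  have hslice : ContDiffAt ℝ ∞ (fun y : EG => (y, (0 : ℝ))) (φ g₀) :=
    contDiffAt_id.prodMk contDiffAt_const
  have hD : ContDiffAt ℝ ∞ (fun y : EG => fderiv ℝ u (y, 0) (0, 1)) (φ g₀) :=
    (ContDiffAt.comp (φ g₀) (f := fun y : EG => (y, (0 : ℝ))) hu' hslice).clm_apply contDiffAt_const
  have hd : ∀ᶠ y in 𝓝 (φ g₀), DifferentiableAt ℝ u (y, 0) := by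
    have h1 := (hu.of_le (m := 1) (by simp)).eventually (by simp)
    filter_upwards [hslice.continuousAt.eventually h1] with y hy using hy.differentiableAt (by simp)
  refine (ContMDiffAt.comp g₀ (g := fun y : EG => fderiv ℝ u (y, 0) (0, 1)) (f := φ)
    hD.contMDiffAt hφ0).congr_of_eventuallyEq ?_
  have hsrc : ∀ᶠ g in 𝓝 g₀, g ∈ (chartAt EG g₀).source :=
    (chartAt EG g₀).open_source.mem_nhds (mem_chart_source EG g₀)
  filter_upwards [hW, hsrc, hφ0.continuousAt.eventually hd] with g hg hgs hgd
  have hgs' : g ∈ φ.source := by rwa [hφ, extChartAt_source]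
  have h1 := TangentBundle.continuousLinearMapAt_trivializationAt (I := 𝓘(ℝ, EG)) hgs
  have h2 : (trivializationAt EG (TangentSpace 𝓘(ℝ, EG)) g₀
      (⟨g, W g⟩ : TangentBundle 𝓘(ℝ, EG) G)).2 = mfderiv 𝓘(ℝ, EG) 𝓘(ℝ, EG) φ g (W g) := by
    refine Eq.trans ?_ (congrArg (fun A => A (W g)) h1)
    exact (Bundle.Trivialization.coe_linearMapAt_of_mem (R := ℝ)
      (trivializationAt EG (TangentSpace 𝓘(ℝ, EG)) g₀) (b := g) (by simpa using hgs) ▸ rfl)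
  have h3 := (hasVelocity_iff_hasDerivAt.1 (hg.comp (mdifferentiableAt_extChartAt hgs))).2
  have h4 : HasDerivAt (fun τ : ℝ => (φ g, τ)) ((0, 1) : EG × ℝ) 0 :=
    (hasDerivAt_const (0 : ℝ) (φ g)).prodMk (hasDerivAt_id 0)
  have h5 := hgd.hasFDerivAt.comp_hasDerivAt (0 : ℝ) h4
  have h6 : (u ∘ fun τ : ℝ => (φ g, τ)) = fun τ => φ (Φ (g, τ)) := by
    funext τ
    change φ (Φ (φ.symm (φ g), τ)) = _
    rw [φ.left_inv hgs']
  rw [h6] at h5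
  exact h2.trans (h3.unique h5)

theorem contMDiffAt_mul {V N : Type*} [NormedAddCommGroup V] [NormedSpace ℝ V] {H : Type*}
    [TopologicalSpace H] {I : ModelWithCorners ℝ V H} [TopologicalSpace N] [ChartedSpace H N]
    {a b : N → G} {q : N}
    (ha : ContMDiffAt I 𝓘(ℝ, EG) ∞ a q) (hb : ContMDiffAt I 𝓘(ℝ, EG) ∞ b q)
    (hab : ∀ᶠ q in 𝓝 q, 𝒢.src (a q) = 𝒢.tgt (b q)) :
    ContMDiffAt I 𝓘(ℝ, EG) ∞ (fun q => 𝒢.mul (a q) (b q)) q := by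
  let S : Set N := {q | 𝒢.src (a q) = 𝒢.tgt (b q)}
  have h1 : ContMDiffWithinAt I (𝓘(ℝ, EG).prod 𝓘(ℝ, EG)) ∞ (fun q => (a q, b q)) S q :=
    (ha.prodMk hb).contMDiffWithinAt
  have h2 := 𝒢.contMDiffOn_mul (a q, b q) hab.self_of_nhds
  exact (h2.comp (t := {p : G × G | 𝒢.src p.1 = 𝒢.tgt p.2}) q h1 (fun q hq => hq)).contMDiffAt hab

/-- The field is the initial velocity of the smooth family `g ∘ c(s(g), τ)`, with `c` from
`exists_curves`. -/
theorem smooth_leftField (X : 𝒢.Sec) : SmoothField (𝒢.leftField X.1) := by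
  intro g₀
  obtain ⟨c, hc, hct, hcv⟩ := 𝒢.exists_curves X (𝒢.src g₀)
  have hs : ContMDiffAt (𝓘(ℝ, EG).prod 𝓘(ℝ, ℝ)) (𝓘(ℝ, EM).prod 𝓘(ℝ, ℝ)) ∞
      (fun q : G × ℝ => (𝒢.src q.1, q.2)) (g₀, 0) :=
    ((𝒢.contMDiff_src g₀).comp (g₀, (0 : ℝ)) contMDiffAt_fst).prodMk contMDiffAt_snd
  have hΦ : ContMDiffAt (𝓘(ℝ, EG).prod 𝓘(ℝ, ℝ)) 𝓘(ℝ, EG) ∞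
      (fun q : G × ℝ => 𝒢.mul q.1 (c (𝒢.src q.1, q.2))) (g₀, 0) := by
    refine 𝒢.contMDiffAt_mul contMDiffAt_fst
      (ContMDiffAt.comp (g₀, (0 : ℝ)) (g := c) (f := fun q : G × ℝ => (𝒢.src q.1, q.2)) hc hs) ?_
    filter_upwards [hs.continuousAt.eventually hct] with q hq using hq.symm
  refine contMDiffAt_of_hasVelocity hΦ ?_
  have hct' : ∀ᶠ x in 𝓝 (𝒢.src g₀), ∀ᶠ τ in 𝓝 (0 : ℝ), 𝒢.tgt (c (x, τ)) = x := by
    rw [nhds_prod_eq] at hct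
    exact hct.curry
  filter_upwards [𝒢.contMDiff_src.continuous.continuousAt.eventually (hcv.and hct')] with g hg
  exact hasVelocity_mul_left rfl hg.1 hg.2

theorem exists_left_curve (X : 𝒢.Sec) (x : M) :
    ∃ c : ℝ → G, ContMDiffAt 𝓘(ℝ, ℝ) 𝓘(ℝ, EG) ∞ c 0 ∧ (∀ᶠ τ in 𝓝 0, 𝒢.tgt (c τ) = x) ∧
      HasVelocity 𝓘(ℝ, EG) c (𝒢.unit x) (𝒢.leftRep x (X.1 x)) := by
  obtain ⟨c, hc, hct, hcv⟩ := 𝒢.exists_curves X x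
  have h1 : ContMDiffAt 𝓘(ℝ, ℝ) (𝓘(ℝ, EM).prod 𝓘(ℝ, ℝ)) ∞ (fun τ : ℝ => (x, τ)) 0 :=
    contMDiffAt_const.prodMk contMDiffAt_id
  exact ⟨fun τ => c (x, τ), ContMDiffAt.comp (0 : ℝ) (g := c) (f := fun τ : ℝ => (x, τ)) hc h1,
    h1.continuousAt.eventually hct, hcv.self_of_nhds⟩

/-- Inversion exchanges the two kinds of fibres and reverses the sign, so a left curve for `-X` is
inverted. -/
theorem exists_right_curve (X : 𝒢.Sec) (x : M) :
    ∃ c : ℝ → G, ContMDiffAt 𝓘(ℝ, ℝ) 𝓘(ℝ, EG) ∞ c 0 ∧ (∀ᶠ τ in 𝓝 0, 𝒢.src (c τ) = x) ∧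
      HasVelocity 𝓘(ℝ, EG) c (𝒢.unit x) (𝒢.rightRep x (X.1 x)) := by
  obtain ⟨c, hc, hct, hcv⟩ := 𝒢.exists_left_curve (-X) x
  refine ⟨fun τ => 𝒢.inv (c τ), (𝒢.contMDiff_inv _).comp (0 : ℝ) hc,
    hct.mono fun τ h => (𝒢.src_inv _).trans h, ?_⟩
  have h1 := 𝒢.hasVelocity_inv_leftRep hcv
  have h2 : -𝒢.rightRep x ((-X : 𝒢.Sec).1 x) = 𝒢.rightRep x (X.1 x) := by
    change -𝒢.rightRep x (-(X.1 x)) = _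
    rw [map_neg, neg_neg]
  rwa [h2] at h1

theorem rightField_neg (X : ∀ x, 𝒢.Fibre x) (g : G) : 𝒢.rightField (-X) g = -𝒢.rightField X g := by
  simp only [rightField, Pi.neg_apply, map_neg]

theorem leftField_add (X Y : ∀ x, 𝒢.Fibre x) (g : G) :
    𝒢.leftField (X + Y) g = 𝒢.leftField X g + 𝒢.leftField Y g := by
  simp only [leftField, Pi.add_apply, map_add]

theorem leftField_smulSec (f : C^∞⟮𝓘(ℝ, EM), M; 𝓘(ℝ, ℝ), ℝ⟯) (X : 𝒢.Sec) (g : G) :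
    𝒢.leftField (𝒢.smulSec f X).1 g = f (𝒢.src g) • 𝒢.leftField X.1 g := by
  simp only [leftField, smulSec, map_smul]

/-- Inversion maps the left-invariant vector field of `X` to the right-invariant field of `-X`. -/
theorem mfderiv_inv_leftField (X : 𝒢.Sec) (g : G) :
    (mfderiv 𝓘(ℝ, EG) 𝓘(ℝ, EG) 𝒢.inv g (𝒢.leftField X.1 g) : TangentSpace 𝓘(ℝ, EG) (𝒢.inv g)) =
      -𝒢.rightField X.1 (𝒢.inv g) := by
  obtain ⟨c, -, hct, hcv⟩ := 𝒢.exists_left_curve X (𝒢.src g)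
  have h1 := (hasVelocity_mul_left (g := g) rfl hcv hct).comp (𝒢.inv_mdifferentiableAt g)
  have h2 : HasVelocity 𝓘(ℝ, EG) (fun τ => 𝒢.inv (c τ)) (𝒢.unit (𝒢.src g))
      (𝒢.rightRep (𝒢.src g) ((-X.1) (𝒢.src g))) := by
    have := 𝒢.hasVelocity_inv_leftRep hcv
    rwa [← map_neg] at this
  -- `inv (g ∘ c τ) = inv (c τ) ∘ inv g` is a right translate of the inverted curve.
  have h3 := hasVelocity_mul_right (X := -X.1) (𝒢.tgt_inv g) h2
    (hct.mono fun τ h => (𝒢.src_inv _).trans h)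
  rw [rightField_neg] at h3
  refine h1.unique (h3.congr ?_)
  filter_upwards [hct] with τ hτ
  exact 𝒢.inv_mul_rev hτ.symm

/-- `X^R` is the image of `(-X)^L` under inversion, so smoothness is inherited from the left field.
-/
theorem smooth_rightField (X : 𝒢.Sec) : SmoothField (𝒢.rightField X.1) := by
  have h1 : ContMDiff 𝓘(ℝ, EG) 𝓘(ℝ, EG).tangent ∞ (fun g : G => tangentMap 𝓘(ℝ, EG) 𝓘(ℝ, EG) 𝒢.inv
      (⟨𝒢.inv g, 𝒢.leftField (-X : 𝒢.Sec).1 (𝒢.inv g)⟩ : TangentBundle 𝓘(ℝ, EG) G)) :=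
    (𝒢.contMDiff_inv.contMDiff_tangentMap (m := ∞) (by simp)).comp
      ((𝒢.smooth_leftField (-X)).comp 𝒢.contMDiff_inv)
  have h2 : (fun g : G => tangentMap 𝓘(ℝ, EG) 𝓘(ℝ, EG) 𝒢.inv
      (⟨𝒢.inv g, 𝒢.leftField (-X : 𝒢.Sec).1 (𝒢.inv g)⟩ : TangentBundle 𝓘(ℝ, EG) G)) =
      fun g => (⟨g, 𝒢.rightField X.1 g⟩ : TangentBundle 𝓘(ℝ, EG) G) := by
    funext g
    have h3 := 𝒢.mfderiv_inv_leftField (-X) (𝒢.inv g)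
    have h4 : -𝒢.rightField (-X : 𝒢.Sec).1 (𝒢.inv (𝒢.inv g)) = 𝒢.rightField X.1 (𝒢.inv (𝒢.inv g)) := by
      change -𝒢.rightField (-(X.1)) _ = _
      rw [rightField_neg, neg_neg]
    rw [h4] at h3
    have h5 : (⟨𝒢.inv (𝒢.inv g), 𝒢.rightField X.1 (𝒢.inv (𝒢.inv g))⟩ : TangentBundle 𝓘(ℝ, EG) G) =
      ⟨g, 𝒢.rightField X.1 g⟩ := by rw [𝒢.inv_inv]
    exact Eq.trans (congrArg (Bundle.TotalSpace.mk' EG (𝒢.inv (𝒢.inv g))) h3) h5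
  rw [h2] at h1
  exact h1

/-! ### Derivatives of functions along vector fields -/

/-- Schwarz's theorem, in the form in which the inner partial derivatives are already known as
functions `p` and `q`. -/
theorem mixed_partial_symm {u : ℝ × ℝ → ℝ} (hu : ContDiffAt ℝ ∞ u (0, 0)) {p q : ℝ → ℝ} {P Q : ℝ}
    (hp : ∀ᶠ τ in 𝓝 (0 : ℝ), HasDerivAt (fun σ => u (σ, τ)) (p τ) 0) (hP : HasDerivAt p P 0)
    (hq : ∀ᶠ σ in 𝓝 (0 : ℝ), HasDerivAt (fun τ => u (σ, τ)) (q σ) 0) (hQ : HasDerivAt q Q 0) :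
    P = Q := by
  have hd : ∀ᶠ r in 𝓝 ((0 : ℝ), (0 : ℝ)), DifferentiableAt ℝ u r := by
    filter_upwards [(hu.of_le (m := 1) (by simp)).eventually (by simp)] with r hr
    exact hr.differentiableAt (by simp)
  have hd2 : DifferentiableAt ℝ (fderiv ℝ u) (0, 0) :=
    (hu.fderiv_right (m := 1) (WithTop.coe_le_coe.2 (le_top : (1 + 1 : ℕ∞) ≤ ⊤))).differentiableAt
      one_ne_zero
  have hv : HasDerivAt (fun τ : ℝ => ((0 : ℝ), τ)) ((0, 1) : ℝ × ℝ) 0 :=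
    (hasDerivAt_const (0 : ℝ) (0 : ℝ)).prodMk (hasDerivAt_id 0)
  have hh : HasDerivAt (fun σ : ℝ => (σ, (0 : ℝ))) ((1, 0) : ℝ × ℝ) 0 :=
    (hasDerivAt_id (0 : ℝ)).prodMk (hasDerivAt_const (0 : ℝ) (0 : ℝ))
  have hp' : p =ᶠ[𝓝 0] fun τ => fderiv ℝ u (0, τ) (1, 0) := by
    filter_upwards [hp, hv.continuousAt.eventually hd] with τ h1 h2
    have h3 : HasDerivAt (fun σ : ℝ => (σ, τ)) ((1, 0) : ℝ × ℝ) 0 :=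
      (hasDerivAt_id (0 : ℝ)).prodMk (hasDerivAt_const (0 : ℝ) τ)
    exact h1.unique (h2.hasFDerivAt.comp_hasDerivAt (0 : ℝ) h3)
  have hq' : q =ᶠ[𝓝 0] fun σ => fderiv ℝ u (σ, 0) (0, 1) := by
    filter_upwards [hq, hh.continuousAt.eventually hd] with σ h1 h2
    have h3 : HasDerivAt (fun τ : ℝ => (σ, τ)) ((0, 1) : ℝ × ℝ) 0 :=
      (hasDerivAt_const (0 : ℝ) σ).prodMk (hasDerivAt_id (0 : ℝ))
    exact h1.unique (h2.hasFDerivAt.comp_hasDerivAt (0 : ℝ) h3)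
  have hP' := (hP.congr_of_eventuallyEq hp'.symm).unique
    ((HasFDerivAt.comp_hasDerivAt (0 : ℝ) (f := fun τ : ℝ => ((0 : ℝ), τ)) hd2.hasFDerivAt hv).clm_apply
      (hasDerivAt_const (0 : ℝ) ((1, 0) : ℝ × ℝ)))
  have hQ' := (hQ.congr_of_eventuallyEq hq'.symm).unique
    ((HasFDerivAt.comp_hasDerivAt (0 : ℝ) (f := fun σ : ℝ => (σ, (0 : ℝ))) hd2.hasFDerivAt hh).clm_apply
      (hasDerivAt_const (0 : ℝ) ((0, 1) : ℝ × ℝ)))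
  rw [hP', hQ']
  have h2 : (2 : ℕ∞ω) ≤ ∞ := WithTop.coe_le_coe.2 (le_top : (2 : ℕ∞) ≤ ⊤)
  have hs := hu.isSymmSndFDerivAt (by rwa [minSmoothness_of_isRCLikeNormedField]) (0, 1) (1, 0)
  simpa using hs

theorem smooth_along {V : ∀ g : G, TangentSpace 𝓘(ℝ, EG) g} (hV : SmoothField V) {f : G → ℝ}
    (hf : ContMDiff 𝓘(ℝ, EG) 𝓘(ℝ, ℝ) ∞ f) : ContMDiff 𝓘(ℝ, EG) 𝓘(ℝ, ℝ) ∞ (along V f) :=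
  (contMDiff_snd_tangentBundle_modelSpace ℝ 𝓘(ℝ, ℝ)).comp
    ((hf.contMDiff_tangentMap (m := ∞) (by simp)).comp hV)

theorem hasDerivAt_along {V : ∀ g : G, TangentSpace 𝓘(ℝ, EG) g} {f : G → ℝ}
    {γ : ℝ → G} {g : G} (h : HasVelocity 𝓘(ℝ, EG) γ g (V g))
    (hf : MDifferentiableAt 𝓘(ℝ, EG) 𝓘(ℝ, ℝ) f g) :
    HasDerivAt (fun τ => f (γ τ)) (along V f g) 0 :=
  (hasVelocity_iff_hasDerivAt.1 (h.comp hf)).2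

theorem mdiff_real {f : G → ℝ} (hf : ContMDiff 𝓘(ℝ, EG) 𝓘(ℝ, ℝ) ∞ f) (g : G) :
    MDifferentiableAt 𝓘(ℝ, EG) 𝓘(ℝ, ℝ) f g := (hf g).mdifferentiableAt (by simp)

theorem along_add {V : ∀ g : G, TangentSpace 𝓘(ℝ, EG) g} {f f' : G → ℝ} {g : G}
    (hf : MDifferentiableAt 𝓘(ℝ, EG) 𝓘(ℝ, ℝ) f g) (hf' : MDifferentiableAt 𝓘(ℝ, EG) 𝓘(ℝ, ℝ) f' g) :
    along V (fun g => f g + f' g) g = along V f g + along V f' g := by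
  have : IsManifold 𝓘(ℝ, EG) 1 G := IsManifold.of_le (n := ∞) (by simp)
  obtain ⟨γ, hγ⟩ := exists_hasVelocity (I := 𝓘(ℝ, EG)) g (V g)
  exact (hasDerivAt_along hγ (hf.add hf')).unique
    ((hasDerivAt_along hγ hf).add (hasDerivAt_along hγ hf'))

theorem along_mul {V : ∀ g : G, TangentSpace 𝓘(ℝ, EG) g} {f f' : G → ℝ} {g : G}
    (hf : MDifferentiableAt 𝓘(ℝ, EG) 𝓘(ℝ, ℝ) f g) (hf' : MDifferentiableAt 𝓘(ℝ, EG) 𝓘(ℝ, ℝ) f' g) :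
    along V (fun g => f g * f' g) g = along V f g * f' g + f g * along V f' g := by
  have : IsManifold 𝓘(ℝ, EG) 1 G := IsManifold.of_le (n := ∞) (by simp)
  obtain ⟨γ, hγ⟩ := exists_hasVelocity (I := 𝓘(ℝ, EG)) g (V g)
  have h := (hasDerivAt_along hγ hf).mul (hasDerivAt_along hγ hf')
  simp only [hγ.1] at h
  exact (hasDerivAt_along hγ (hf.mul hf')).unique h

theorem along_neg (V : ∀ g : G, TangentSpace 𝓘(ℝ, EG) g) (f : G → ℝ) (g : G) :
    along V (fun g => -f g) g = -along V f g :=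
  congrArg (fun A : EG →L[ℝ] ℝ => A (V g)) (mfderiv_neg (I := 𝓘(ℝ, EG)) (f := f) (x := g))

theorem along_congr_field {V W : ∀ g : G, TangentSpace 𝓘(ℝ, EG) g} {g : G} (h : V g = W g)
    (f : G → ℝ) : along V f g = along W f g := congrArg (mfderiv 𝓘(ℝ, EG) 𝓘(ℝ, ℝ) f g) h

theorem along_field_add (V W : ∀ g : G, TangentSpace 𝓘(ℝ, EG) g) (f : G → ℝ) (g : G) :
    along (fun g => V g + W g) f g = along V f g + along W f g :=
  (mfderiv 𝓘(ℝ, EG) 𝓘(ℝ, ℝ) f g).map_add (V g) (W g)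

theorem along_field_smul (φ : G → ℝ) (V : ∀ g : G, TangentSpace 𝓘(ℝ, EG) g) (f : G → ℝ) (g : G) :
    along (fun g => φ g • V g) f g = φ g * along V f g :=
  (mfderiv 𝓘(ℝ, EG) 𝓘(ℝ, ℝ) f g).map_smul (φ g) (V g)

/-- Left-invariant and right-invariant vector fields commute. -/
theorem along_left_right_comm (X Z : 𝒢.Sec) {f : G → ℝ} (hf : ContMDiff 𝓘(ℝ, EG) 𝓘(ℝ, ℝ) ∞ f)
    (g : G) : along (𝒢.leftField X.1) (along (𝒢.rightField Z.1) f) g =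
      along (𝒢.rightField Z.1) (along (𝒢.leftField X.1) f) g := by
  obtain ⟨c, hc, hct, hcv⟩ := 𝒢.exists_left_curve X (𝒢.src g)
  obtain ⟨d, hd, hds, hdv⟩ := 𝒢.exists_right_curve Z (𝒢.tgt g)
  have hcg : ContMDiffAt 𝓘(ℝ, ℝ) 𝓘(ℝ, EG) ∞ (fun τ => 𝒢.mul g (c τ)) 0 :=
    𝒢.contMDiffAt_mul contMDiffAt_const hc (hct.mono fun τ h => h.symm)
  have hcd : ∀ σ τ, 𝒢.src (d σ) = 𝒢.tgt g → 𝒢.tgt (c τ) = 𝒢.src g →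
      𝒢.src (d σ) = 𝒢.tgt (𝒢.mul g (c τ)) := fun σ τ h1 h2 => by
    rw [𝒢.tgt_mul _ _ h2.symm, h1]
  -- By associativity, varying the first parameter right-translates `d` and varying the second
  -- left-translates `c`. The two iterated derivatives of `f` are therefore the two mixed partials
  -- of `f ∘ m` at the origin.
  let m : ℝ × ℝ → G := fun q => 𝒢.mul (d q.1) (𝒢.mul g (c q.2))
  have hm : ContMDiffAt 𝓘(ℝ, ℝ × ℝ) 𝓘(ℝ, EG) ∞ m (0, 0) := by
    refine 𝒢.contMDiffAt_mul ?_ ?_ ?_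
    · exact ContMDiffAt.comp ((0 : ℝ), (0 : ℝ)) (g := d) (f := Prod.fst) hd
        contDiffAt_fst.contMDiffAt
    · exact ContMDiffAt.comp ((0 : ℝ), (0 : ℝ)) (g := fun τ => 𝒢.mul g (c τ)) (f := Prod.snd) hcg
        contDiffAt_snd.contMDiffAt
    · have h1 := (continuousAt_fst (p := ((0 : ℝ), (0 : ℝ)))).eventually hds
      have h2 := (continuousAt_snd (p := ((0 : ℝ), (0 : ℝ)))).eventually hct
      filter_upwards [h1, h2] with q hq1 hq2 using hcd _ _ hq1 hq2
  have hu : ContDiffAt ℝ ∞ (fun q => f (m q)) (0, 0) := by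
    rw [← contMDiffAt_iff_contDiffAt]
    exact (hf _).comp ((0 : ℝ), (0 : ℝ)) hm
  have hR := smooth_along (𝒢.smooth_rightField Z) hf
  have hL := smooth_along (𝒢.smooth_leftField X) hf
  have h1 := hasDerivAt_along (hasVelocity_mul_left (g := g) rfl hcv hct) (mdiff_real hR g)
  have h2 := hasDerivAt_along (hasVelocity_mul_right (g := g) rfl hdv hds) (mdiff_real hL g)
  have h3 : ∀ᶠ τ in 𝓝 (0 : ℝ), HasDerivAt (fun σ => f (m (σ, τ)))
      (along (𝒢.rightField Z.1) f (𝒢.mul g (c τ))) 0 := by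
    filter_upwards [hct] with τ hτ
    exact hasDerivAt_along (hasVelocity_mul_right (g := 𝒢.mul g (c τ)) (𝒢.tgt_mul _ _ hτ.symm)
      hdv hds) (mdiff_real hf _)
  have h4 : ∀ᶠ σ in 𝓝 (0 : ℝ), HasDerivAt (fun τ => f (m (σ, τ)))
      (along (𝒢.leftField X.1) f (𝒢.mul (d σ) g)) 0 := by
    filter_upwards [hds] with σ hσ
    refine (hasDerivAt_along (hasVelocity_mul_left (g := 𝒢.mul (d σ) g) (𝒢.src_mul _ _ hσ)
      hcv hct) (mdiff_real hf _)).congr_of_eventuallyEq ?_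
    filter_upwards [hct] with τ hτ
    exact congrArg f (𝒢.mul_assoc _ _ _ hσ hτ.symm).symm
  exact mixed_partial_symm hu h3 h1 h4 h2

theorem leftField_unit (X : 𝒢.Sec) (x : M) :
    𝒢.leftField X.1 (𝒢.unit x) = 𝒢.leftRep x (X.1 x) := by
  obtain ⟨c, -, hct, hcv⟩ := 𝒢.exists_left_curve X x
  refine (hasVelocity_mul_left (g := 𝒢.unit x) (𝒢.src_unit x) hcv hct).unique (hcv.congr ?_)
  filter_upwards [hct] with τ hτ
  have := 𝒢.unit_mul (c τ)
  rwa [hτ] at this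

theorem rightField_unit (X : 𝒢.Sec) (x : M) :
    𝒢.rightField X.1 (𝒢.unit x) = 𝒢.rightRep x (X.1 x) := by
  obtain ⟨c, -, hct, hcv⟩ := 𝒢.exists_right_curve X x
  refine (hasVelocity_mul_right (g := 𝒢.unit x) (𝒢.tgt_unit x) hcv hct).unique (hcv.congr ?_)
  filter_upwards [hct] with τ hτ
  have := 𝒢.mul_unit (c τ)
  rwa [hτ] at this

theorem anchorDeriv_eq_of_hasVelocity (X : 𝒢.Sec) {f : M → ℝ} {x : M} {γ : ℝ → M}
    (hγ : HasVelocity 𝓘(ℝ, EM) γ x (𝒢.anchor x (X.1 x)))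
    (hf : MDifferentiableAt 𝓘(ℝ, EM) 𝓘(ℝ, ℝ) f x) :
    HasDerivAt (fun τ => f (γ τ)) (𝒢.anchorDeriv X f x) 0 :=
  (hasVelocity_iff_hasDerivAt.1 (hγ.comp hf)).2

/-- `Ts` maps `leftRep` to the anchor. This produces the derivative term of the Leibniz rule. -/
theorem along_left_comp_src (X : 𝒢.Sec) {f : M → ℝ} (hf : ContMDiff 𝓘(ℝ, EM) 𝓘(ℝ, ℝ) ∞ f) (x : M) :
    along (𝒢.leftField X.1) (fun g => f (𝒢.src g)) (𝒢.unit x) = 𝒢.anchorDeriv X f x := by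
  obtain ⟨c, -, hct, hcv⟩ := 𝒢.exists_left_curve X x
  have h1 := hasVelocity_src hcv
  rw [dSrc_leftRep] at h1
  rw [← leftField_unit] at hcv
  exact (hasDerivAt_along hcv (mdiff_real (hf.comp 𝒢.contMDiff_src) _)).unique
    (𝒢.anchorDeriv_eq_of_hasVelocity X h1 ((hf x).mdifferentiableAt (by simp)))

/-- At the units, `X^L - X^R` is the anchor. -/
theorem along_left_unit (X : 𝒢.Sec) {f : G → ℝ} (hf : ContMDiff 𝓘(ℝ, EG) 𝓘(ℝ, ℝ) ∞ f) (x : M) :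
    along (𝒢.leftField X.1) f (𝒢.unit x) = along (𝒢.rightField X.1) f (𝒢.unit x) +
      𝒢.anchorDeriv X (fun y => f (𝒢.unit y)) x := by
  have : IsManifold 𝓘(ℝ, EM) 1 M := IsManifold.of_le (n := ∞) (by simp)
  obtain ⟨γ, hγ⟩ := exists_hasVelocity (I := 𝓘(ℝ, EM)) x (𝒢.anchor x (X.1 x))
  have h1 := 𝒢.anchorDeriv_eq_of_hasVelocity X hγ (f := fun y => f (𝒢.unit y))
    (((hf.comp 𝒢.contMDiff_unit) x).mdifferentiableAt (by simp))
  have h2 := (hasVelocity_iff_hasDerivAt.1 ((hasVelocity_unit hγ).comp (mdiff_real hf (𝒢.unit x)))).2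
  have h3 := h1.unique h2
  unfold along
  rw [h3, leftField_unit, rightField_unit, leftRep_eq]
  exact (mfderiv 𝓘(ℝ, EG) 𝓘(ℝ, ℝ) f (𝒢.unit x)).map_add _ _

theorem along_left_comp_inv (X : 𝒢.Sec) {f : G → ℝ} (hf : ContMDiff 𝓘(ℝ, EG) 𝓘(ℝ, ℝ) ∞ f) :
    along (𝒢.leftField X.1) (fun g => f (𝒢.inv g)) =
      fun g => -along (𝒢.rightField X.1) f (𝒢.inv g) := by
  funext g
  have h1 := mfderiv_comp (I := 𝓘(ℝ, EG)) (I' := 𝓘(ℝ, EG)) (I'' := 𝓘(ℝ, ℝ)) g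
    (mdiff_real hf (𝒢.inv g)) (𝒢.inv_mdifferentiableAt g)
  have h2 := congrArg (fun A => A (𝒢.leftField X.1 g)) h1
  refine Eq.trans h2 ?_
  have h3 := congrArg (mfderiv 𝓘(ℝ, EG) 𝓘(ℝ, ℝ) f (𝒢.inv g)) (𝒢.mfderiv_inv_leftField X g)
  exact Eq.trans h3 ((mfderiv 𝓘(ℝ, EG) 𝓘(ℝ, ℝ) f (𝒢.inv g)).map_neg _)

theorem along_right_comp_inv (X : 𝒢.Sec) {f : G → ℝ} (hf : ContMDiff 𝓘(ℝ, EG) 𝓘(ℝ, ℝ) ∞ f) :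
    along (𝒢.rightField X.1) (fun g => f (𝒢.inv g)) =
      fun g => -along (𝒢.leftField X.1) f (𝒢.inv g) := by
  have h1 := 𝒢.along_left_comp_inv X (f := fun g => f (𝒢.inv g)) (hf.comp 𝒢.contMDiff_inv)
  simp only [𝒢.inv_inv] at h1
  funext g
  have h2 := congrFun h1 (𝒢.inv g)
  simp only [𝒢.inv_inv] at h2
  rw [← neg_eq_iff_eq_neg] at h2
  rw [← h2]

/-! ### The Lie bracket as a commutator -/

/-- The Lie bracket of vector fields acts on functions as the commutator. -/
theorem along_mlieBracket {V W : ∀ g : G, TangentSpace 𝓘(ℝ, EG) g} (hV : SmoothField V)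
    (hW : SmoothField W) {f : G → ℝ} (hf : ContMDiff 𝓘(ℝ, EG) 𝓘(ℝ, ℝ) ∞ f) (p : G) :
    along (VectorField.mlieBracket 𝓘(ℝ, EG) V W) f p = along V (along W f) p - along W (along V f) p := by
  have : IsManifold 𝓘(ℝ, EG) 1 G := IsManifold.of_le (n := ∞) (by simp)
  have : IsManifold 𝓘(ℝ, EG) 2 G :=
    IsManifold.of_le (n := ∞) (WithTop.coe_le_coe.2 (le_top : (2 : ℕ∞) ≤ ⊤))
  set φ := extChartAt 𝓘(ℝ, EG) p with hφ
  let fh : EG → ℝ := f ∘ φ.symm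
  have hfh : ContDiffAt ℝ ∞ fh (φ p) := contDiffAt_chart hf p
  let pull : (∀ g : G, TangentSpace 𝓘(ℝ, EG) g) → EG → EG := fun W y =>
    VectorField.mpullbackWithin 𝓘(ℝ, EG) 𝓘(ℝ, EG) φ.symm W (Set.range 𝓘(ℝ, EG)) y
  have hpi : φ.symm (φ p) = p := extChartAt_to_inv p
  have hdiff : ∀ W : ∀ g : G, TangentSpace 𝓘(ℝ, EG) g, SmoothField W →
      DifferentiableAt ℝ (pull W) (φ p) := by
    intro W hW
    have h1 : MDifferentiableWithinAt 𝓘(ℝ, EG) 𝓘(ℝ, EG).tangent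
      (fun g => (⟨g, W g⟩ : TangentBundle 𝓘(ℝ, EG) G)) Set.univ p :=
      ((hW p).mdifferentiableAt (by simp)).mdifferentiableWithinAt
    have h2 := h1.differentiableWithinAt_mpullbackWithin_vectorField
    have h3 : ((extChartAt 𝓘(ℝ, EG) p).symm ⁻¹' Set.univ ∩ Set.range 𝓘(ℝ, EG)) = Set.univ := by simp
    rw [h3] at h2
    exact differentiableWithinAt_univ.1 h2
  have hdsymm : ∀ y ∈ φ.target, MDifferentiableAt 𝓘(ℝ, EG) 𝓘(ℝ, EG) φ.symm y := by
    intro y hy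
    have h1 := mdifferentiableWithinAt_extChartAt_symm (I := 𝓘(ℝ, EG)) hy
    have h2 := h1.mdifferentiableAt (by simp)
    exact h2
  have hinv : ∀ W : ∀ g : G, TangentSpace 𝓘(ℝ, EG) g, ∀ y ∈ φ.target,
      (mfderiv 𝓘(ℝ, EG) 𝓘(ℝ, EG) φ.symm y (pull W y) : EG) = W (φ.symm y) := by
    intro W y hy
    obtain ⟨e, he⟩ := isInvertible_mfderivWithin_extChartAt_symm (I := 𝓘(ℝ, EG)) hy
    have h1 : mfderivWithin 𝓘(ℝ, EG) 𝓘(ℝ, EG) φ.symm (Set.range 𝓘(ℝ, EG)) y =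
        mfderiv 𝓘(ℝ, EG) 𝓘(ℝ, EG) φ.symm y := by
      simp
    have h2 : pull W y = e.symm (W (φ.symm y)) := by
      change (mfderivWithin 𝓘(ℝ, EG) 𝓘(ℝ, EG) φ.symm (Set.range 𝓘(ℝ, EG)) y).inverse _ = _
      rw [← he, ContinuousLinearMap.inverse_equiv]
      rfl
    rw [← h1, ← he, h2]
    exact e.apply_symm_apply _
  have halong : ∀ W : ∀ g : G, TangentSpace 𝓘(ℝ, EG) g, ∀ h : G → ℝ,
      ContMDiff 𝓘(ℝ, EG) 𝓘(ℝ, ℝ) ∞ h → ∀ y ∈ φ.target,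
      along W h (φ.symm y) = fderiv ℝ (h ∘ φ.symm) y (pull W y) := by
    intro W h hh y hy
    have h1 := mfderiv_comp (I := 𝓘(ℝ, EG)) (I' := 𝓘(ℝ, EG)) (I'' := 𝓘(ℝ, ℝ)) y
      (mdiff_real hh (φ.symm y)) (hdsymm y hy)
    rw [mfderiv_eq_fderiv] at h1
    have h2 := congrArg (fun A : EG →L[ℝ] ℝ => A (pull W y)) h1
    refine Eq.trans ?_ h2.symm
    exact congrArg (mfderiv 𝓘(ℝ, EG) 𝓘(ℝ, ℝ) h (φ.symm y)) (hinv W y hy).symm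
  have htgt : ∀ᶠ y in 𝓝 (φ p), y ∈ φ.target := extChartAt_target_mem_nhds p
  have hd2 : DifferentiableAt ℝ (fderiv ℝ fh) (φ p) :=
    (hfh.fderiv_right (m := 1) (WithTop.coe_le_coe.2 (le_top : (1 + 1 : ℕ∞) ≤ ⊤))).differentiableAt
      one_ne_zero
  -- In the chart, `V W f = D²f(V, W) + Df(DW · V)`. In the commutator the symmetric first terms
  -- cancel, and the rest is `Df` applied to the coordinate bracket; at `p` the chart has identity
  -- derivative.
  have hsecond : ∀ V W : ∀ g : G, TangentSpace 𝓘(ℝ, EG) g, SmoothField V → SmoothField W →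
      along V (along W f) p = fderiv ℝ (fderiv ℝ fh) (φ p) (pull V (φ p)) (pull W (φ p)) +
        fderiv ℝ fh (φ p) (fderiv ℝ (pull W) (φ p) (pull V (φ p))) := by
    intro V W hV hW
    have h1 := halong V (along W f) (smooth_along hW hf) (φ p) (mem_extChartAt_target p)
    rw [hpi] at h1
    have h2 : (along W f ∘ φ.symm) =ᶠ[𝓝 (φ p)] fun y => fderiv ℝ fh y (pull W y) := by
      filter_upwards [htgt] with y hy using halong W f hf y hy
    rw [h1, h2.fderiv_eq]
    have h3 := hd2.hasFDerivAt.clm_apply (hdiff W hW).hasFDerivAt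
    rw [h3.fderiv]
    simp [add_comm]
  have hsym : fderiv ℝ (fderiv ℝ fh) (φ p) (pull V (φ p)) (pull W (φ p)) =
      fderiv ℝ (fderiv ℝ fh) (φ p) (pull W (φ p)) (pull V (φ p)) := by
    have h : (2 : ℕ∞ω) ≤ ∞ := WithTop.coe_le_coe.2 (le_top : (2 : ℕ∞) ≤ ⊤)
    exact hfh.isSymmSndFDerivAt (by rwa [minSmoothness_of_isRCLikeNormedField]) _ _
  have hbr : (VectorField.mlieBracket 𝓘(ℝ, EG) V W p : EG) =
      fderiv ℝ (pull W) (φ p) (pull V (φ p)) - fderiv ℝ (pull V) (φ p) (pull W (φ p)) := by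
    have h1 := VectorField.mlieBracketWithin_apply (I := 𝓘(ℝ, EG)) (V := V) (W := W)
      (s := Set.univ) (x₀ := p)
    rw [VectorField.mlieBracketWithin_univ] at h1
    rw [h1, mfderiv_extChartAt_self]
    have h2 : ((extChartAt 𝓘(ℝ, EG) p).symm ⁻¹' Set.univ ∩ Set.range 𝓘(ℝ, EG)) = Set.univ := by simp
    rw [h2]
    refine Eq.trans (congrArg (fun A : EG →L[ℝ] EG => A _) ContinuousLinearMap.inverse_id) ?_
    change VectorField.lieBracketWithin ℝ (pull V) (pull W) Set.univ (φ p) = _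
    rw [VectorField.lieBracketWithin_univ]
    rfl
  have hfin : along (VectorField.mlieBracket 𝓘(ℝ, EG) V W) f p =
      fderiv ℝ fh (φ p) (VectorField.mlieBracket 𝓘(ℝ, EG) V W p) := by
    have h1 := halong (VectorField.mlieBracket 𝓘(ℝ, EG) V W) f hf (φ p) (mem_extChartAt_target p)
    have h2 := hinv (VectorField.mlieBracket 𝓘(ℝ, EG) V W) (φ p) (mem_extChartAt_target p)
    rw [hpi] at h1
    rw [h1]
    refine congrArg (fderiv ℝ fh (φ p)) ?_
    have h3 := congrArg (fun A : EG →L[ℝ] EG => A (pull (VectorField.mlieBracket 𝓘(ℝ, EG) V W) (φ p)))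
      (mfderivWithin_range_extChartAt_symm (I := 𝓘(ℝ, EG)) (x := p))
    have h4 : mfderivWithin 𝓘(ℝ, EG) 𝓘(ℝ, EG) φ.symm (Set.range 𝓘(ℝ, EG)) (φ p) =
        mfderiv 𝓘(ℝ, EG) 𝓘(ℝ, EG) φ.symm (φ p) := by
      simp
    have h5 := congrArg (fun A : EG →L[ℝ] EG => A (pull (VectorField.mlieBracket 𝓘(ℝ, EG) V W) (φ p))) h4
    have h6 := h3.symm.trans (h5.trans h2)
    refine Eq.trans h6 ?_
    rw [hpi]
  rw [hfin, hsecond V W hV hW, hsecond W V hW hV, hsym]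
  have h7 := congrArg (fderiv ℝ fh (φ p)) hbr
  rw [map_sub] at h7
  rw [add_sub_add_left_eq_sub]
  exact h7

/-! ### Bump functions and sections -/

/-- The Hausdorff property of `M` enters the proof through this lemma. With `tsupport f ⊆ U`, data
given on `U` only can be extended by zero after multiplication by `f`. -/
theorem exists_bump [T2Space M] {x₀ : M} {U : Set M} (hU : U ∈ 𝓝 x₀) :
    ∃ f : C^∞⟮𝓘(ℝ, EM), M; 𝓘(ℝ, ℝ), ℝ⟯, (∀ᶠ x in 𝓝 x₀, f x = 1) ∧ tsupport f ⊆ U := by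
  obtain ⟨f, -, hf⟩ := (SmoothBumpFunction.nhds_basis_tsupport (I := 𝓘(ℝ, EM)) x₀).mem_iff.1 hU
  exact ⟨⟨f, f.contMDiff⟩, f.eventuallyEq_one, hf⟩

theorem smoothAlong_smul_of_tsupport {f : M → ℝ} (hf : ContMDiff 𝓘(ℝ, EM) 𝓘(ℝ, ℝ) ∞ f)
    {V : ∀ x, 𝒢.UnitTangent x} (hV : ∀ x ∈ tsupport f, ContMDiffAt 𝓘(ℝ, EM) 𝓘(ℝ, EG).tangent ∞
      (fun x => (⟨𝒢.unit x, V x⟩ : TangentBundle 𝓘(ℝ, EG) G)) x) :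
    𝒢.SmoothAlong (fun x => f x • V x) := by
  rw [smoothAlong_iff]
  intro x₀
  by_cases hx : x₀ ∈ tsupport f
  · have h1 := (Bundle.contMDiffAt_totalSpace.1 (hV x₀ hx)).2
    refine ((hf x₀).smul h1).congr_of_eventuallyEq ?_
    filter_upwards [𝒢.eventually_mem_baseSet x₀] with x hx
    exact ((trivializationAt EG (TangentSpace 𝓘(ℝ, EG)) (𝒢.unit x₀)).linear ℝ hx).2 (f x) (V x)
  · refine (contMDiffAt_const (c := (0 : EG))).congr_of_eventuallyEq ?_
    filter_upwards [𝒢.eventually_mem_baseSet x₀, notMem_tsupport_iff_eventuallyEq.1 hx] with x hx h0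
    have h2 : f x • V x = 0 := by rw [h0]; exact zero_smul ℝ (V x)
    rw [h2]
    exact (((trivializationAt EG (TangentSpace 𝓘(ℝ, EG)) (𝒢.unit x₀)).linear ℝ hx).mk' _).map_zero

/-- Every element of a fibre of `E` is the value of a smooth section. -/
theorem exists_section [T2Space M] (x₀ : M) (e : 𝒢.Fibre x₀) : ∃ X : 𝒢.Sec, X.1 x₀ = e := by
  obtain ⟨v, rfl⟩ := (𝒢.tangentUnits x₀).mkQ_surjective e
  set t := trivializationAt EG (TangentSpace 𝓘(ℝ, EG)) (𝒢.unit x₀) with ht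
  obtain ⟨f, hf1, hfU⟩ := exists_bump (EM := EM) (𝒢.eventually_mem_baseSet x₀)
  set w : EG := (t (⟨𝒢.unit x₀, v⟩ : TangentBundle 𝓘(ℝ, EG) G)).2 with hw
  let V : ∀ x, 𝒢.UnitTangent x := fun x => t.symm (𝒢.unit x) w
  have hV : 𝒢.SmoothAlong (fun x => f x • V x) := by
    refine 𝒢.smoothAlong_smul_of_tsupport f.contMDiff fun x hx => ?_
    have hx' : 𝒢.unit x ∈ t.baseSet := hfU hx
    have hopen : ∀ᶠ y in 𝓝 x, 𝒢.unit y ∈ t.baseSet :=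
      𝒢.contMDiff_unit.continuous.continuousAt.eventually (t.open_baseSet.mem_nhds hx')
    have h1 : ContMDiffAt (𝓘(ℝ, EG).prod 𝓘(ℝ, EG)) 𝓘(ℝ, EG).tangent ∞
        t.toOpenPartialHomeomorph.symm (𝒢.unit x, w) := by
      refine (Bundle.Trivialization.contMDiffOn_symm t).contMDiffAt ?_
      exact t.open_target.mem_nhds (t.mem_target.2 hx')
    have h2 : ContMDiffAt 𝓘(ℝ, EM) (𝓘(ℝ, EG).prod 𝓘(ℝ, EG)) ∞ (fun y : M => (𝒢.unit y, w)) x :=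
      (𝒢.contMDiff_unit x).prodMk contMDiffAt_const
    refine (ContMDiffAt.comp x (g := t.toOpenPartialHomeomorph.symm)
      (f := fun y : M => (𝒢.unit y, w)) h1 h2).congr_of_eventuallyEq ?_
    filter_upwards [hopen] with y hy
    exact t.mk_symm hy w
  refine ⟨⟨fun x => (𝒢.tangentUnits x).mkQ (f x • V x), _, hV, fun _ => rfl⟩, ?_⟩
  have h1 : V x₀ = v := t.symm_apply_apply_mk (FiberBundle.mem_baseSet_trivializationAt' _) v
  change (𝒢.tangentUnits x₀).mkQ (f x₀ • V x₀) = _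
  rw [h1, hf1.self_of_nhds, one_smul]

/-! ### Second and third derivatives of contrast functions -/

namespace ContrastFunction

variable {𝒢} (F : 𝒢.ContrastFunction)

/-- `dF` vanishes along `M`, so `W F` does too, and its derivative in a direction tangent to `M` is
zero. -/
theorem hessian_dUnit {W : ∀ g : G, TangentSpace 𝓘(ℝ, EG) g} (hW : SmoothField W) (x : M)
    (w : TangentSpace 𝓘(ℝ, EM) x) :
    hessian F.toFun (𝒢.unit x) (𝒢.dUnit x w) (W (𝒢.unit x)) = 0 := by
  have : IsManifold 𝓘(ℝ, EM) 1 M := IsManifold.of_le (n := ∞) (by simp)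
  have h1 := along_along F.smooth (𝒢.unit x) (F.deriv_unit x) (fun _ => 𝒢.dUnit x w) W
    ((hW _).mdifferentiableAt (by simp))
  obtain ⟨γ, hγ⟩ := exists_hasVelocity (I := 𝓘(ℝ, EM)) x w
  have h2 := hasDerivAt_along (V := fun _ => 𝒢.dUnit x w) (hasVelocity_unit hγ)
    (mdiff_real (smooth_along hW F.smooth) (𝒢.unit x))
  have h3 : (fun τ => along W F.toFun (𝒢.unit (γ τ))) = fun _ => 0 := by
    funext τ
    unfold along
    rw [F.deriv_unit]
    rfl
  rw [h3] at h2
  exact h1.symm.trans (h2.unique (hasDerivAt_const (0 : ℝ) (0 : ℝ)))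

/-- Vectors tangent to the units lie in the radical of the Hessian, so `g^F` can be computed from
any representatives, here an arbitrary `v` and the right one. -/
theorem hessian_rightRep [T2Space M] (x : M) (v : 𝒢.UnitTangent x) (Z : 𝒢.Sec) :
    hessian F.toFun (𝒢.unit x) v (𝒢.rightRep x (Z.1 x)) =
      F.metric x ((𝒢.tangentUnits x).mkQ v) (Z.1 x) := by
  have h1 := F.hessian_dUnit (𝒢.smooth_rightField Z) x (𝒢.dTgt x v)
  rw [rightField_unit] at h1
  have h2 : v = 𝒢.leftRep x ((𝒢.tangentUnits x).mkQ v) + 𝒢.dUnit x (𝒢.dTgt x v) := by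
    rw [leftRep_mkQ, sub_add_cancel]
  have h3 : ∀ (e : 𝒢.Fibre x) (w : TangentSpace 𝓘(ℝ, EM) x),
      hessian F.toFun (𝒢.unit x) (𝒢.leftRep x e) (𝒢.dUnit x w) = 0 := by
    intro e w
    obtain ⟨X, rfl⟩ := 𝒢.exists_section x e
    rw [hessian_symm F.smooth, ← leftField_unit]
    exact F.hessian_dUnit (𝒢.smooth_leftField X) x w
  have h4 : 𝒢.rightRep x (Z.1 x) = 𝒢.leftRep x (Z.1 x) - 𝒢.dUnit x (𝒢.anchor x (Z.1 x)) := by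
    rw [leftRep_eq, add_sub_cancel_right]
  conv_lhs => rw [h2]
  rw [map_add, LinearMap.add_apply, h1, add_zero, h4, map_sub, h3, sub_zero]
  rfl

theorem along_left_along_right [T2Space M] (X Z : 𝒢.Sec) (x : M) :
    along (𝒢.leftField X.1) (along (𝒢.rightField Z.1) F.toFun) (𝒢.unit x) =
      F.metric x (X.1 x) (Z.1 x) := by
  rw [along_along F.smooth _ (F.deriv_unit x) _ _
    ((𝒢.smooth_rightField Z _).mdifferentiableAt (by simp)), leftField_unit, rightField_unit,
    hessian_rightRep]
  congr 1
  obtain ⟨v, hv⟩ := (𝒢.tangentUnits x).mkQ_surjective (X.1 x)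
  rw [← hv, leftRep_mkQ, map_sub]
  have : (𝒢.tangentUnits x).mkQ (𝒢.dUnit x (𝒢.dTgt x v)) = 0 := by
    rw [Submodule.mkQ_apply, Submodule.Quotient.mk_eq_zero]
    exact ⟨_, rfl⟩
  rw [this, sub_zero]

theorem along_right_along_left [T2Space M] (X Z : 𝒢.Sec) (x : M) :
    along (𝒢.rightField Z.1) (along (𝒢.leftField X.1) F.toFun) (𝒢.unit x) =
      F.metric x (X.1 x) (Z.1 x) := by
  rw [← along_left_right_comm 𝒢 X Z F.smooth, along_left_along_right]

theorem smooth_metric [T2Space M] (X Z : 𝒢.Sec) :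
    ContMDiff 𝓘(ℝ, EM) 𝓘(ℝ, ℝ) ∞ (fun x => F.metric x (X.1 x) (Z.1 x)) := by
  have h := (smooth_along (𝒢.smooth_leftField X)
    (smooth_along (𝒢.smooth_rightField Z) F.smooth)).comp 𝒢.contMDiff_unit
  exact h.congr fun x => (F.along_left_along_right X Z x).symm

theorem along_star_right (X : 𝒢.Sec) :
    along (𝒢.rightField X.1) F.star.toFun = fun g => -along (𝒢.leftField X.1) F.toFun (𝒢.inv g) :=
  𝒢.along_right_comp_inv X F.smooth

/-- Passing two invariant fields through inversion produces two signs, which cancel: `X^L Y^R F*` is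
`(X^R Y^L F) ∘ inv`. -/
theorem metric_star [T2Space M] (x : M) : F.star.metric x = F.metric x := by
  refine LinearMap.ext fun e => LinearMap.ext fun e' => ?_
  obtain ⟨X, rfl⟩ := 𝒢.exists_section x e
  obtain ⟨Y, rfl⟩ := 𝒢.exists_section x e'
  have hs := smooth_along (𝒢.smooth_leftField Y) F.smooth
  rw [← along_left_along_right, along_star_right, along_neg, 𝒢.along_left_comp_inv X hs, neg_neg,
    𝒢.inv_unit, along_right_along_left, metric_symm]

theorem star_star : F.star.star = F := by
  cases F
  simp only [star, 𝒢.inv_inv]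

/-- The third derivatives of `F` and of `F*` are dual with respect to the metric. -/
theorem third_add_third_star [T2Space M] (X Y Z : 𝒢.Sec) (x : M) :
    𝒢.third X Y Z F.toFun x + 𝒢.third X Z Y F.star.toFun x =
      𝒢.anchorDeriv X (fun y => F.metric y (Y.1 y) (Z.1 y)) x := by
  have hY := smooth_along (𝒢.smooth_leftField Y) F.smooth
  have hZY := smooth_along (𝒢.smooth_rightField Z) hY
  have h1 : along (𝒢.leftField Y.1) (along (𝒢.rightField Z.1) F.toFun) =
      along (𝒢.rightField Z.1) (along (𝒢.leftField Y.1) F.toFun) :=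
    funext (along_left_right_comm 𝒢 Y Z F.smooth)
  have h2 : along (𝒢.leftField Z.1) (along (𝒢.rightField Y.1) F.star.toFun) =
      fun g => along (𝒢.rightField Z.1) (along (𝒢.leftField Y.1) F.toFun) (𝒢.inv g) := by
    funext g
    rw [along_star_right, along_neg, 𝒢.along_left_comp_inv Z hY, neg_neg]
  unfold third
  -- Both terms are now derivatives of the same function `Z^R Y^L F`, along `X^L` and along `-X^R`;
  -- on `M` that function is `g(Y, Z)`.
  rw [h1, h2, 𝒢.along_left_comp_inv X hZY, along_left_unit 𝒢 X hZY]
  simp only [along_right_along_left, 𝒢.inv_unit]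
  ring

/-- The third derivatives are torsion-free. -/
theorem third_sub_third_swap [T2Space M] (X Y Z : 𝒢.Sec) (x : M) :
    𝒢.third X Y Z F.toFun x - 𝒢.third Y X Z F.toFun x = F.metric x (𝒢.bracket X Y x) (Z.1 x) := by
  have hZ := smooth_along (𝒢.smooth_rightField Z) F.smooth
  unfold third
  -- The units are critical points of `F`, so the derivative of `Z^R F` along the commutator is a
  -- Hessian value and sees only the class of `[X^L, Y^L]` in `E`.
  rw [← along_mlieBracket (𝒢.smooth_leftField X) (𝒢.smooth_leftField Y) hZ,
    along_along F.smooth _ (F.deriv_unit x) _ _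
    ((𝒢.smooth_rightField Z _).mdifferentiableAt (by simp)), rightField_unit, hessian_rightRep]
  rfl

end ContrastFunction

/-! ### Dependence of the third derivative on its arguments -/

theorem third_smooth (X Y Z : 𝒢.Sec) {f : G → ℝ} (hf : ContMDiff 𝓘(ℝ, EG) 𝓘(ℝ, ℝ) ∞ f) :
    ContMDiff 𝓘(ℝ, EM) 𝓘(ℝ, ℝ) ∞ (𝒢.third X Y Z f) :=
  (smooth_along (𝒢.smooth_leftField X) (smooth_along (𝒢.smooth_leftField Y)
    (smooth_along (𝒢.smooth_rightField Z) hf))).comp 𝒢.contMDiff_unit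

/-- The third derivative as a linear form in the last argument. -/
def thirdForm (X Y : 𝒢.Sec) (f : G → ℝ) (x : M) : 𝒢.Fibre x →ₗ[ℝ] ℝ :=
  (mfderiv 𝓘(ℝ, EG) 𝓘(ℝ, ℝ) (along (𝒢.leftField X.1) (along (𝒢.leftField Y.1) f))
    (𝒢.unit x)).toLinearMap ∘ₗ 𝒢.rightRep x

/-- Commuted past both left fields, `Z^R` is applied last, and so it enters only through its value
at the unit. -/
theorem thirdForm_apply (X Y Z : 𝒢.Sec) {f : G → ℝ} (hf : ContMDiff 𝓘(ℝ, EG) 𝓘(ℝ, ℝ) ∞ f) (x : M) :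
    𝒢.thirdForm X Y f x (Z.1 x) = 𝒢.third X Y Z f x := by
  have h1 : along (𝒢.leftField Y.1) (along (𝒢.rightField Z.1) f) =
      along (𝒢.rightField Z.1) (along (𝒢.leftField Y.1) f) :=
    funext (along_left_right_comm 𝒢 Y Z hf)
  unfold third
  rw [h1, along_left_right_comm 𝒢 X Z (smooth_along (𝒢.smooth_leftField Y) hf)]
  unfold along
  rw [rightField_unit]
  rfl

theorem third_add_left (X X' Y Z : 𝒢.Sec) (f : G → ℝ) (x : M) :
    𝒢.third (X + X') Y Z f x = 𝒢.third X Y Z f x + 𝒢.third X' Y Z f x := by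
  unfold third
  rw [← along_field_add]
  exact along_congr_field (𝒢.leftField_add X.1 X'.1 _) _

theorem third_smul_left (φ : C^∞⟮𝓘(ℝ, EM), M; 𝓘(ℝ, ℝ), ℝ⟯) (X Y Z : 𝒢.Sec) (f : G → ℝ) (x : M) :
    𝒢.third (𝒢.smulSec φ X) Y Z f x = φ x * 𝒢.third X Y Z f x := by
  have h1 := along_congr_field (W := fun g => φ (𝒢.src g) • 𝒢.leftField X.1 g)
    (𝒢.leftField_smulSec φ X (𝒢.unit x))
    (along (𝒢.leftField Y.1) (along (𝒢.rightField Z.1) f))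
  rw [along_field_smul (fun g => φ (𝒢.src g)), 𝒢.src_unit] at h1
  exact h1

theorem third_add_middle (X Y Y' Z : 𝒢.Sec) {f : G → ℝ} (hf : ContMDiff 𝓘(ℝ, EG) 𝓘(ℝ, ℝ) ∞ f)
    (x : M) : 𝒢.third X (Y + Y') Z f x = 𝒢.third X Y Z f x + 𝒢.third X Y' Z f x := by
  have hZ := smooth_along (𝒢.smooth_rightField Z) hf
  have h1 : along (𝒢.leftField (Y + Y' : 𝒢.Sec).1) (along (𝒢.rightField Z.1) f) =
      fun g => along (𝒢.leftField Y.1) (along (𝒢.rightField Z.1) f) g +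
        along (𝒢.leftField Y'.1) (along (𝒢.rightField Z.1) f) g := by
    funext g
    rw [← along_field_add]
    exact along_congr_field (𝒢.leftField_add Y.1 Y'.1 _) _
  unfold third
  rw [h1, along_add (mdiff_real (smooth_along (𝒢.smooth_leftField Y) hZ) _)
    (mdiff_real (smooth_along (𝒢.smooth_leftField Y') hZ) _)]

/-- `(φ Y)^L = (φ ∘ s) Y^L`, so the product rule for `X^L` adds the derivative of `φ ∘ s` times `Y^L
Z^R F`, which on `M` is `g(Y, Z)`. -/
theorem ContrastFunction.third_smul_middle [T2Space M] (F : 𝒢.ContrastFunction)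
    (φ : C^∞⟮𝓘(ℝ, EM), M; 𝓘(ℝ, ℝ), ℝ⟯) (X Y Z : 𝒢.Sec) (x : M) :
    𝒢.third X (𝒢.smulSec φ Y) Z F.toFun x =
      φ x * 𝒢.third X Y Z F.toFun x + 𝒢.anchorDeriv X φ x * F.metric x (Y.1 x) (Z.1 x) := by
  have hZ := smooth_along (𝒢.smooth_rightField Z) F.smooth
  have hφ : ContMDiff 𝓘(ℝ, EG) 𝓘(ℝ, ℝ) ∞ (fun g => φ (𝒢.src g)) := φ.contMDiff.comp 𝒢.contMDiff_src
  have h1 : along (𝒢.leftField (𝒢.smulSec φ Y).1) (along (𝒢.rightField Z.1) F.toFun) =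
      fun g => φ (𝒢.src g) * along (𝒢.leftField Y.1) (along (𝒢.rightField Z.1) F.toFun) g := by
    funext g
    rw [← along_field_smul (fun g => φ (𝒢.src g))]
    exact along_congr_field (𝒢.leftField_smulSec φ Y g) _
  unfold third
  rw [h1, along_mul (mdiff_real hφ _) (mdiff_real (smooth_along (𝒢.smooth_leftField Y) hZ) _),
    along_left_comp_src 𝒢 X φ.contMDiff, F.along_left_along_right, 𝒢.src_unit, add_comm]

/-! ### Solving linear equations with the metric -/

theorem finiteDimensional_unitTangent (x : M) : FiniteDimensional ℝ (𝒢.UnitTangent x) :=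
  inferInstanceAs (FiniteDimensional ℝ EG)

theorem finiteDimensional_fibre (x : M) : FiniteDimensional ℝ (𝒢.Fibre x) :=
  have := 𝒢.finiteDimensional_unitTangent x
  inferInstance

theorem finrank_fibre (x : M) :
    Module.finrank ℝ (𝒢.Fibre x) + Module.finrank ℝ EM = Module.finrank ℝ EG := by
  have := 𝒢.finiteDimensional_unitTangent x
  have h1 := Submodule.finrank_quotient_add_finrank (𝒢.tangentUnits x)
  have h2 : Module.finrank ℝ (𝒢.tangentUnits x) = Module.finrank ℝ (TangentSpace 𝓘(ℝ, EM) x) :=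
    LinearMap.finrank_range_of_inj
      (Function.LeftInverse.injective (g := 𝒢.dTgt x) (𝒢.dTgt_dUnit x))
  rw [h2] at h1
  exact h1

/-- Division by a locally nonvanishing determinant, carried out inside the ring of global smooth
functions. -/
theorem exists_local_inverse [T2Space M] (d : C^∞⟮𝓘(ℝ, EM), M; 𝓘(ℝ, ℝ), ℝ⟯) {x₀ : M} (hd : d x₀ ≠ 0) :
    ∃ η : C^∞⟮𝓘(ℝ, EM), M; 𝓘(ℝ, ℝ), ℝ⟯, ∀ᶠ x in 𝓝 x₀, η x * d x = 1 := by
  have hU : ∀ᶠ x in 𝓝 x₀, d x ≠ 0 := d.contMDiff.continuous.continuousAt.eventually_ne hd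
  obtain ⟨f, hf1, hfU⟩ := exists_bump (EM := EM) hU
  refine ⟨⟨fun x => f x / d x, fun x => ?_⟩, ?_⟩
  · by_cases hx : x ∈ tsupport f
    · exact (f.contMDiff x).div₀ (d.contMDiff x) (hfU hx)
    · refine (contMDiffAt_const (c := (0 : ℝ))).congr_of_eventuallyEq ?_
      filter_upwards [notMem_tsupport_iff_eventuallyEq.1 hx] with y hy
      rw [hy]
      exact zero_div _
  · filter_upwards [hf1, hU] with x h1 h2
    change f x / d x * d x = 1
    rw [h1, one_div_mul_cancel h2]

theorem sum_smulSec_apply {r : ℕ} (c : Fin r → C^∞⟮𝓘(ℝ, EM), M; 𝓘(ℝ, ℝ), ℝ⟯) (Z : Fin r → 𝒢.Sec)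
    (x : M) : (∑ j, 𝒢.smulSec (c j) (Z j)).1 x = ∑ j, c j x • (Z j).1 x := by
  have h : (∑ j, 𝒢.smulSec (c j) (Z j)).1 = ∑ j, (𝒢.smulSec (c j) (Z j)).1 :=
    map_sum 𝒢.Sec.subtype _ _
  rw [h, Finset.sum_apply]
  rfl

namespace ContrastFunction

variable {𝒢} (F : 𝒢.ContrastFunction)

theorem transMetric_symm (x : M) (a b : F.Transversal x) :
    F.transMetric x a b = F.transMetric x b a := by
  obtain ⟨e, rfl⟩ := (F.kernel x).mkQ_surjective a
  obtain ⟨e', rfl⟩ := (F.kernel x).mkQ_surjective b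
  rw [transMetric_mk, transMetric_mk, metric_symm]

theorem eq_zero_of_transMetric {x : M} {a : F.Transversal x}
    (h : ∀ e : 𝒢.Fibre x, F.transMetric x a ((F.kernel x).mkQ e) = 0) : a = 0 := by
  obtain ⟨e, rfl⟩ := (F.kernel x).mkQ_surjective a
  rw [Submodule.mkQ_apply, Submodule.Quotient.mk_eq_zero]
  exact LinearMap.mem_ker.2 (LinearMap.ext fun e' => (F.transMetric_mk x e e').symm.trans (h e'))

/-- Nondegeneracy of the transversal metric. -/
theorem transMetric_ext [T2Space M] {x : M} {a b : F.Transversal x}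
    (h : ∀ Z : 𝒢.Sec, F.transMetric x a ((F.bar Z).1 x) = F.transMetric x b ((F.bar Z).1 x)) :
    a = b := by
  rw [← sub_eq_zero]
  refine F.eq_zero_of_transMetric fun e => ?_
  obtain ⟨Z, rfl⟩ := 𝒢.exists_section x e
  rw [map_sub, LinearMap.sub_apply, sub_eq_zero]
  exact h Z

theorem finrank_transversal_eq (hF : F.IsRegular) (x y : M) :
    Module.finrank ℝ (F.Transversal x) = Module.finrank ℝ (F.Transversal y) := by
  obtain ⟨r, hr⟩ := hF
  have := 𝒢.finiteDimensional_fibre x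
  have := 𝒢.finiteDimensional_fibre y
  have h1 : Module.finrank ℝ (F.Transversal x) + _ = _ :=
    Submodule.finrank_quotient_add_finrank (F.kernel x)
  have h2 : Module.finrank ℝ (F.Transversal y) + _ = _ :=
    Submodule.finrank_quotient_add_finrank (F.kernel y)
  have h3 := 𝒢.finrank_fibre x
  have h4 := 𝒢.finrank_fibre y
  rw [hr] at h1 h2
  omega

/-- If the Gram determinant of elements of `E_x` is nonzero, their classes are linearly independent. -/
theorem linearIndependent_of_gram {x : M} {r : ℕ} {e : Fin r → 𝒢.Fibre x}
    (h : (Matrix.of fun i j => F.metric x (e j) (e i)).det ≠ 0) :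
    LinearIndependent ℝ fun i => (F.kernel x).mkQ (e i) := by
  rw [Fintype.linearIndependent_iff]
  intro v hv
  by_contra hne
  push Not at hne
  refine h (Matrix.exists_mulVec_eq_zero_iff.1 ⟨v, fun h0 => ?_, ?_⟩)
  · obtain ⟨i, hi⟩ := hne
    exact hi (congrFun h0 i)
  · funext i
    have h1 : F.transMetric x (∑ j, v j • (F.kernel x).mkQ (e j)) ((F.kernel x).mkQ (e i)) = 0 := by
      rw [hv, map_zero, LinearMap.zero_apply]
    simp only [map_sum, map_smul, LinearMap.sum_apply, LinearMap.smul_apply, transMetric_mk] at h1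
    simpa [Matrix.mulVec, dotProduct, mul_comm] using h1

/-- A null vector of the Gram matrix would be the coordinate vector of a nonzero element orthogonal
to a basis of `L_x`, contrary to nondegeneracy. -/
theorem gram_det_ne_zero {x : M} {r : ℕ} {e : Fin r → 𝒢.Fibre x}
    (b : Module.Basis (Fin r) ℝ (F.Transversal x)) (he : ∀ i, (F.kernel x).mkQ (e i) = b i) :
    (Matrix.of fun i j => F.metric x (e j) (e i)).det ≠ 0 := by
  intro h
  obtain ⟨v, hv0, hv⟩ := Matrix.exists_mulVec_eq_zero_iff.2 h
  have h1 : ∀ i, F.transMetric x (∑ j, v j • b j) (b i) = 0 := by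
    intro i
    have h2 := congrFun hv i
    simp only [← he, map_sum, map_smul, LinearMap.sum_apply, LinearMap.smul_apply, transMetric_mk]
    simpa [Matrix.mulVec, dotProduct, mul_comm] using h2
  have h2 : F.transMetric x (∑ j, v j • b j) = 0 := b.ext fun i => (h1 i).trans rfl
  have h3 : ∑ j, v j • b j = 0 := F.eq_zero_of_transMetric fun e => by rw [h2]; rfl
  exact hv0 (funext (Fintype.linearIndependent_iff.1 b.linearIndependent v h3))

/-- A smooth family of linear forms on `E` that vanish on `K^F` is represented by the metric. -/
theorem exists_represents [T2Space M] (hF : F.IsRegular) (ℓ : ∀ x, 𝒢.Fibre x →ₗ[ℝ] ℝ)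
    (hℓ : ∀ Z : 𝒢.Sec, ContMDiff 𝓘(ℝ, EM) 𝓘(ℝ, ℝ) ∞ (fun x => ℓ x (Z.1 x)))
    (hker : ∀ x, ∀ e ∈ F.kernel x, ℓ x e = 0) (x₀ : M) :
    ∃ W : 𝒢.Sec, (∀ᶠ x in 𝓝 x₀, F.metric x (W.1 x) = ℓ x) ∧ (ℓ x₀ = 0 → W.1 x₀ = 0) := by
  have := 𝒢.finiteDimensional_fibre x₀
  let b := Module.finBasis ℝ (F.Transversal x₀)
  set r := Module.finrank ℝ (F.Transversal x₀) with hr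
  have hZ : ∀ i, ∃ Z : 𝒢.Sec, (F.kernel x₀).mkQ (Z.1 x₀) = b i := by
    intro i
    obtain ⟨e, he⟩ := (F.kernel x₀).mkQ_surjective (b i)
    obtain ⟨Z, rfl⟩ := 𝒢.exists_section x₀ e
    exact ⟨Z, he⟩
  choose Z hZ using hZ
  -- The Gram matrix is taken over the ring of smooth functions, and the system is solved by
  -- Cramer's rule: `c = η • adj(A) β`, with `η` inverting `det A` near `x₀`.
  let A : Matrix (Fin r) (Fin r) C^∞⟮𝓘(ℝ, EM), M; 𝓘(ℝ, ℝ), ℝ⟯ :=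
    Matrix.of fun i j => ⟨fun x => F.metric x ((Z j).1 x) ((Z i).1 x), F.smooth_metric (Z j) (Z i)⟩
  let β : Fin r → C^∞⟮𝓘(ℝ, EM), M; 𝓘(ℝ, ℝ), ℝ⟯ := fun i => ⟨_, hℓ (Z i)⟩
  have hdet : ∀ x, A.det x = (Matrix.of fun i j => F.metric x ((Z j).1 x) ((Z i).1 x)).det :=
    fun x => (ContMDiffMap.evalRingHom x).map_det A
  have hdet0 : A.det x₀ ≠ 0 := by
    rw [hdet]
    exact F.gram_det_ne_zero b hZ
  obtain ⟨η, hη⟩ := exists_local_inverse A.det hdet0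
  let c : Fin r → C^∞⟮𝓘(ℝ, EM), M; 𝓘(ℝ, ℝ), ℝ⟯ := η • (A.adjugate.mulVec β)
  have hc : ∀ i, ∑ j, A i j * c j = (η * A.det) * β i := by
    have h1 : A.mulVec c = (η * A.det) • β := by
      change A.mulVec (η • _) = _
      rw [Matrix.mulVec_smul, Matrix.mulVec_mulVec, Matrix.mul_adjugate, Matrix.smul_mulVec,
        Matrix.one_mulVec, smul_smul]
    exact fun i => congrFun h1 i
  have hcx : ∀ i x, ∑ j, c j x * F.metric x ((Z j).1 x) ((Z i).1 x) =
      (η x * A.det x) * ℓ x ((Z i).1 x) := by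
    intro i x
    have h1 := congrArg (ContMDiffMap.evalRingHom x) (hc i)
    rw [map_sum, map_mul, map_mul] at h1
    simp only [map_mul] at h1
    refine Eq.trans (Finset.sum_congr rfl fun j _ => ?_) h1
    exact mul_comm _ _
  refine ⟨∑ j, 𝒢.smulSec (c j) (Z j), ?_, ?_⟩
  · filter_upwards [hη] with x hx
    have := 𝒢.finiteDimensional_fibre x
    have hdx : A.det x ≠ 0 := right_ne_zero_of_mul (hx.symm ▸ one_ne_zero)
    rw [hdet] at hdx
    have hli := F.linearIndependent_of_gram hdx
    -- Constant rank is needed here: independent classes span `L_x` near `x₀` because its dimension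
    -- is still `r`.
    have hspan := hli.span_eq_top_of_card_eq_finrank'
      (by rw [Fintype.card_fin, hr, F.finrank_transversal_eq hF])
    rw [sum_smulSec_apply]
    set w := ∑ j, c j x • (Z j).1 x with hw
    have hwZ : ∀ i, F.metric x w ((Z i).1 x) = ℓ x ((Z i).1 x) := by
      intro i
      have h1 := hcx i x
      rw [hx, one_mul] at h1
      rw [← h1, hw]
      simp only [map_sum, map_smul, LinearMap.sum_apply, LinearMap.smul_apply, smul_eq_mul]
    have hle : F.kernel x ≤ LinearMap.ker (F.metric x w - ℓ x) := by
      intro e he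
      rw [LinearMap.mem_ker, LinearMap.sub_apply, hker x e he, F.metric_symm, sub_zero]
      exact LinearMap.congr_fun (LinearMap.mem_ker.1 he) w
    have h0 : (F.kernel x).liftQ (F.metric x w - ℓ x) hle = 0 := by
      refine LinearMap.ext_on_range hspan fun i => ?_
      change F.metric x w ((Z i).1 x) - ℓ x ((Z i).1 x) = 0
      rw [hwZ, sub_self]
    refine sub_eq_zero.1 (LinearMap.ext fun e => ?_)
    exact LinearMap.congr_fun h0 ((F.kernel x).mkQ e)
  -- The coefficients are linear in the values of `ℓ`, so `W` vanishes at `x₀` exactly, not merely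
  -- modulo `K^F`. This lets `exists_kernel_section` attain a prescribed value.
  · intro h0
    rw [sum_smulSec_apply]
    refine Finset.sum_eq_zero fun j _ => ?_
    have h1 : c j x₀ = 0 := by
      change ContMDiffMap.evalRingHom x₀ (η * ∑ i, A.adjugate j i * β i) = 0
      rw [map_mul, map_sum, Finset.sum_eq_zero, mul_zero]
      intro i _
      have h2 : ContMDiffMap.evalRingHom x₀ (β i) = 0 := LinearMap.congr_fun h0 ((Z i).1 x₀)
      rw [map_mul, h2, mul_zero]
    rw [h1, zero_smul]

/-- Every element of `K^F` is the value of a section of `K^F`. -/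
theorem exists_kernel_section [T2Space M] (hF : F.IsRegular) {x₀ : M} {k : 𝒢.Fibre x₀}
    (hk : k ∈ F.kernel x₀) : ∃ Z : 𝒢.Sec, (∀ x, Z.1 x ∈ F.kernel x) ∧ Z.1 x₀ = k := by
  obtain ⟨Z, rfl⟩ := 𝒢.exists_section x₀ k
  -- `Z - W` lies in `K^F` near `x₀`, and `W` vanishes at `x₀` because `g(Z, ·)` does.
  obtain ⟨W, hW, hW0⟩ := F.exists_represents hF (fun x => F.metric x (Z.1 x)) (F.smooth_metric Z)
    (fun x e he => by
      rw [F.metric_symm]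
      exact LinearMap.congr_fun (LinearMap.mem_ker.1 he) _) x₀
  obtain ⟨f, hf1, hfU⟩ := exists_bump (EM := EM) hW
  refine ⟨𝒢.smulSec f (Z - W), fun x => ?_, ?_⟩
  · change f x • (Z.1 x - W.1 x) ∈ F.kernel x
    by_cases hx : x ∈ tsupport f
    · refine Submodule.smul_mem _ _ (LinearMap.mem_ker.2 ?_)
      have h : F.metric x (W.1 x) = F.metric x (Z.1 x) := hfU hx
      rw [map_sub, h, sub_self]
    · have h : f x = 0 := image_eq_zero_of_notMem_tsupport hx
      rw [h, zero_smul]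
      exact Submodule.zero_mem _
  · change f x₀ • (Z.1 x₀ - W.1 x₀) = Z.1 x₀
    rw [hf1.self_of_nhds, one_smul, hW0 (LinearMap.mem_ker.1 hk), sub_zero]

end ContrastFunction

/-! ### Connections -/

theorem anchorDeriv_congr (X : 𝒢.Sec) {f f' : M → ℝ} {x : M} (h : f =ᶠ[𝓝 x] f') :
    𝒢.anchorDeriv X f x = 𝒢.anchorDeriv X f' x :=
  congrArg (fun A : EM →L[ℝ] ℝ => A (𝒢.anchor x (X.1 x))) (h.mfderiv_eq (I := 𝓘(ℝ, EM)))

theorem anchorDeriv_const (X : 𝒢.Sec) (c : ℝ) (x : M) : 𝒢.anchorDeriv X (fun _ => c) x = 0 :=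
  congrArg (fun A : EM →L[ℝ] ℝ => A (𝒢.anchor x (X.1 x))) (mfderiv_const (I := 𝓘(ℝ, EM)))

namespace ContrastFunction

variable {𝒢} {F : 𝒢.ContrastFunction}

/-- Connections are local operators. -/
theorem IsConnection.congr_of_eventuallyEq [T2Space M] {D : 𝒢.Sec → F.TSec → F.TSec}
    (hD : F.IsConnection D) (X : 𝒢.Sec) {σ τ : F.TSec} {x : M} (h : ∀ᶠ y in 𝓝 x, σ.1 y = τ.1 y) :
    (D X σ).1 x = (D X τ).1 x := by
  obtain ⟨f, hf1, hfU⟩ := exists_bump (EM := EM) h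
  have h1 : F.smulTSec f σ = F.smulTSec f τ := by
    refine Subtype.ext (funext fun y => ?_)
    change f y • σ.1 y = f y • τ.1 y
    by_cases hy : y ∈ tsupport f
    · have h2 : σ.1 y = τ.1 y := hfU hy
      rw [h2]
    · have h2 : f y = 0 := image_eq_zero_of_notMem_tsupport hy
      rw [h2, zero_smul, zero_smul]
  have h0 : 𝒢.anchorDeriv X f x = 0 :=
    (𝒢.anchorDeriv_congr X hf1).trans (𝒢.anchorDeriv_const X 1 x)
  have h2 := hD.leibniz f X σ x
  have h3 := hD.leibniz f X τ x
  rw [h0, hf1.self_of_nhds, one_smul, zero_smul, add_zero] at h2 h3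
  rw [← h2, ← h3, h1]

/-- A connection is determined by its values on the classes of sections of `E`. -/
theorem IsConnection.ext [T2Space M] {D D' : 𝒢.Sec → F.TSec → F.TSec} (hD : F.IsConnection D)
    (hD' : F.IsConnection D')
    (h : ∀ X Y x, (D X (F.bar Y)).1 x = (D' X (F.bar Y)).1 x) : D = D' := by
  funext X σ
  refine Subtype.ext (funext fun x => ?_)
  obtain ⟨Y, hY⟩ := σ.2 x
  rw [hD.congr_of_eventuallyEq X (τ := F.bar Y) hY, hD'.congr_of_eventuallyEq X (τ := F.bar Y) hY, h]

/-- Connections form an affine space: the weights sum to one, so the Leibniz term keeps its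
coefficient. -/
theorem IsConnection.half_add {D D' : 𝒢.Sec → F.TSec → F.TSec} (hD : F.IsConnection D)
    (hD' : F.IsConnection D') :
    F.IsConnection (fun X σ => (1 / 2 : ℝ) • (D X σ + D' X σ)) where
  add_left X Y σ := by rw [hD.add_left, hD'.add_left]; module
  smul_left f X σ := by
    rw [hD.smul_left, hD'.smul_left]
    refine Subtype.ext (funext fun x => ?_)
    change (1 / 2 : ℝ) • (f x • (D X σ).1 x + f x • (D' X σ).1 x) =
      f x • ((1 / 2 : ℝ) • ((D X σ).1 x + (D' X σ).1 x))
    module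
  add_right X σ τ := by rw [hD.add_right, hD'.add_right]; module
  leibniz f X σ x := by
    have h1 := hD.leibniz f X σ x
    have h2 := hD'.leibniz f X σ x
    change (1 / 2 : ℝ) • ((D X (F.smulTSec f σ)).1 x + (D' X (F.smulTSec f σ)).1 x) =
      f x • ((1 / 2 : ℝ) • ((D X σ).1 x + (D' X σ).1 x)) + 𝒢.anchorDeriv X f x • σ.1 x
    rw [h1, h2]
    module

theorem metric_eq_zero_right {x : M} {e k : 𝒢.Fibre x} (hk : k ∈ F.kernel x) :
    F.metric x e k = 0 := by
  rw [F.metric_symm]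
  exact LinearMap.congr_fun (LinearMap.mem_ker.1 hk) e

/-! ### Construction of the Koszul connections, for a function `H` that will be `F` or `F*` -/

section Koszul

variable [T2Space M] {H : 𝒢.ContrastFunction} (hmet : ∀ x, H.metric x = F.metric x)
  (hreg : F.IsRegular)
  (hH : ∀ X Y Z : 𝒢.Sec, (∀ x, Z.1 x ∈ F.kernel x) → ∀ x, 𝒢.third X Y Z H.toFun x = 0)
  (hHs : ∀ X Y Z : 𝒢.Sec, (∀ x, Z.1 x ∈ F.kernel x) → ∀ x, 𝒢.third X Y Z H.star.toFun x = 0)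

-- Duality turns the vanishing of the third derivative of `H*` on `K^F` in the last slot into
-- vanishing for `H` in the middle slot; the anchor term is the derivative of the zero function.
include hmet hHs in
theorem third_eq_zero_of_middle_mem_kernel (X Y Z : 𝒢.Sec) (hY : ∀ x, Y.1 x ∈ F.kernel x) (x : M) :
    𝒢.third X Y Z H.toFun x = 0 := by
  have h1 := H.third_add_third_star X Y Z x
  have h2 : (fun y => H.metric y (Y.1 y) (Z.1 y)) = fun _ => 0 := by
    funext y
    rw [hmet, F.metric_symm]
    exact metric_eq_zero_right (hY y)
  rwa [hHs X Z Y hY, h2, anchorDeriv_const, add_zero] at h1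

-- `Y - Y'` lies in `K^F` only near `x`, so it is first cut off by a bump function. The Leibniz term
-- this creates contains `g(Y - Y', Z)` at `x`, which is zero.
include hmet hHs in
theorem third_congr_middle (X : 𝒢.Sec) {Y Y' : 𝒢.Sec} (Z : 𝒢.Sec) {x : M}
    (h : ∀ᶠ y in 𝓝 x, (F.kernel y).mkQ (Y.1 y) = (F.kernel y).mkQ (Y'.1 y)) :
    𝒢.third X Y Z H.toFun x = 𝒢.third X Y' Z H.toFun x := by
  have hK : ∀ᶠ y in 𝓝 x, (Y - Y' : 𝒢.Sec).1 y ∈ F.kernel y := by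
    filter_upwards [h] with y hy
    exact (Submodule.Quotient.eq _).1 hy
  obtain ⟨f, hf1, hfU⟩ := exists_bump (EM := EM) hK
  have hfK : ∀ y, (𝒢.smulSec f (Y - Y')).1 y ∈ F.kernel y := by
    intro y
    change f y • (Y - Y' : 𝒢.Sec).1 y ∈ F.kernel y
    by_cases hy : y ∈ tsupport f
    · exact Submodule.smul_mem _ _ (hfU hy)
    · have h2 : f y = 0 := image_eq_zero_of_notMem_tsupport hy
      rw [h2, zero_smul]
      exact Submodule.zero_mem _
  have h1 := third_eq_zero_of_middle_mem_kernel hmet hHs X _ Z hfK x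
  rw [H.third_smul_middle, hmet, F.metric_symm, metric_eq_zero_right hK.self_of_nhds, mul_zero,
    add_zero, hf1.self_of_nhds, one_mul] at h1
  have h2 := 𝒢.third_add_middle X (Y - Y') Y' Z H.smooth x
  rwa [sub_add_cancel, h1, zero_add] at h2

-- `W` is a smooth local lift of `∇_X σ`. It serves all points near `x₀` and all local lifts `Y` of
-- `σ` at once, which is what makes the pointwise definition of the connection smooth.
include hmet hreg hH hHs in
theorem exists_represents_third (X : 𝒢.Sec) (σ : F.TSec) (x₀ : M) :
    ∃ W : 𝒢.Sec, ∀ᶠ x in 𝓝 x₀, ∀ Y : 𝒢.Sec, (∀ᶠ y in 𝓝 x, σ.1 y = (F.kernel y).mkQ (Y.1 y)) →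
      ∀ Z : 𝒢.Sec, F.metric x (W.1 x) (Z.1 x) = 𝒢.third X Y Z H.toFun x := by
  obtain ⟨Y₀, hY₀⟩ := σ.2 x₀
  obtain ⟨W, hW, -⟩ := F.exists_represents hreg (𝒢.thirdForm X Y₀ H.toFun)
    (fun Z => (𝒢.third_smooth X Y₀ Z H.smooth).congr fun x => 𝒢.thirdForm_apply X Y₀ Z H.smooth x)
    (fun x e he => by
      obtain ⟨Z, hZ, rfl⟩ := F.exists_kernel_section hreg he
      rw [𝒢.thirdForm_apply X Y₀ Z H.smooth, hH X Y₀ Z hZ]) x₀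
  refine ⟨W, ?_⟩
  filter_upwards [hW, eventually_eventually_nhds.2 hY₀] with x hx hYx Y hY Z
  rw [hx, 𝒢.thirdForm_apply X Y₀ Z H.smooth]
  refine third_congr_middle hmet hHs X Z ?_
  filter_upwards [hY, hYx] with y h1 h2
  rw [← h1, ← h2]

include hmet hreg hH hHs in
theorem exists_koszulConnection : ∃ D, F.IsKoszulConnection H.toFun D := by
  choose W hW using exists_represents_third hmet hreg hH hHs
  have hval : ∀ X σ x (Y : 𝒢.Sec), (∀ᶠ y in 𝓝 x, σ.1 y = (F.kernel y).mkQ (Y.1 y)) → ∀ Z : 𝒢.Sec,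
      F.transMetric x ((F.bar (W X σ x)).1 x) ((F.bar Z).1 x) = 𝒢.third X Y Z H.toFun x :=
    fun X σ x Y hY Z => (F.transMetric_mk x _ _).trans ((hW X σ x).self_of_nhds Y hY Z)
  -- The value at `x` uses the lift chosen at `x`. Near `x₀` it agrees, by nondegeneracy, with the
  -- class of the single section `W X σ x₀`, hence it is smooth.
  let D : 𝒢.Sec → F.TSec → F.TSec := fun X σ => ⟨fun x => (F.bar (W X σ x)).1 x, fun x₀ =>
    ⟨W X σ x₀, by
      filter_upwards [hW X σ x₀] with x hx
      obtain ⟨Y, hY⟩ := σ.2 x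
      refine F.transMetric_ext fun Z => ?_
      rw [hval X σ x Y hY Z]
      exact ((F.transMetric_mk x _ _).trans (hx Y hY Z)).symm⟩⟩
  have hD : ∀ X σ x (Y : 𝒢.Sec), (∀ᶠ y in 𝓝 x, σ.1 y = (F.kernel y).mkQ (Y.1 y)) → ∀ Z : 𝒢.Sec,
      F.transMetric x ((D X σ).1 x) ((F.bar Z).1 x) = 𝒢.third X Y Z H.toFun x := hval
  refine ⟨D, ⟨?_, ?_, ?_, ?_⟩, fun X Y Z x => hD X (F.bar Y) x Y (.of_forall fun _ => rfl) Z⟩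
  · intro X X' σ
    refine Subtype.ext (funext fun x => F.transMetric_ext fun Z => ?_)
    obtain ⟨Y, hY⟩ := σ.2 x
    change _ = F.transMetric x ((D X σ).1 x + (D X' σ).1 x) _
    rw [map_add, LinearMap.add_apply, hD _ _ _ Y hY, hD _ _ _ Y hY, hD _ _ _ Y hY,
      third_add_left]
  · intro f X σ
    refine Subtype.ext (funext fun x => F.transMetric_ext fun Z => ?_)
    obtain ⟨Y, hY⟩ := σ.2 x
    change _ = F.transMetric x (f x • (D X σ).1 x) _
    rw [map_smul, LinearMap.smul_apply, hD _ _ _ Y hY, hD _ _ _ Y hY, third_smul_left, smul_eq_mul]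
  · intro X σ τ
    refine Subtype.ext (funext fun x => F.transMetric_ext fun Z => ?_)
    obtain ⟨Y, hY⟩ := σ.2 x
    obtain ⟨Y', hY'⟩ := τ.2 x
    have hYY : ∀ᶠ y in 𝓝 x, (σ + τ).1 y = (F.kernel y).mkQ ((Y + Y' : 𝒢.Sec).1 y) := by
      filter_upwards [hY, hY'] with y h1 h2
      change σ.1 y + τ.1 y = (F.kernel y).mkQ (Y.1 y + Y'.1 y)
      rw [h1, h2, map_add]
    change _ = F.transMetric x ((D X σ).1 x + (D X τ).1 x) _
    rw [map_add, LinearMap.add_apply, hD _ _ _ _ hYY, hD _ _ _ Y hY, hD _ _ _ Y' hY',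
      𝒢.third_add_middle X Y Y' Z H.smooth]
  · intro f X σ x
    refine F.transMetric_ext fun Z => ?_
    obtain ⟨Y, hY⟩ := σ.2 x
    have hfY : ∀ᶠ y in 𝓝 x, (F.smulTSec f σ).1 y = (F.kernel y).mkQ ((𝒢.smulSec f Y).1 y) := by
      filter_upwards [hY] with y h1
      change f y • σ.1 y = (F.kernel y).mkQ (f y • Y.1 y)
      rw [h1, map_smul]
    rw [map_add, LinearMap.add_apply, map_smul, map_smul, LinearMap.smul_apply, LinearMap.smul_apply,
      hD _ _ _ _ hfY, hD _ _ _ Y hY, H.third_smul_middle, hmet, hY.self_of_nhds]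
    simp only [smul_eq_mul]
    congr 2
    exact (F.transMetric_mk x _ _).symm

end Koszul

/-! ### Uniqueness, and the transversal Levi-Civita connection -/

theorem IsKoszulConnection.unique [T2Space M] {f : G → ℝ} {D D' : 𝒢.Sec → F.TSec → F.TSec}
    (hD : F.IsKoszulConnection f D) (hD' : F.IsKoszulConnection f D') : D = D' :=
  hD.isConnection.ext hD'.isConnection fun X Y x => F.transMetric_ext fun Z => by
    rw [hD.eq_third, hD'.eq_third]

/-- The transversal Levi-Civita connection is the mean of the two Koszul connections. -/
theorem isTransversalLeviCivita_half_add [T2Space M] {D D' : 𝒢.Sec → F.TSec → F.TSec}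
    (hD : F.IsKoszulConnection F.toFun D) (hD' : F.IsKoszulConnection F.star.toFun D') :
    F.IsTransversalLeviCivita (fun X σ => (1 / 2 : ℝ) • (D X σ + D' X σ)) where
  isConnection := hD.isConnection.half_add hD'.isConnection
  torsion_free X Y x := by
    refine F.transMetric_ext fun Z => ?_
    have h1 := F.third_sub_third_swap X Y Z x
    have h2 := F.star.third_sub_third_swap X Y Z x
    rw [F.metric_star] at h2
    have h3 := F.transMetric_mk x (𝒢.bracket X Y x) (Z.1 x)
    refine Eq.trans ?_ h3.symm
    change F.transMetric x ((1 / 2 : ℝ) • ((D X (F.bar Y)).1 x + (D' X (F.bar Y)).1 x) -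
      (1 / 2 : ℝ) • ((D Y (F.bar X)).1 x + (D' Y (F.bar X)).1 x)) _ = _
    simp only [map_add, map_sub, map_smul, LinearMap.add_apply, LinearMap.sub_apply,
      LinearMap.smul_apply, smul_eq_mul, hD.eq_third, hD'.eq_third]
    linarith
  metric X σ τ x := by
    obtain ⟨Y, hY⟩ := σ.2 x
    obtain ⟨Z, hZ⟩ := τ.2 x
    -- Duality for `(Y, Z)` and for `(Z, Y)` has the same right side; adding the two gives twice the
    -- metric property of the mean.
    have h1 := F.third_add_third_star X Y Z x
    have h2 := F.third_add_third_star X Z Y x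
    have h3 : (fun y => F.transMetric y (σ.1 y) (τ.1 y)) =ᶠ[𝓝 x]
        fun y => F.metric y (Y.1 y) (Z.1 y) := by
      filter_upwards [hY, hZ] with y hy hz
      rw [hy, hz, transMetric_mk]
    have h4 : (fun y => F.metric y (Z.1 y) (Y.1 y)) = fun y => F.metric y (Y.1 y) (Z.1 y) :=
      funext fun y => F.metric_symm y _ _
    rw [h4] at h2
    rw [𝒢.anchorDeriv_congr X h3]
    change _ = F.transMetric x ((1 / 2 : ℝ) • ((D X σ).1 x + (D' X σ).1 x)) _ +
      F.transMetric x _ ((1 / 2 : ℝ) • ((D X τ).1 x + (D' X τ).1 x))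
    have e1 : σ.1 x = (F.bar Y).1 x := hY.self_of_nhds
    have e2 : τ.1 x = (F.bar Z).1 x := hZ.self_of_nhds
    rw [hD.isConnection.congr_of_eventuallyEq X (τ := F.bar Y) hY,
      hD'.isConnection.congr_of_eventuallyEq X (τ := F.bar Y) hY,
      hD.isConnection.congr_of_eventuallyEq X (τ := F.bar Z) hZ,
      hD'.isConnection.congr_of_eventuallyEq X (τ := F.bar Z) hZ, e1, e2,
      F.transMetric_symm x ((F.bar Y).1 x)]
    simp only [map_add, map_smul, LinearMap.add_apply, LinearMap.smul_apply, smul_eq_mul,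
      hD.eq_third, hD'.eq_third]
    linarith

/-- The difference of two such connections is symmetric in its first two arguments and skew in the
last two, hence zero. Alternating the two symmetries six times returns to the start with the
opposite sign. -/
theorem IsTransversalLeviCivita.unique [T2Space M] {D D' : 𝒢.Sec → F.TSec → F.TSec}
    (hD : F.IsTransversalLeviCivita D) (hD' : F.IsTransversalLeviCivita D') : D = D' := by
  refine hD.isConnection.ext hD'.isConnection fun X Y x => F.transMetric_ext fun Z => ?_
  let a : 𝒢.Sec → 𝒢.Sec → 𝒢.Sec → ℝ := fun X Y Z =>
    F.transMetric x ((D X (F.bar Y)).1 x) ((F.bar Z).1 x) -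
      F.transMetric x ((D' X (F.bar Y)).1 x) ((F.bar Z).1 x)
  have h1 : ∀ X Y Z, a X Y Z = a Y X Z := by
    intro X Y Z
    have e := (hD.torsion_free X Y x).trans (hD'.torsion_free X Y x).symm
    have e' := congrArg (fun u => F.transMetric x u ((F.bar Z).1 x)) e
    simp only [map_sub, LinearMap.sub_apply] at e'
    simp only [a]
    linarith
  have h2 : ∀ X Y Z, a X Y Z = -a X Z Y := by
    intro X Y Z
    have e := (hD.metric X (F.bar Y) (F.bar Z) x).symm.trans (hD'.metric X (F.bar Y) (F.bar Z) x)
    rw [F.transMetric_symm x ((F.bar Y).1 x), F.transMetric_symm x ((F.bar Y).1 x)] at e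
    simp only [a]
    linarith
  have h3 : a X Y Z = 0 := by
    linarith [h1 X Y Z, h2 Y X Z, h1 Y Z X, h2 Z Y X, h1 Z X Y, h2 X Z Y]
  exact sub_eq_zero.1 h3

end ContrastFunction

/-! ### The difference tensor -/

namespace ContrastFunction

variable {𝒢} {F : 𝒢.ContrastFunction}

theorem exists_bar [T2Space M] (x : M) (a : F.Transversal x) : ∃ X : 𝒢.Sec, (F.bar X).1 x = a := by
  obtain ⟨e, rfl⟩ := (F.kernel x).mkQ_surjective a
  obtain ⟨X, rfl⟩ := 𝒢.exists_section x e
  exact ⟨X, rfl⟩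

/-- A cyclically symmetric expression that is tensorial in the last argument defines a unique field of
trilinear forms. -/
theorem existsUnique_trilinearField [T2Space M] (q : 𝒢.Sec → 𝒢.Sec → ∀ x, F.Transversal x)
    (hq : ∀ X Y Z x, F.transMetric x (q X Y x) ((F.bar Z).1 x) =
      F.transMetric x (q Y Z x) ((F.bar X).1 x)) :
    ∃! T : F.TrilinearField, ∀ (X Y Z : 𝒢.Sec) (x : M),
      T x ((F.bar X).1 x) ((F.bar Y).1 x) ((F.bar Z).1 x) =
        F.transMetric x (q X Y x) ((F.bar Z).1 x) := by
  choose s hs using exists_bar (F := F)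
  have hq' : ∀ X Y Z x, F.transMetric x (q X Y x) ((F.bar Z).1 x) =
      F.transMetric x (q Z X x) ((F.bar Y).1 x) := fun X Y Z x => (hq Z X Y x).symm
  -- No linearity of `q` is assumed. Cyclic symmetry moves any slot to the last place, where
  -- linearity and independence of the chosen section `s x a` are evident.
  have h1 : ∀ x a Y Z, F.transMetric x (q (s x a) Y x) ((F.bar Z).1 x) =
      F.transMetric x (q Y Z x) a := fun x a Y Z => by rw [hq, hs]
  have h2 : ∀ x X b Z, F.transMetric x (q X (s x b) x) ((F.bar Z).1 x) =
      F.transMetric x (q Z X x) b := fun x X b Z => by rw [hq', hs]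
  have hext : ∀ x (φ ψ : F.Transversal x →ₗ[ℝ] ℝ),
      (∀ Z : 𝒢.Sec, φ ((F.bar Z).1 x) = ψ ((F.bar Z).1 x)) → φ = ψ := by
    intro x φ ψ h
    refine LinearMap.ext fun c => ?_
    obtain ⟨Z, rfl⟩ := exists_bar x c
    exact h Z
  let T : F.TrilinearField := fun x => LinearMap.mk₂ ℝ
    (fun a b => F.transMetric x (q (s x a) (s x b) x))
    (fun a a' b => hext x _ _ fun Z => by
      rw [LinearMap.add_apply, h1, h1, h1, map_add])
    (fun r a b => hext x _ _ fun Z => by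
      rw [LinearMap.smul_apply, h1, h1, map_smul])
    (fun a b b' => hext x _ _ fun Z => by
      rw [LinearMap.add_apply, h2, h2, h2, map_add])
    (fun r a b => hext x _ _ fun Z => by
      rw [LinearMap.smul_apply, h2, h2, map_smul])
  refine ⟨T, fun X Y Z x => ?_, fun T' hT' => ?_⟩
  · change F.transMetric x (q (s x _) (s x _) x) _ = _
    rw [h1, hq, hs]
    exact (hq' X Y Z x).symm
  · funext x
    refine LinearMap.ext fun a => LinearMap.ext fun b => hext x _ _ fun Z => ?_
    have h3 := hT' (s x a) (s x b) Z x
    rw [hs, hs] at h3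
    exact h3

end ContrastFunction

end LieGroupoid

end

/-- The three-tensor of a Koszul contrast function on a Lie groupoid. -/
theorem theoremt3 {EM M EG G : Type*}
    [NormedAddCommGroup EM] [NormedSpace ℝ EM] [FiniteDimensional ℝ EM]
    [TopologicalSpace M] [T2Space M] [ChartedSpace EM M] [IsManifold 𝓘(ℝ, EM) ∞ M]
    [NormedAddCommGroup EG] [NormedSpace ℝ EG] [FiniteDimensional ℝ EG]
    [TopologicalSpace G] [ChartedSpace EG G] [IsManifold 𝓘(ℝ, EG) ∞ G]
    (𝒢 : LieGroupoid EM M EG G) (F : 𝒢.ContrastFunction) (hF : F.IsKoszul) :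
    (∃! D, F.IsKoszulConnection F.toFun D) ∧
    (∃! D, F.IsKoszulConnection F.star.toFun D) ∧
    (∃! D, F.IsTransversalLeviCivita D) ∧
    ∀ nabla nablaStar nablaG : 𝒢.Sec → F.TSec → F.TSec,
      F.IsKoszulConnection F.toFun nabla →
      F.IsKoszulConnection F.star.toFun nablaStar →
      F.IsTransversalLeviCivita nablaG →
      (∃! T, F.IsDifferenceTensor nabla nablaStar T) ∧
      ∀ T, F.IsDifferenceTensor nabla nablaStar T →
        F.IsSymmetricTensor T ∧
        (∀ (X Y Z : 𝒢.Sec) (x : M),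
          F.transMetric x ((nabla X (F.bar Y)).1 x) ((F.bar Z).1 x) =
            F.transMetric x ((nablaG X (F.bar Y)).1 x) ((F.bar Z).1 x) +
              (1 / 2 : ℝ) * T x ((F.bar X).1 x) ((F.bar Y).1 x) ((F.bar Z).1 x)) ∧
        (∀ (X Y Z : 𝒢.Sec) (x : M),
          F.transMetric x ((nablaStar X (F.bar Y)).1 x) ((F.bar Z).1 x) =
            F.transMetric x ((nablaG X (F.bar Y)).1 x) ((F.bar Z).1 x) -
              (1 / 2 : ℝ) * T x ((F.bar X).1 x) ((F.bar Y).1 x) ((F.bar Z).1 x)) ∧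
        ((∀ g, F.toFun (𝒢.inv g) = F.toFun g) → ∀ x, T x = 0) := by
  obtain ⟨D, hD⟩ := LieGroupoid.ContrastFunction.exists_koszulConnection (H := F) (fun _ => rfl)
    hF.regular hF.third_eq_zero hF.third_star_eq_zero
  obtain ⟨D', hD'⟩ := LieGroupoid.ContrastFunction.exists_koszulConnection (H := F.star)
    F.metric_star hF.regular hF.third_star_eq_zero (by
      rw [F.star_star]
      exact hF.third_eq_zero)
  have hG := LieGroupoid.ContrastFunction.isTransversalLeviCivita_half_add hD hD'
  refine ⟨⟨D, hD, fun _ h => h.unique hD⟩, ⟨D', hD', fun _ h => h.unique hD'⟩,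
    ⟨_, hG, fun _ h => h.unique hG⟩, ?_⟩
  clear! D D'
  intro D D' DG hD hD' hDG
  -- By uniqueness the Levi-Civita connection is the mean of the other two, so the two half-`T`
  -- formulas become linear algebra.
  obtain rfl := hDG.unique
    (LieGroupoid.ContrastFunction.isTransversalLeviCivita_half_add hD hD')
  have hq : ∀ (X Y Z : 𝒢.Sec) (x : M),
      F.transMetric x ((D X (F.bar Y)).1 x - (D' X (F.bar Y)).1 x) ((F.bar Z).1 x) =
        𝒢.third X Y Z F.toFun x - 𝒢.third X Y Z F.star.toFun x := fun X Y Z x => by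
    rw [map_sub, LinearMap.sub_apply, hD.eq_third, hD'.eq_third]
  -- The torsion term `g([X, Y], Z)` is the same for `F` and `F*`, so it drops out of the
  -- difference.
  have hl : ∀ (X Y Z : 𝒢.Sec) (x : M), 𝒢.third X Y Z F.toFun x - 𝒢.third X Y Z F.star.toFun x =
      𝒢.third Y X Z F.toFun x - 𝒢.third Y X Z F.star.toFun x := fun X Y Z x => by
    have h1 := F.third_sub_third_swap X Y Z x
    have h2 := F.star.third_sub_third_swap X Y Z x
    rw [F.metric_star] at h2
    linarith
  -- Subtract the duality for `(Z, Y)` from that for `(Y, Z)`; the metric terms agree by symmetry.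
  have hr : ∀ (X Y Z : 𝒢.Sec) (x : M), 𝒢.third X Y Z F.toFun x - 𝒢.third X Y Z F.star.toFun x =
      𝒢.third X Z Y F.toFun x - 𝒢.third X Z Y F.star.toFun x := fun X Y Z x => by
    have h1 := F.third_add_third_star X Y Z x
    have h2 := F.third_add_third_star X Z Y x
    have h3 : (fun y => F.metric y (Z.1 y) (Y.1 y)) = fun y => F.metric y (Y.1 y) (Z.1 y) :=
      funext fun y => F.metric_symm y _ _
    rw [h3] at h2
    linarith
  refine ⟨LieGroupoid.ContrastFunction.existsUnique_trilinearField
    (fun X Y x => (D X (F.bar Y)).1 x - (D' X (F.bar Y)).1 x)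
    -- The required cyclic shift is the product of the two transpositions `hl` and `hr`.
    fun X Y Z x => by rw [hq, hq, hl, hr], fun T hT => ?_⟩
  have hT' : ∀ (X Y Z : 𝒢.Sec) (x : M), T x ((F.bar X).1 x) ((F.bar Y).1 x) ((F.bar Z).1 x) =
      𝒢.third X Y Z F.toFun x - 𝒢.third X Y Z F.star.toFun x :=
    fun X Y Z x => (hT X Y Z x).trans (hq X Y Z x)
  refine ⟨⟨fun σ τ υ x₀ => ?_, fun x a b c => ?_, fun x a b c => ?_⟩, fun X Y Z x => ?_,
    fun X Y Z x => ?_, fun hinv x => ?_⟩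
  · obtain ⟨X, hX⟩ := σ.2 x₀
    obtain ⟨Y, hY⟩ := τ.2 x₀
    obtain ⟨Z, hZ⟩ := υ.2 x₀
    refine (((𝒢.third_smooth X Y Z F.smooth) x₀).sub
      ((𝒢.third_smooth X Y Z F.star.smooth) x₀)).congr_of_eventuallyEq ?_
    filter_upwards [hX, hY, hZ] with x h1 h2 h3
    rw [h1, h2, h3]
    exact hT' X Y Z x
  · obtain ⟨X, rfl⟩ := LieGroupoid.ContrastFunction.exists_bar x a
    obtain ⟨Y, rfl⟩ := LieGroupoid.ContrastFunction.exists_bar x b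
    obtain ⟨Z, rfl⟩ := LieGroupoid.ContrastFunction.exists_bar x c
    rw [hT', hT', hl]
  · obtain ⟨X, rfl⟩ := LieGroupoid.ContrastFunction.exists_bar x a
    obtain ⟨Y, rfl⟩ := LieGroupoid.ContrastFunction.exists_bar x b
    obtain ⟨Z, rfl⟩ := LieGroupoid.ContrastFunction.exists_bar x c
    rw [hT', hT', hr]
  · change _ = F.transMetric x ((1 / 2 : ℝ) • ((D X (F.bar Y)).1 x + (D' X (F.bar Y)).1 x)) _ + _
    rw [hT X Y Z x]
    simp only [map_add, map_sub, map_smul, LinearMap.add_apply, LinearMap.sub_apply,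
      LinearMap.smul_apply, smul_eq_mul]
    ring
  · change _ = F.transMetric x ((1 / 2 : ℝ) • ((D X (F.bar Y)).1 x + (D' X (F.bar Y)).1 x)) _ - _
    rw [hT X Y Z x]
    simp only [map_add, map_sub, map_smul, LinearMap.add_apply, LinearMap.sub_apply,
      LinearMap.smul_apply, smul_eq_mul]
    ring
  · have hstar : F.star.toFun = F.toFun := funext hinv
    refine LinearMap.ext fun a => LinearMap.ext fun b => LinearMap.ext fun c => ?_
    obtain ⟨X, rfl⟩ := LieGroupoid.ContrastFunction.exists_bar x a
    obtain ⟨Y, rfl⟩ := LieGroupoid.ContrastFunction.exists_bar x b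
    obtain ⟨Z, rfl⟩ := LieGroupoid.ContrastFunction.exists_bar x c
    rw [hT', hstar, sub_self]
    rfl
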